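/- **Theorem 4.3 (convergence on the coarse grid).** *Problem.* Let $T>0$, $\Omega=(l_x,r_x)\times(l_y,r_y)$, and let $u$ solve $$\int_0^t k(t-s)\,\partial_s^2u(\cdot,s)\,ds-\Delta u=f(u)\ \text{ in }\Omega\times(0,T],\qquad k(t)=\frac{t^{1-\alpha(t)}}{\Gamma(2-\alpha(t))},$$ with $u(\cdot,0)=u_0$, $\partial_tu(\cdot,0)=\bar u_0$ on $\bar\Omega$ and $u=0$ on $\partial\Omega\times[0,T]$. Here $f\in C^2(\mathbb R)$ with $|f'|\le Q_f$, and on $[0,T]$ the exponent satisfies $1<\alpha(t)<2$, is three times differentiable with $|\alpha'|+|\alpha''|+|\alpha'''|\le Q_\alpha$, and $\alpha'(0)=0$. Put $\alpha_0=\alpha(0)$, $\bar\alpha=\alpha_0-1$, $Q_L=\sqrt{(r_x-l_x)(r_y-l_y)}$, $\beta_{\bar\alpha}(t)=t^{\bar\alpha-1}/\Gamma(\bar\alpha)$, and $g(0)=1$, $g(t)=\int_0^t\beta_{\bar\alpha}(t-s)k(s)\,ds$ for $t>0$. *Regularity, with a constant $C$, for $\chi=x,y$.* (A1) $\partial_tu$,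 $\partial_t\partial_\chi^2u$, $\partial_\chi^6u$ exist and are continuous on $\bar\Omega\times[0,T]$, and $|\partial_tu|\le Ct^{\alpha_0-1}$, $|\partial_t\partial_\chi^2u|\le Ct^{\alpha_0-1}$, $|\partial_\chi^6u|\le C$ on $\bar\Omega\times(0,T]$. (A2) $\partial_t^2u$, $\partial_t^3u$, $\partial_t^2\partial_\chi^2u$ exist and are continuous on $\bar\Omega\times(0,T]$, and there $|\partial_t^2u|\le Ct^{\alpha_0-2}$, $|\partial_t^3u|\le Ct^{\alpha_0-3}$, $|\partial_t^2\partial_\chi^2u|\le Ct^{\alpha_0-2}$. *Scheme.* For positive integers $N,M_x,M_y$ let $\tau=T/N$, $t_n=n\tau$, $H_x=(r_x-l_x)/M_x$, $H_y=(r_y-l_y)/M_y$, $x_i=l_x+iH_x$, $y_j=l_y+jH_y$. For a grid function $v=(v_{i,j})$, $0\le i\le M_x$, $0\le j\le M_y$, let $\mathcal A_xv_{i,j}=\frac1{12}(v_{i-1,j}+10v_{i,j}+v_{i+1,j})$ if $0<i<M_x$ and $\mathcal A_xv_{i,j}=v_{i,j}$ if $i\in\{0,M_x\}$, $\delta_x^2v_{i,j}=(v_{i+1,j}-2v_{i,j}+v_{i-1,j})/H_x^2$,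 define $\mathcal A_y,\delta_y^2$ likewise in the index $j$, and let $\mathcal A=\mathcal A_x\mathcal A_y$, $\Lambda=\mathcal A_y\delta_x^2+\mathcal A_x\delta_y^2$, $\|v\|_H^2=H_xH_y\sum_{i=1}^{M_x-1}\sum_{j=1}^{M_y-1}v_{i,j}^2$. Let $\delta_tU^n=(U^n-U^{n-1})/\tau$, $U^{n-1/2}=\frac12(U^n+U^{n-1})$, $$\lambda_{n,j}=\frac1\tau\int_{t_{n-1}}^{t_n}\int_{t_{j-1}}^{\min\{t,t_j\}}\beta_{\bar\alpha}(t-s)\,ds\,dt,\qquad b^n_{i,j}=\frac1\tau\int_{t_{n-1}}^{t_n}g(t)\,\bar u_0(x_i,y_j)\,dt,$$ $w_k=g(t_{k+1})-g(t_k)$, $\tilde w_k=\frac12(w_k+w_{k-1})$ for $k\ge1$, $c_0=1+\frac{w_0}2$, $\tilde\lambda_{n,1}=\lambda_{n,1}+\frac12\lambda_{n,2}$, and $\tilde\lambda_{n,k}=\frac12(\lambda_{n,k+1}+\lambda_{n,k})$ for $2\le k\le n-1$. A solution $U_H$ of the coarse-grid nonlinear compact scheme satisfies, for $1\le i\le M_x-1$,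 $1\le j\le M_y-1$ (indices suppressed), $$c_0\mathcal A\delta_tU_H^1-\lambda_{1,1}\Lambda U_H^1=\lambda_{1,1}\mathcal Af(U_H^1)+\mathcal Ab^1,$$ $$c_0\mathcal A\delta_tU_H^n+\sum_{k=1}^{n-1}\tilde w_{n-k}\mathcal A\delta_tU_H^k-\lambda_{n,1}\Lambda U_H^1-\sum_{m=2}^n\lambda_{n,m}\Lambda U_H^{m-1/2}=\frac{\lambda_{n,n}}2\mathcal Af(U_H^n)+\sum_{k=1}^{n-1}\tilde\lambda_{n,k}\mathcal Af(U_H^k)+\mathcal Ab^n\quad(2\le n\le N),$$ with $[U_H]^0_{i,j}=u_0(x_i,y_j)$ at the interior grid points and $[U_H]^n_{i,j}=0$ at the boundary grid points for $0\le n\le N$. *Claim.* (i) For every such $\alpha$ there is a constant $Q_g>0$ with $|g|\le Q_g$ and $|g'|\le Q_g$ on $[0,T]$ and $|g''(t)|\le Q_g(|\ln t|+1)$ on $(0,T]$ (these derivatives exist). (ii) There are $Q>0$ and $\delta>0$, depending only on $T,\bar\alpha,Q_g,Q_f,Q_L$, on the constant $C$ of (A1)–(A2), and on a bound $K_f$ for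 $|f''(u)|$ on $\bar\Omega\times[0,T]$, such that, whenever (A1)–(A2) hold, $Q_g$ is as in (i), and $\tau,H_x,H_y\le\delta$, every solution $U_H$ of the scheme satisfies $$\|u^n-U_H^n\|_H\le Q\,(\tau^2+H_x^4+H_y^4),\qquad 1\le n\le N,$$ where $u^n_{i,j}=u(x_i,y_j,t_n)$. That is, the scheme is second-order accurate in time, with no reduction of order caused by the variable exponent, and fourth-order accurate in space. -/

import Mathlib

open Set

noncomputable section

namespace DiffusionWave

/-! ### The continuous problem -/

/-- An open rectangle `Ω = (lx, rx) × (ly, ry)`. -/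
structure Rectangle where
  lx : ℝ
  rx : ℝ
  ly : ℝ
  ry : ℝ
  hx : lx < rx
  hy : ly < ry

/-- The points of the open rectangle `Ω`. -/
def Rectangle.inner (D : Rectangle) : Set (ℝ × ℝ) := Ioo D.lx D.rx ×ˢ Ioo D.ly D.ry

/-- The points of the closed rectangle. -/
def Rectangle.closed (D : Rectangle) : Set (ℝ × ℝ) := Icc D.lx D.rx ×ˢ Icc D.ly D.ry

/-- The boundary of the rectangle. -/
def Rectangle.bdry (D : Rectangle) : Set (ℝ × ℝ) := D.closed \ D.inner

/-- The Abel kernel `β_a(t) = t^(a-1) / Γ(a)`. -/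
def abelKernel (a t : ℝ) : ℝ := t ^ (a - 1) / Real.Gamma a

/-- The variable-exponent kernel `k(t) = t^(1-α(t)) / Γ(2-α(t))`. -/
def varKernel (α : ℝ → ℝ) (t : ℝ) : ℝ := t ^ (1 - α t) / Real.Gamma (2 - α t)

/-- The generalized identity function `g = β_{α(0)-1} * k`, with the value `g(0) = 1`, which is the
limit of the convolution integral as `t → 0+`. -/
def genIdentity (α : ℝ → ℝ) (t : ℝ) : ℝ :=
  if t = 0 then 1 else ∫ s in (0 : ℝ)..t, abelKernel (α 0 - 1) (t - s) * varKernel α s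

/-- The conditions on the exponent on `[0, T]`: values in `(1, 2)`, three times differentiable with
`|α'| + |α''| + |α'''| ≤ Qα`, and `α'(0) = 0`. -/
structure IsAdmissibleExponent (T Qα : ℝ) (α : ℝ → ℝ) : Prop where
  range : ∀ t ∈ Icc 0 T, 1 < α t ∧ α t < 2
  diff : ∀ k < 3, DifferentiableOn ℝ (iteratedDerivWithin k α (Icc 0 T)) (Icc 0 T)
  bound : ∀ t ∈ Icc 0 T, |iteratedDerivWithin 1 α (Icc 0 T) t|
    + |iteratedDerivWithin 2 α (Icc 0 T) t| + |iteratedDerivWithin 3 α (Icc 0 T) t| ≤ Qα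
  deriv_zero : iteratedDerivWithin 1 α (Icc 0 T) 0 = 0

/-- `Qg` is an admissible value of the constant that controls `g` on `[0, T]`:
`|g| ≤ Qg` and `|g'| ≤ Qg` on `[0, T]`, and `|g''(t)| ≤ Qg (|ln t| + 1)` on `(0, T]`. -/
structure IsKernelConstant (T : ℝ) (α : ℝ → ℝ) (Qg : ℝ) : Prop where
  bound_zero : ∀ t ∈ Icc 0 T, |genIdentity α t| ≤ Qg
  diff_one : DifferentiableOn ℝ (genIdentity α) (Icc 0 T)
  bound_one : ∀ t ∈ Icc 0 T, |derivWithin (genIdentity α) (Icc 0 T) t| ≤ Qg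
  diff_two : ∀ t ∈ Ioc 0 T,
    DifferentiableWithinAt ℝ (derivWithin (genIdentity α) (Icc 0 T)) (Icc 0 T) t
  bound_two : ∀ t ∈ Ioc 0 T,
    |derivWithin (derivWithin (genIdentity α) (Icc 0 T)) (Icc 0 T) t| ≤ Qg * (|Real.log t| + 1)

/-- The conditions on the nonlinearity: `f ∈ C²(ℝ)` with `|f'| ≤ Qf`. -/
structure IsAdmissibleSource (Qf : ℝ) (f : ℝ → ℝ) : Prop where
  smooth : ContDiff ℝ 2 f
  bound : ∀ v, |deriv f v| ≤ Qf

/-- The partial derivative `∂_x`, one-sided at the ends of `[lx, rx]`. -/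
def Rectangle.dx (D : Rectangle) (v : ℝ → ℝ → ℝ → ℝ) : ℝ → ℝ → ℝ → ℝ :=
  fun x y t => derivWithin (fun ξ => v ξ y t) (Icc D.lx D.rx) x

/-- The partial derivative `∂_y`, one-sided at the ends of `[ly, ry]`. -/
def Rectangle.dy (D : Rectangle) (v : ℝ → ℝ → ℝ → ℝ) : ℝ → ℝ → ℝ → ℝ :=
  fun x y t => derivWithin (fun η => v x η t) (Icc D.ly D.ry) y

/-- The partial derivative `∂_t`, one-sided at the ends of `[0, T]`. -/
def dt (T : ℝ) (v : ℝ → ℝ → ℝ → ℝ) : ℝ → ℝ → ℝ → ℝ :=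
  fun x y t => derivWithin (fun s => v x y s) (Icc 0 T) t

/-- The derivative `∂_x v` exists at all points of the closed rectangle and all times in `I`. -/
def HasDx (D : Rectangle) (I : Set ℝ) (v : ℝ → ℝ → ℝ → ℝ) : Prop :=
  ∀ x y t, (x, y) ∈ D.closed → t ∈ I →
    DifferentiableWithinAt ℝ (fun ξ => v ξ y t) (Icc D.lx D.rx) x

/-- The derivative `∂_y v` exists at all points of the closed rectangle and all times in `I`. -/
def HasDy (D : Rectangle) (I : Set ℝ) (v : ℝ → ℝ → ℝ → ℝ) : Prop :=
  ∀ x y t, (x, y) ∈ D.closed → t ∈ I →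
    DifferentiableWithinAt ℝ (fun η => v x η t) (Icc D.ly D.ry) y

/-- The derivative `∂_t v` exists at all points of the closed rectangle and all times in `I`. -/
def HasDt (D : Rectangle) (T : ℝ) (I : Set ℝ) (v : ℝ → ℝ → ℝ → ℝ) : Prop :=
  ∀ x y t, (x, y) ∈ D.closed → t ∈ I →
    DifferentiableWithinAt ℝ (fun s => v x y s) (Icc 0 T) t

/-- Joint continuity of `v` on (closed rectangle) × `I`. -/
def JointlyContinuous (D : Rectangle) (I : Set ℝ) (v : ℝ → ℝ → ℝ → ℝ) : Prop :=
  ContinuousOn (fun p : (ℝ × ℝ) × ℝ => v p.1.1 p.1.2 p.2) (D.closed ×ˢ I)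

/-- `|v(x, y, t)| ≤ C t^r` on (closed rectangle) × `(0, T]`. -/
def PowerBound (D : Rectangle) (T C r : ℝ) (v : ℝ → ℝ → ℝ → ℝ) : Prop :=
  ∀ x y t, (x, y) ∈ D.closed → t ∈ Ioc 0 T → |v x y t| ≤ C * t ^ r

/-- Regularity (A1), with constant `C`. -/
structure RegularityA1 (D : Rectangle) (T α₀ C : ℝ) (u : ℝ → ℝ → ℝ → ℝ) : Prop where
  has_t : HasDt D T (Icc 0 T) u
  has_x : ∀ k < 6, HasDx D (Icc 0 T) (D.dx^[k] u)
  has_y : ∀ k < 6, HasDy D (Icc 0 T) (D.dy^[k] u)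
  has_txx : HasDt D T (Icc 0 T) (D.dx^[2] u)
  has_tyy : HasDt D T (Icc 0 T) (D.dy^[2] u)
  cont_t : JointlyContinuous D (Icc 0 T) (dt T u)
  cont_x : JointlyContinuous D (Icc 0 T) (D.dx^[6] u)
  cont_y : JointlyContinuous D (Icc 0 T) (D.dy^[6] u)
  cont_txx : JointlyContinuous D (Icc 0 T) (dt T (D.dx^[2] u))
  cont_tyy : JointlyContinuous D (Icc 0 T) (dt T (D.dy^[2] u))
  bound_t : PowerBound D T C (α₀ - 1) (dt T u)
  bound_x : PowerBound D T C 0 (D.dx^[6] u)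
  bound_y : PowerBound D T C 0 (D.dy^[6] u)
  bound_txx : PowerBound D T C (α₀ - 1) (dt T (D.dx^[2] u))
  bound_tyy : PowerBound D T C (α₀ - 1) (dt T (D.dy^[2] u))

/-- Regularity (A2), with constant `C`. -/
structure RegularityA2 (D : Rectangle) (T α₀ C : ℝ) (u : ℝ → ℝ → ℝ → ℝ) : Prop where
  has_tt : HasDt D T (Ioc 0 T) (dt T u)
  has_ttt : HasDt D T (Ioc 0 T) ((dt T)^[2] u)
  has_ttxx : HasDt D T (Ioc 0 T) (dt T (D.dx^[2] u))
  has_ttyy : HasDt D T (Ioc 0 T) (dt T (D.dy^[2] u))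
  cont_tt : JointlyContinuous D (Ioc 0 T) ((dt T)^[2] u)
  cont_ttt : JointlyContinuous D (Ioc 0 T) ((dt T)^[3] u)
  cont_ttxx : JointlyContinuous D (Ioc 0 T) ((dt T)^[2] (D.dx^[2] u))
  cont_ttyy : JointlyContinuous D (Ioc 0 T) ((dt T)^[2] (D.dy^[2] u))
  bound_tt : PowerBound D T C (α₀ - 2) ((dt T)^[2] u)
  bound_ttt : PowerBound D T C (α₀ - 3) ((dt T)^[3] u)
  bound_ttxx : PowerBound D T C (α₀ - 2) ((dt T)^[2] (D.dx^[2] u))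
  bound_ttyy : PowerBound D T C (α₀ - 2) ((dt T)^[2] (D.dy^[2] u))

/-- `u` solves the initial-boundary value problem for the nonlinear variable-exponent
diffusion-wave equation `∫_0^t k(t-s) ∂_s² u(s) ds - Δu = f(u)` in `Ω × (0, T]`. -/
structure IsSolution (D : Rectangle) (T : ℝ) (α f : ℝ → ℝ) (u₀ v₀ : ℝ → ℝ → ℝ)
    (u : ℝ → ℝ → ℝ → ℝ) : Prop where
  equation : ∀ x y t, (x, y) ∈ D.inner → t ∈ Ioc 0 T →
    (∫ s in (0 : ℝ)..t, varKernel α (t - s) * (dt T)^[2] u x y s)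
      - (D.dx^[2] u x y t + D.dy^[2] u x y t) = f (u x y t)
  initial : ∀ x y, (x, y) ∈ D.closed → u x y 0 = u₀ x y
  initial_deriv : ∀ x y, (x, y) ∈ D.closed → dt T u x y 0 = v₀ x y
  boundary : ∀ x y t, (x, y) ∈ D.bdry → t ∈ Icc 0 T → u x y t = 0

/-! ### The discretization

Grid functions are functions `v i j` of two indices, of which only `0 ≤ i ≤ Mx`, `0 ≤ j ≤ My`
matter. A space-time grid function is written `U n i j`, with `n` the time level. -/

/-- The step size `(rx - lx) / Mx`. -/
def Rectangle.stepX (D : Rectangle) (Mx : ℕ) : ℝ := (D.rx - D.lx) / Mx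

/-- The step size `(ry - ly) / My`. -/
def Rectangle.stepY (D : Rectangle) (My : ℕ) : ℝ := (D.ry - D.ly) / My

/-- The grid point `x_i = lx + i Hx`. -/
def Rectangle.ptX (D : Rectangle) (Mx i : ℕ) : ℝ := D.lx + i * D.stepX Mx

/-- The grid point `y_j = ly + j Hy`. -/
def Rectangle.ptY (D : Rectangle) (My j : ℕ) : ℝ := D.ly + j * D.stepY My

/-- The compact averaging operator `𝒜_x`. -/
def avgX (Mx : ℕ) (v : ℕ → ℕ → ℝ) : ℕ → ℕ → ℝ := fun i j =>
  if 0 < i ∧ i < Mx then (v (i - 1) j + 10 * v i j + v (i + 1) j) / 12 else v i j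

/-- The compact averaging operator `𝒜_y`. -/
def avgY (My : ℕ) (v : ℕ → ℕ → ℝ) : ℕ → ℕ → ℝ := fun i j =>
  if 0 < j ∧ j < My then (v i (j - 1) + 10 * v i j + v i (j + 1)) / 12 else v i j

/-- The second difference quotient `δ_x²`, meant for `1 ≤ i ≤ Mx - 1`. -/
def diffX (h : ℝ) (v : ℕ → ℕ → ℝ) : ℕ → ℕ → ℝ := fun i j =>
  (v (i + 1) j - 2 * v i j + v (i - 1) j) / h ^ 2

/-- The second difference quotient `δ_y²`, meant for `1 ≤ j ≤ My - 1`. -/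
def diffY (h : ℝ) (v : ℕ → ℕ → ℝ) : ℕ → ℕ → ℝ := fun i j =>
  (v i (j + 1) - 2 * v i j + v i (j - 1)) / h ^ 2

/-- `𝒜 = 𝒜_x 𝒜_y`. -/
def avg (Mx My : ℕ) (v : ℕ → ℕ → ℝ) : ℕ → ℕ → ℝ := avgX Mx (avgY My v)

/-- `Λ = 𝒜_y δ_x² + 𝒜_x δ_y²`. -/
def Rectangle.lap (D : Rectangle) (Mx My : ℕ) (v : ℕ → ℕ → ℝ) : ℕ → ℕ → ℝ := fun i j =>
  avgY My (diffX (D.stepX Mx) v) i j + avgX Mx (diffY (D.stepY My) v) i j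

/-- The discrete `L²` norm `(Hx Hy ∑_{i=1}^{Mx-1} ∑_{j=1}^{My-1} v_{ij}²)^{1/2}`. -/
def Rectangle.gridNorm (D : Rectangle) (Mx My : ℕ) (v : ℕ → ℕ → ℝ) : ℝ :=
  Real.sqrt (D.stepX Mx * D.stepY My *
    ∑ i ∈ Finset.Ioo 0 Mx, ∑ j ∈ Finset.Ioo 0 My, v i j * v i j)

/-- The weights `λ_{n,j}`, `1 ≤ j ≤ n`, of the averaged product integration rule, where
`t_n = n τ`. -/
def piWeight (a τ : ℝ) (n j : ℕ) : ℝ :=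
  (1 / τ) * ∫ t in (((n : ℝ) - 1) * τ)..((n : ℝ) * τ),
    ∫ s in (((j : ℝ) - 1) * τ)..(min t ((j : ℝ) * τ)), abelKernel a (t - s)

/-- The averaged product integration rule
`ℑ^n φ = λ_{n,1} φ^1 + ∑_{j=2}^n λ_{n,j} (φ^j + φ^{j-1}) / 2`. -/
def piRule (a τ : ℝ) (n : ℕ) (φ : ℕ → ℝ) : ℝ :=
  piWeight a τ n 1 * φ 1
    + ∑ j ∈ Finset.Icc 2 n, piWeight a τ n j * ((φ j + φ (j - 1)) / 2)

/-- The weights `λ̃_{n,k}`, `1 ≤ k ≤ n - 1`, of the nonlinear term. -/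
def piWeightTilde (a τ : ℝ) (n k : ℕ) : ℝ :=
  if k = 1 then piWeight a τ n 1 + piWeight a τ n 2 / 2
  else (piWeight a τ n (k + 1) + piWeight a τ n k) / 2

/-- `w_k = g(t_{k+1}) - g(t_k)`. -/
def gWeight (α : ℝ → ℝ) (τ : ℝ) (k : ℕ) : ℝ :=
  genIdentity α (((k : ℝ) + 1) * τ) - genIdentity α ((k : ℝ) * τ)

/-- `w̃_k = (w_k + w_{k-1}) / 2` for `k ≥ 1`. -/
def gWeightTilde (α : ℝ → ℝ) (τ : ℝ) (k : ℕ) : ℝ := (gWeight α τ k + gWeight α τ (k - 1)) / 2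

/-- `c_0 = 1 + w_0 / 2`. -/
def leadCoeff (α : ℝ → ℝ) (τ : ℝ) : ℝ := 1 + gWeight α τ 0 / 2

/-- The backward difference quotient `δ_t U^n = (U^n - U^{n-1}) / τ`, meant for `n ≥ 1`. -/
def diffT (τ : ℝ) (U : ℕ → ℕ → ℕ → ℝ) (n : ℕ) : ℕ → ℕ → ℝ := fun i j =>
  (U n i j - U (n - 1) i j) / τ

/-- `b^n_{ij} = (1/τ) ∫_{t_{n-1}}^{t_n} g(t) v₀(x_i, y_j) dt`. -/
def Rectangle.load (D : Rectangle) (Mx My : ℕ) (α : ℝ → ℝ) (τ : ℝ) (v₀ : ℝ → ℝ → ℝ) (n : ℕ) :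
    ℕ → ℕ → ℝ := fun i j =>
  (1 / τ) * ∫ t in (((n : ℝ) - 1) * τ)..((n : ℝ) * τ),
    genIdentity α t * v₀ (D.ptX Mx i) (D.ptY My j)

/-- `U` solves the nonlinear compact difference scheme on the grid with `Mx × My` cells and time
levels `t_n = n τ`, `0 ≤ n ≤ N`, `τ = T / N`. -/
structure IsSchemeSolution (D : Rectangle) (T : ℝ) (α f : ℝ → ℝ) (u₀ v₀ : ℝ → ℝ → ℝ)
    (N Mx My : ℕ) (U : ℕ → ℕ → ℕ → ℝ) : Prop where
  first : ∀ i j, 0 < i → i < Mx → 0 < j → j < My →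
    leadCoeff α (T / N) * avg Mx My (diffT (T / N) U 1) i j
        - piWeight (α 0 - 1) (T / N) 1 1 * D.lap Mx My (U 1) i j
      = piWeight (α 0 - 1) (T / N) 1 1 * avg Mx My (fun i j => f (U 1 i j)) i j
        + avg Mx My (D.load Mx My α (T / N) v₀ 1) i j
  later : ∀ n, 2 ≤ n → n ≤ N → ∀ i j, 0 < i → i < Mx → 0 < j → j < My →
    leadCoeff α (T / N) * avg Mx My (diffT (T / N) U n) i j
        + ∑ k ∈ Finset.Icc 1 (n - 1),
            gWeightTilde α (T / N) (n - k) * avg Mx My (diffT (T / N) U k) i j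
        - piRule (α 0 - 1) (T / N) n (fun m => D.lap Mx My (U m) i j)
      = piWeight (α 0 - 1) (T / N) n n * avg Mx My (fun i j => f (U n i j)) i j / 2
        + ∑ k ∈ Finset.Icc 1 (n - 1),
            piWeightTilde (α 0 - 1) (T / N) n k * avg Mx My (fun i j => f (U k i j)) i j
        + avg Mx My (D.load Mx My α (T / N) v₀ n) i j
  initial : ∀ i j, 0 < i → i < Mx → 0 < j → j < My →
    U 0 i j = u₀ (D.ptX Mx i) (D.ptY My j)
  boundary : ∀ n ≤ N, ∀ i ≤ Mx, ∀ j ≤ My, (i = 0 ∨ i = Mx ∨ j = 0 ∨ j = My) → U n i j = 0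

end DiffusionWave

end

namespace DiffusionWave

/-! ### A discrete energy estimate -/

/-! Convolution of the equation with `β_ā` replaces `k` by `g = β_ā * k`, and one integration in
time gives `g * ∂_t u = B * φ` with `B(t) = t^ā / Γ(ā+1)` and `φ = Δu + f(u)`. No initial term
appears: (A1) forces `∂_t u(·,0) = 0`, so the load of the scheme vanishes too. The scheme is the
increment of this identity over one time step, divided by `τ`: on each cell `g` and `φ` are replaced
by the mean of their end values, and `∂_t u` and `B` are integrated exactly. The only other change
in time is that `φ` is replaced by its right end value on the first cell.

Consistency in time. Both exactly integrated factors vanish at `0`, so a rearrangement of the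
remainders bounds their increments by `τ²` times a discrete convolution of the variation of that
factor with the variation of the derivative of the other one, plus one boundary term
(`abs_trapSum_succ_sub_le`). Summed over the time levels, this is at most `τ²` times products of
total variations (`sum_trapBound_le`). These are finite, since `∂_t² u` and the second time
derivative of `φ` are `O(t^(ā-1))` and `g''` has a logarithmic bound. Thus `∑ τ |r^n| = O(τ²)`; no
second order bound on each single `r^n` is needed.

Consistency in space is the usual compact Taylor expansion (`DerivChain.abs_compact_sub_le`). As `𝒜`
also reaches boundary grid points, the equation is first extended to the closed rectangle by
continuity.

Stability (`energy_estimate`). The error equation is tested with the mean of two consecutive errors.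
The leading term telescopes, because `𝒜` is symmetric and positive definite. The memory term is
summed by parts and costs only the variation of `w̃`, which is `O(τ)`. The `Λ` term has a sign: `-Λ`
is a sum of squares of linear functionals, and the weights `λ_{n,j}` are of positive type because
`|t-s|^(ā-1)` is, up to a constant, the `L²` inner product of `(t-r)_+^(ā/2-1)` and
`(s-r)_+^(ā/2-1)` (`piWeight_posWeighted`). A Gronwall argument for the running maximum of the error
needs the truncation errors only in `ℓ¹` in time.

Part (i). The substitution `s = tz` makes `g(t)` a Beta average of `Γ(1-ā) κ(tz)` with `κ(t) =
t^(α₀-α(t)) / Γ(2-α(t))` (`genIdentity_eq`). Since `α'(0) = 0`, `α₀ - α(t) = O(t²)`; hence `κ'` is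
bounded and `κ''` is at most logarithmic, and both bounds survive the average. -/

theorem gronwall_sum {X : ℕ → ℝ} {A κ : ℝ} {N : ℕ} (hκ : 0 ≤ κ)
    (h : ∀ n ≤ N, X n ≤ A + κ * ∑ m ∈ Finset.range n, X m) :
    ∀ n ≤ N, X n ≤ A * (1 + κ) ^ n := by
  have key : ∀ n ≤ N, A + κ * ∑ m ∈ Finset.range n, X m ≤ A * (1 + κ) ^ n := by
    intro n
    induction n with
    | zero => intro _; simp
    | succ n ih =>
      intro hn
      have h1 := ih (by omega)
      have h2 := h n (by omega)
      rw [Finset.sum_range_succ, pow_succ]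
      nlinarith
  exact fun n hn => (h n hn).trans (key n hn)

theorem sum_by_parts (w Q : ℕ → ℝ) (M : ℕ) :
    ∑ j ∈ Finset.range (M + 1), w (j + 1) * (Q (j + 1) - Q (j + 2))
      = w 1 * Q 1 + ∑ j ∈ Finset.range M, (w (j + 2) - w (j + 1)) * Q (j + 2)
        - w (M + 1) * Q (M + 2) := by
  induction M with
  | zero => simp; ring
  | succ M ih => rw [Finset.sum_range_succ, ih, Finset.sum_range_succ]; ring

/-- Summation by parts moves the differences from `P` to the weights, so that only `|w 1|` and the
variation of `w` are paid. The boundary term at the far end disappears because `P 0 = 0`. -/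
theorem abs_sum_weights_le {w P : ℕ → ℝ} {n N : ℕ} {q Y : ℝ} (hn : n ≤ N) (hP0 : P 0 = 0)
    (hP : ∀ k ≤ n, |P k| ≤ Y) (hY : 0 ≤ Y) (hq : 0 ≤ q)
    (hw : |w 1| + ∑ j ∈ Finset.range (N - 2), |w (j + 2) - w (j + 1)| ≤ q) :
    |∑ k ∈ Finset.Icc 1 (n - 1), w (n - k) * (P k - P (k - 1))| ≤ q * Y := by
  rcases Nat.lt_or_ge n 2 with h | h
  · have : Finset.Icc 1 (n - 1) = ∅ := Finset.Icc_eq_empty (by omega)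
    rw [this]; simp; positivity
  obtain ⟨M, rfl⟩ : ∃ M, n = M + 2 := ⟨n - 2, by omega⟩
  have e : ∑ k ∈ Finset.Icc 1 (M + 2 - 1), w (M + 2 - k) * (P k - P (k - 1))
      = ∑ j ∈ Finset.range (M + 1), w (j + 1) * (P (M + 2 - (j + 1)) - P (M + 2 - (j + 2))) := by
    refine Finset.sum_nbij' (fun k => M + 1 - k) (fun j => M + 1 - j) ?_ ?_ ?_ ?_ ?_
    · intro k hk; simp only [Finset.mem_Icc, Finset.mem_range] at *; omega
    · intro k hk; simp only [Finset.mem_Icc, Finset.mem_range] at *; omega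
    · intro k hk; simp only [Finset.mem_Icc] at *; omega
    · intro k hk; simp only [Finset.mem_range] at *; omega
    · intro k hk
      simp only [Finset.mem_Icc] at hk
      congr 2
      · omega
      · congr 1; omega
      · congr 1; omega
  rw [e, sum_by_parts w (fun j => P (M + 2 - j))]
  simp only [Nat.sub_self, hP0, mul_zero, sub_zero]
  calc _ ≤ |w 1 * P (M + 2 - 1)| + ∑ j ∈ Finset.range M, |(w (j + 2) - w (j + 1)) * P (M + 2 - (j + 2))| :=
        (abs_add_le _ _).trans (add_le_add le_rfl (Finset.abs_sum_le_sum_abs _ _))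
    _ ≤ |w 1| * Y + ∑ j ∈ Finset.range M, |w (j + 2) - w (j + 1)| * Y := by
        gcongr
        · rw [abs_mul]; gcongr; exact hP _ (by omega)
        · rw [abs_mul]; gcongr; exact hP _ (by omega)
    _ = (|w 1| + ∑ j ∈ Finset.range M, |w (j + 2) - w (j + 1)|) * Y := by
        rw [← Finset.sum_mul]; ring
    _ ≤ (|w 1| + ∑ j ∈ Finset.range (N - 2), |w (j + 2) - w (j + 1)|) * Y := by
        gcongr; omega
    _ ≤ q * Y := by gcongr

/-- Stability of the averaged backward Euler scheme with memory, in terms of the numbers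
`p k n = ⟨𝒜 e^k, e^n⟩` and `x n = ‖e^n‖`. -/
theorem energy_estimate {N : ℕ} {τ T c c₀ K q : ℝ} (hτ : 0 < τ) (hN : N * τ ≤ T) (hc : 0 < c)
    (hc₀ : 1 / 2 ≤ c₀) (hK : 0 ≤ K) (hq : 0 ≤ q) {x ρ w l F : ℕ → ℝ} {p P : ℕ → ℕ → ℝ}
    (hx : ∀ n, 0 ≤ x n) (hx0 : x 0 = 0) (hρ : ∀ n, 0 ≤ ρ n)
    (hsymm : ∀ k n, k ≤ N → n ≤ N → p k n = p n k) (hp : ∀ k n, k ≤ N → n ≤ N → |p k n| ≤ x k * x n)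
    (hpc : ∀ n ≤ N, c * x n ^ 2 ≤ p n n)
    (hP1 : ∀ k, P k 1 = p k 1) (hP : ∀ k n, 2 ≤ n → P k n = (p k n + p k (n - 1)) / 2)
    (hw : |w 1| + ∑ j ∈ Finset.range (N - 2), |w (j + 2) - w (j + 1)| ≤ q * τ)
    (heq : ∀ n, 1 ≤ n → n ≤ N → c₀ * ((P n n - P (n - 1) n) / τ)
      + ∑ k ∈ Finset.Icc 1 (n - 1), w (n - k) * ((P k n - P (k - 1) n) / τ) + l n = F n)
    (hl : ∀ n ≤ N, 0 ≤ ∑ m ∈ Finset.Icc 1 n, l m)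
    (hF : ∀ n, 1 ≤ n → n ≤ N → ∀ X, (∀ k ≤ n, x k ≤ X) → |F n| ≤ (K * X + ρ n) * X)
    (hsmall : 8 * (K + q) * τ ≤ c) :
    ∀ n ≤ N, x n ≤ 8 / c * (∑ m ∈ Finset.Icc 1 N, τ * ρ m) * Real.exp (8 * (K + q) / c * T) := by
  have hpz : ∀ n ≤ N, p 0 n = 0 := by
    intro n hn
    have := hp 0 n (by omega) hn
    rw [hx0, zero_mul] at this
    exact abs_nonpos_iff.1 this
  -- The running maximum of the errors: the memory and the nonlinear term at level `n` involve all
  -- earlier levels.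
  set X : ℕ → ℝ := fun n => (Finset.range (n + 1)).sup' ⟨0, by simp⟩ x with hXdef
  have hxX : ∀ n, ∀ k ≤ n, x k ≤ X n := fun n k hk =>
    Finset.le_sup' x (Finset.mem_range.2 (by omega))
  have hX0 : ∀ n, 0 ≤ X n := fun n => (hx n).trans (hxX n n le_rfl)
  have hXm : ∀ m n, m ≤ n → X m ≤ X n := fun m n h =>
    Finset.sup'_le _ _ fun k hk => hxX n k (by rw [Finset.mem_range] at hk; omega)
  have hXex : ∀ n, ∃ k ≤ n, X n = x k := fun n => by
    obtain ⟨k, hk, h⟩ := Finset.exists_mem_eq_sup' (s := Finset.range (n + 1)) ⟨0, by simp⟩ x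
    exact ⟨k, by rw [Finset.mem_range] at hk; omega, h⟩
  have hXz : X 0 = 0 := by
    obtain ⟨k, hk, h⟩ := hXex 0
    rw [h, Nat.le_zero.1 hk, hx0]
  have hpX : ∀ n ≤ N, ∀ k ≤ n, ∀ m ≤ n, |p k m| ≤ X n ^ 2 := by
    intro n hn k hk m hm
    refine (hp k m (by omega) (by omega)).trans ?_
    rw [sq]
    exact mul_le_mul (hxX n k hk) (hxX n m hm) (hx m) (hX0 n)
  have hPX : ∀ n, 1 ≤ n → n ≤ N → ∀ k ≤ n, |P k n| ≤ X n ^ 2 := by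
    intro n h1 hn k hk
    rcases Nat.lt_or_ge n 2 with h | h
    · obtain rfl : n = 1 := by omega
      rw [hP1]; exact hpX 1 hn k hk 1 le_rfl
    · rw [hP k n h, abs_le]
      have e1 := abs_le.1 (hpX n hn k hk n le_rfl)
      have e2 := abs_le.1 (hpX n hn k hk (n - 1) (by omega))
      constructor <;> linarith [e1.1, e1.2, e2.1, e2.2]
  have hP0 : ∀ n, 1 ≤ n → n ≤ N → P 0 n = 0 := by
    intro n h1 hn
    rcases Nat.lt_or_ge n 2 with h | h
    · obtain rfl : n = 1 := by omega
      rw [hP1, hpz 1 hn]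
    · rw [hP 0 n h, hpz n hn, hpz (n - 1) (by omega)]; simp
  -- The variation of `w` is of order `τ`, which compensates the division by `τ` in the difference
  -- quotients.
  have hmem : ∀ n, 1 ≤ n → n ≤ N →
      |∑ k ∈ Finset.Icc 1 (n - 1), w (n - k) * ((P k n - P (k - 1) n) / τ)| ≤ q * X n ^ 2 := by
    intro n h1 hn
    have h := abs_sum_weights_le (w := w) (P := fun k => P k n / τ) hn (by simp [hP0 n h1 hn])
      (Y := X n ^ 2 / τ) (q := q * τ)
      (fun k hk => by
        rw [abs_div, abs_of_pos hτ]
        exact div_le_div_of_nonneg_right (hPX n h1 hn k hk) hτ.le) (by positivity)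
      (by positivity) hw
    have e : q * τ * (X n ^ 2 / τ) = q * X n ^ 2 := by field_simp
    rw [e] at h
    simpa only [← sub_div] using h
  have hstep : ∀ n, 1 ≤ n → n ≤ N →
      c₀ * (P n n - P (n - 1) n) + τ * l n ≤ τ * (((K + q) * X n + ρ n) * X n) := by
    intro n h1 hn
    have a1 := abs_le.1 (hmem n h1 hn)
    have a2 := abs_le.1 (hF n h1 hn (X n) (hxX n))
    have a3 := heq n h1 hn
    have : c₀ * ((P n n - P (n - 1) n) / τ) + l n ≤ ((K + q) * X n + ρ n) * X n := by
      nlinarith [a1.1, a2.2]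
    have := mul_le_mul_of_nonneg_left this hτ.le
    refine le_trans (le_of_eq ?_) this
    field_simp
  -- By symmetry of `p`, testing with the mean turns each difference with `m ≥ 2` into `(p m m - p
  -- (m-1) (m-1)) / 2`. The level `m = 1` is tested with the error itself and contributes the full
  -- `p 1 1`, of which half suffices.
  have htel : ∀ n, n ≤ N →
      p n n / 2 ≤ ∑ m ∈ Finset.Icc 1 n, (P m m - P (m - 1) m) := by
    intro n
    induction n with
    | zero => intro _; simp [hpz 0 (by omega)]
    | succ n ih =>
      intro hn
      rw [Finset.sum_Icc_succ_top (by omega)]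
      rcases Nat.eq_zero_or_pos n with h | h
      · subst h
        have hpos := hpc 1 hn
        have : 0 ≤ p 1 1 := le_trans (by positivity) hpos
        simp only [zero_add, Nat.sub_self]
        rw [hP0 1 le_rfl hn, hP1]
        simp; linarith
      · have := ih (by omega)
        rw [hP _ _ (by omega), hP _ _ (by omega), Nat.add_sub_cancel, hsymm n (n + 1) (by omega) hn]
        linarith
  have henergy : ∀ n ≤ N,
      c / 4 * x n ^ 2 ≤ X n * ∑ m ∈ Finset.Icc 1 n, τ * ((K + q) * X m + ρ m) := by
    intro n hn
    have s1 : ∑ m ∈ Finset.Icc 1 n, (c₀ * (P m m - P (m - 1) m) + τ * l m)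
        ≤ ∑ m ∈ Finset.Icc 1 n, τ * (((K + q) * X m + ρ m) * X m) :=
      Finset.sum_le_sum fun m hm => by
        rw [Finset.mem_Icc] at hm; exact hstep m hm.1 (by omega)
    rw [Finset.sum_add_distrib, ← Finset.mul_sum, ← Finset.mul_sum] at s1
    have s2 : ∑ m ∈ Finset.Icc 1 n, τ * (((K + q) * X m + ρ m) * X m)
        ≤ X n * ∑ m ∈ Finset.Icc 1 n, τ * ((K + q) * X m + ρ m) := by
      rw [Finset.mul_sum]
      exact Finset.sum_le_sum fun m hm => by
        rw [Finset.mem_Icc] at hm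
        have h1 : 0 ≤ τ * ((K + q) * X m + ρ m) := by
          have := hX0 m; have := hρ m; positivity
        nlinarith [hXm m n hm.2]
    have s3 := htel n hn
    have s4 := hl n hn
    have s5 := hpc n hn
    have s6 : 0 ≤ c * x n ^ 2 := by positivity
    have s7 := mul_nonneg hτ.le s4
    have s8 : c / 4 * x n ^ 2 ≤ c₀ * ∑ m ∈ Finset.Icc 1 n, (P m m - P (m - 1) m) := by
      nlinarith
    linarith
  set R := ∑ m ∈ Finset.Icc 1 N, τ * ρ m with hR
  have hR0 : 0 ≤ R := Finset.sum_nonneg fun m _ => mul_nonneg hτ.le (hρ m)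
  set κ := 8 * (K + q) / c * τ with hκ
  have hκ0 : 0 ≤ κ := by positivity
  have hrec : ∀ n ≤ N, X n ≤ 8 / c * R + κ * ∑ m ∈ Finset.range n, X m := by
    intro n hn
    have hsum0 : 0 ≤ ∑ m ∈ Finset.range n, X m := Finset.sum_nonneg fun m _ => hX0 m
    rcases (hX0 n).eq_or_lt with h0 | hpos
    · rw [← h0]; positivity
    -- The energy inequality is used at a level `k` where the maximum is attained. There `x k = X k
    -- = X n`, so one factor `X n` cancels and the `ρ m` enter linearly.
    obtain ⟨k, hk, hXk⟩ := hXex n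
    have h1 := henergy k (by omega)
    have hkn : X k = X n := le_antisymm (hXm k n hk) (by rw [hXk]; exact hxX k k le_rfl)
    rw [← hXk, hkn] at h1
    have h2 : c / 4 * X n ≤ ∑ m ∈ Finset.Icc 1 k, τ * ((K + q) * X m + ρ m) := by
      have : X n * (c / 4 * X n) ≤ X n * ∑ m ∈ Finset.Icc 1 k, τ * ((K + q) * X m + ρ m) := by
        linarith
      exact le_of_mul_le_mul_left this hpos
    have h3 : ∑ m ∈ Finset.Icc 1 k, τ * ((K + q) * X m + ρ m)
        ≤ ∑ m ∈ Finset.Icc 1 n, τ * ((K + q) * X m + ρ m) := by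
      refine Finset.sum_le_sum_of_subset_of_nonneg (Finset.Icc_subset_Icc le_rfl hk) ?_
      intro m _ _
      have := hX0 m; have := hρ m; positivity
    have h4 : ∑ m ∈ Finset.Icc 1 n, τ * ((K + q) * X m + ρ m)
        = τ * (K + q) * ∑ m ∈ Finset.Icc 1 n, X m + ∑ m ∈ Finset.Icc 1 n, τ * ρ m := by
      rw [Finset.mul_sum, ← Finset.sum_add_distrib]
      exact Finset.sum_congr rfl fun m _ => by ring
    have h5 : ∑ m ∈ Finset.Icc 1 n, τ * ρ m ≤ R :=
      Finset.sum_le_sum_of_subset_of_nonneg (Finset.Icc_subset_Icc le_rfl hn)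
        fun m _ _ => mul_nonneg hτ.le (hρ m)
    have h6 : ∑ m ∈ Finset.Icc 1 n, X m = ∑ m ∈ Finset.range n, X m + X n := by
      rw [← Finset.sum_range_succ, Finset.range_eq_Ico, Finset.sum_eq_sum_Ico_succ_bot (by omega),
        hXz, zero_add]
      rfl
    rw [h4, h6] at h3
    -- The restriction on `τ` absorbs the implicit summand `m = n` into the left-hand side.
    have h7 : τ * (K + q) * X n ≤ c / 8 * X n := by
      have : τ * (K + q) ≤ c / 8 := by linarith
      exact mul_le_mul_of_nonneg_right this hpos.le
    have h8 : c / 8 * X n ≤ τ * (K + q) * ∑ m ∈ Finset.range n, X m + R := by nlinarith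
    have h9 : X n = 8 / c * (c / 8 * X n) := by field_simp
    rw [h9]
    calc _ ≤ 8 / c * (τ * (K + q) * ∑ m ∈ Finset.range n, X m + R) := by gcongr
      _ = _ := by rw [hκ]; ring
  intro n hn
  have h1 := gronwall_sum hκ0 hrec n hn
  refine (hxX n n le_rfl).trans (h1.trans ?_)
  have hT : κ * n ≤ 8 * (K + q) / c * T := by
    rw [hκ, mul_assoc]
    have : τ * (n : ℝ) ≤ T := by
      have : (n : ℝ) ≤ N := by exact_mod_cast hn
      nlinarith
    gcongr
  have h2 : (1 + κ) ^ n ≤ Real.exp (8 * (K + q) / c * T) := by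
    calc (1 + κ) ^ n ≤ (Real.exp κ) ^ n := by
          gcongr; linarith [Real.add_one_le_exp κ]
      _ = Real.exp (κ * n) := by rw [← Real.exp_nat_mul]; ring_nf
      _ ≤ _ := Real.exp_le_exp.2 hT
  gcongr

end DiffusionWave

namespace DiffusionWave

/-! ### The product trapezoidal remainder -/

theorem abs_sub_le_of_deriv_bound {f f' : ℝ → ℝ} {a b C : ℝ} (hab : a ≤ b)
    (hf : ContinuousOn f (Icc a b)) (hf' : ∀ x ∈ Ioo a b, HasDerivAt f (f' x) x)
    (hC : ∀ x ∈ Ioo a b, |f' x| ≤ C) : |f b - f a| ≤ C * (b - a) := by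
  rcases hab.eq_or_lt with rfl | h
  · simp
  obtain ⟨c, hc, he⟩ := exists_hasDerivAt_eq_slope f f' h hf hf'
  have hba : 0 < b - a := by linarith
  have : f b - f a = f' c * (b - a) := by rw [he]; field_simp
  rw [this, abs_mul, abs_of_pos hba]
  exact mul_le_mul_of_nonneg_right (hC c hc) hba.le

/-- The deviation of `φ` on the `j`-th cell from the mean of its two end values, with `r` the
distance to the right end. -/
noncomputable def cellDev (τ : ℝ) (φ : ℝ → ℝ) (j : ℕ) (r : ℝ) : ℝ :=
  φ (((j : ℝ) + 1) * τ - r) - (φ (((j : ℝ) + 1) * τ) + φ (j * τ)) / 2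

/-- The error at `t_n` of the product trapezoidal approximation of the convolution `B * φ`. -/
noncomputable def trapSum (τ : ℝ) (B φ : ℝ → ℝ) (n : ℕ) : ℝ :=
  ∑ j ∈ Finset.range n, ∫ r in (0 : ℝ)..τ, B (((n - 1 - j : ℕ) : ℝ) * τ + r) * cellDev τ φ j r

/-- The increment of `V` over the `j`-th cell. -/
noncomputable def cellInc (τ : ℝ) (V : ℝ → ℝ) (j : ℕ) : ℝ := V (((j : ℝ) + 1) * τ) - V (j * τ)

/-- A bound for the increments of `trapSum` if `VB`, `V` control the variation of `B`, `φ'`. -/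
noncomputable def trapBound (τ : ℝ) (VB V : ℝ → ℝ) (M : ℝ) (n : ℕ) : ℝ :=
  τ ^ 2 * (∑ j ∈ Finset.range n, cellInc τ VB (n - 1 - j) * (2 * cellInc τ V j + cellInc τ V (j + 1))
    + cellInc τ VB n * M)

theorem cellInc_nonneg {τ : ℝ} {V : ℝ → ℝ} (hτ : 0 < τ) (hV : MonotoneOn V (Ici 0)) (j : ℕ) :
    0 ≤ cellInc τ V j := by
  have h1 : 0 ≤ (j : ℝ) * τ := by positivity
  have h2 : (j : ℝ) * τ ≤ ((j : ℝ) + 1) * τ := by nlinarith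
  exact sub_nonneg.2 (hV h1 (mem_Ici.2 (h1.trans h2)) h2)

theorem sum_cellInc (τ : ℝ) (V : ℝ → ℝ) (n : ℕ) :
    ∑ j ∈ Finset.range n, cellInc τ V j = V (n * τ) - V 0 := by
  have := Finset.sum_range_sub (fun j : ℕ => V (j * τ)) n
  simpa [cellInc] using this

theorem trapBound_nonneg {τ M : ℝ} {VB V : ℝ → ℝ} (hτ : 0 < τ) (hVB : MonotoneOn VB (Ici 0))
    (hV : MonotoneOn V (Ici 0)) (hM : 0 ≤ M) (n : ℕ) : 0 ≤ trapBound τ VB V M n := by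
  refine mul_nonneg (sq_nonneg _) (add_nonneg (Finset.sum_nonneg fun j _ => ?_) ?_)
  · have := cellInc_nonneg hτ hVB (n - 1 - j)
    have := cellInc_nonneg hτ hV j
    have := cellInc_nonneg hτ hV (j + 1)
    positivity
  · exact mul_nonneg (cellInc_nonneg hτ hVB n) hM

/-- Discrete Young inequality in `ℓ¹`, by exchange of the summations. Through it the accumulated
truncation error becomes a product of total variations. -/
theorem sum_conv_le {a b : ℕ → ℝ} (ha : ∀ n, 0 ≤ a n) (hb : ∀ n, 0 ≤ b n) (N : ℕ) :
    ∑ n ∈ Finset.range N, ∑ j ∈ Finset.range n, a (n - 1 - j) * b j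
      ≤ (∑ n ∈ Finset.range N, a n) * ∑ j ∈ Finset.range N, b j := by
  have h := Finset.sum_comm' (s := Finset.range N) (t := fun n => Finset.range n)
    (t' := Finset.range N) (s' := fun j => Finset.Ico (j + 1) N)
    (f := fun n j => a (n - 1 - j) * b j)
    (by intro x y; simp only [Finset.mem_range, Finset.mem_Ico]; omega)
  rw [h, Finset.mul_sum]
  refine Finset.sum_le_sum fun j hj => ?_
  rw [← Finset.sum_mul]
  refine mul_le_mul_of_nonneg_right ?_ (hb j)
  rw [Finset.sum_Ico_eq_sum_range]
  have : ∀ k ∈ Finset.range (N - (j + 1)), a (j + 1 + k - 1 - j) = a k := fun k _ => by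
    congr 1; omega
  rw [Finset.sum_congr rfl this]
  refine Finset.sum_le_sum_of_subset_of_nonneg ?_ fun i _ _ => ha i
  intro k hk; rw [Finset.mem_range] at *; omega

/-- The convolution structure of `trapBound` gives `τ²` times a product of total variations, with no
loss at the singularity `t = 0`. The shifted increment `cellInc τ V (j + 1)` is the reason why `V`
is evaluated one cell beyond `N * τ`. -/
theorem sum_trapBound_le {τ M : ℝ} {VB V : ℝ → ℝ} {N : ℕ} (hτ : 0 < τ)
    (hVB : MonotoneOn VB (Ici 0)) (hV : MonotoneOn V (Ici 0)) :
    ∑ n ∈ Finset.range N, trapBound τ VB V M n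
      ≤ τ ^ 2 * ((VB (N * τ) - VB 0) * (3 * (V ((N + 1) * τ) - V 0) + M)) := by
  unfold trapBound
  rw [← Finset.mul_sum, Finset.sum_add_distrib, ← Finset.sum_mul, sum_cellInc]
  refine mul_le_mul_of_nonneg_left ?_ (sq_nonneg _)
  have hVBN : 0 ≤ VB (N * τ) - VB 0 := by
    rw [← sum_cellInc]; exact Finset.sum_nonneg fun j _ => cellInc_nonneg hτ hVB j
  have h1 := sum_conv_le (a := cellInc τ VB) (b := fun j => 2 * cellInc τ V j + cellInc τ V (j + 1))
    (cellInc_nonneg hτ hVB) (fun n => by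
      have := cellInc_nonneg hτ hV n
      have := cellInc_nonneg hτ hV (n + 1)
      positivity) N
  have h2 : ∑ j ∈ Finset.range N, (2 * cellInc τ V j + cellInc τ V (j + 1))
      ≤ 3 * (V ((N + 1) * τ) - V 0) := by
    have e := sum_cellInc τ V (N + 1)
    push_cast at e
    have e1 := Finset.sum_range_succ (cellInc τ V) N
    have e2 := Finset.sum_range_succ' (cellInc τ V) N
    rw [Finset.sum_add_distrib, ← Finset.mul_sum]
    have := cellInc_nonneg hτ hV N
    have := cellInc_nonneg hτ hV 0
    linarith
  rw [sum_cellInc] at h1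
  have := mul_le_mul_of_nonneg_left h2 hVBN
  linarith

section
variable {τ : ℝ} {B VB φ φ' V : ℝ → ℝ} {M T : ℝ}

theorem mem_cell {j N : ℕ} (hτ : 0 < τ) (hj : j < N) (hN : N * τ ≤ T) {x : ℝ}
    (hx : x ∈ Icc (j * τ) ((j + 1) * τ)) : x ∈ Icc 0 T := by
  have h1 : (0 : ℝ) ≤ j * τ := by positivity
  have h2 : ((j : ℝ) + 1) * τ ≤ N * τ := by
    have : (j : ℝ) + 1 ≤ N := by exact_mod_cast hj
    nlinarith
  exact ⟨h1.trans hx.1, hx.2.trans (h2.trans hN)⟩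

theorem continuousOn_cellDev {j N : ℕ} (hτ : 0 < τ) (hj : j < N) (hN : N * τ ≤ T)
    (hφ : ContinuousOn φ (Icc 0 T)) : ContinuousOn (cellDev τ φ j) (Icc 0 τ) := by
  refine ContinuousOn.sub (hφ.comp (by fun_prop) fun r hr => ?_) continuousOn_const
  exact mem_cell hτ hj hN ⟨by linarith [hr.2], by linarith [hr.1]⟩

theorem abs_cellDev_le {j N : ℕ} (hτ : 0 < τ) (hj : j < N) (hN : N * τ ≤ T)
    (hφ : ContinuousOn φ (Icc 0 T)) (hφ' : ∀ t ∈ Ioo 0 T, HasDerivAt φ (φ' t) t)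
    (hM : ∀ t ∈ Ioo 0 T, |φ' t| ≤ M) {r : ℝ} (hr : r ∈ Icc 0 τ) : |cellDev τ φ j r| ≤ τ * M := by
  have hsub : Icc (j * τ) ((j + 1) * τ) ⊆ Icc 0 T := fun x hx => mem_cell hτ hj hN hx
  have hlip : ∀ x ∈ Icc (j * τ) ((j + 1) * τ), ∀ y ∈ Icc (j * τ) ((j + 1) * τ), x ≤ y →
      |φ y - φ x| ≤ M * (y - x) := by
    intro x hx y hy hxy
    have hx' := hsub hx
    have hy' := hsub hy
    exact abs_sub_le_of_deriv_bound hxy (hφ.mono (Icc_subset_Icc hx'.1 hy'.2))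
      (fun t ht => hφ' t ⟨hx'.1.trans_lt ht.1, ht.2.trans_le hy'.2⟩)
      (fun t ht => hM t ⟨hx'.1.trans_lt ht.1, ht.2.trans_le hy'.2⟩)
  have hmid : ((j : ℝ) + 1) * τ - r ∈ Icc (j * τ) ((j + 1) * τ) :=
    ⟨by linarith [hr.2], by linarith [hr.1]⟩
  have hl : (j : ℝ) * τ ∈ Icc (j * τ) (((j : ℝ) + 1) * τ) := ⟨le_rfl, by linarith⟩
  have hrr : ((j : ℝ) + 1) * τ ∈ Icc (j * τ) (((j : ℝ) + 1) * τ) := ⟨by linarith, le_rfl⟩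
  have h1 := abs_le.1 (hlip _ hl _ hmid hmid.1)
  have h2 := abs_le.1 (hlip _ hmid _ hrr hmid.2)
  have hM0 : 0 ≤ M * τ := by
    have := (abs_nonneg _).trans (hlip _ hl _ hrr (by linarith))
    linarith
  unfold cellDev
  rw [abs_le]
  constructor <;> nlinarith [h1.1, h1.2, h2.1, h2.2]

/-- The deviation is averaged with its reflection `r ↦ τ - r`. The sum is the increment of `φ(a + r)
+ φ(b - r)`, whose derivative `φ'(a + r) - φ'(b - r)` is at most the oscillation of `φ'` on the
cell; this gains a factor over the pointwise bound `abs_cellDev_le`. -/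
theorem abs_integral_cellDev_le {j N : ℕ} (hτ : 0 < τ) (hj : j < N) (hN : N * τ ≤ T)
    (hφ : ContinuousOn φ (Icc 0 T)) (hφ' : ∀ t ∈ Ioo 0 T, HasDerivAt φ (φ' t) t)
    (hVmono : MonotoneOn V (Ici 0))
    (hV : ∀ s t, 0 < s → s ≤ t → t < T → |φ' t - φ' s| ≤ V t - V s) :
    |∫ r in (0 : ℝ)..τ, cellDev τ φ j r| ≤ τ ^ 2 * cellInc τ V j := by
  set a : ℝ := j * τ with ha
  set b : ℝ := ((j : ℝ) + 1) * τ with hb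
  have hab : b = a + τ := by rw [ha, hb]; ring
  have ha0 : 0 ≤ a := by positivity
  have hsub : Icc a b ⊆ Icc 0 T := fun x hx => mem_cell hτ hj hN hx
  have hbT : b ≤ T := (hsub ⟨by linarith, le_rfl⟩).2
  have hVab : ∀ x ∈ Ioo a b, ∀ y ∈ Ioo a b, |φ' y - φ' x| ≤ cellInc τ V j := by
    have key : ∀ x ∈ Ioo a b, ∀ y ∈ Ioo a b, x ≤ y → |φ' y - φ' x| ≤ cellInc τ V j := by
      intro x hx y hy hxy
      have h1 := hV x y (ha0.trans_lt hx.1) hxy (hy.2.trans_le hbT)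
      have h2 : V a ≤ V x := hVmono ha0 (ha0.trans hx.1.le) hx.1.le
      have h3 : V y ≤ V b := hVmono (ha0.trans hy.1.le) (show (0 : ℝ) ≤ b by linarith) hy.2.le
      have : cellInc τ V j = V b - V a := rfl
      linarith
    intro x hx y hy
    rcases le_total x y with h | h
    · exact key x hx y hy h
    · rw [abs_sub_comm]; exact key y hy x hx h
  have hcd := continuousOn_cellDev hτ hj hN hφ
  have hint : IntervalIntegrable (cellDev τ φ j) MeasureTheory.volume 0 τ :=
    ContinuousOn.intervalIntegrable (by rwa [uIcc_of_le hτ.le])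
  have hint' : IntervalIntegrable (fun r => cellDev τ φ j (τ - r)) MeasureTheory.volume 0 τ := by
    refine ContinuousOn.intervalIntegrable ?_
    rw [uIcc_of_le hτ.le]
    exact hcd.comp (by fun_prop) fun r hr => ⟨by linarith [hr.2], by linarith [hr.1]⟩
  have href : ∫ r in (0 : ℝ)..τ, cellDev τ φ j (τ - r) = ∫ r in (0 : ℝ)..τ, cellDev τ φ j r := by
    rw [intervalIntegral.integral_comp_sub_left (cellDev τ φ j)]; simp
  have hsum : ∫ r in (0 : ℝ)..τ, cellDev τ φ j r
      = (1 / 2) * ∫ r in (0 : ℝ)..τ, (cellDev τ φ j r + cellDev τ φ j (τ - r)) := by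
    rw [intervalIntegral.integral_add hint hint', href]; ring
  have hpt : ∀ r ∈ Set.uIoc 0 τ, ‖cellDev τ φ j r + cellDev τ φ j (τ - r)‖
      ≤ τ * cellInc τ V j := by
    intro r hr
    rw [uIoc_of_le hτ.le] at hr
    set h : ℝ → ℝ := fun r => φ (a + r) + φ (b - r) with hh
    have e : cellDev τ φ j r + cellDev τ φ j (τ - r) = h r - h 0 := by
      simp only [cellDev, hh, ← ha, ← hb]
      rw [show b - (τ - r) = a + r by rw [hab]; ring]
      simp; ring
    have hc : ContinuousOn h (Icc 0 r) := by
      refine ContinuousOn.add (hφ.comp (by fun_prop) fun x hx => hsub ?_)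
        (hφ.comp (by fun_prop) fun x hx => hsub ?_)
      · exact ⟨by linarith [hx.1], by linarith [hx.2, hr.2]⟩
      · exact ⟨by linarith [hx.2, hr.2], by linarith [hx.1]⟩
    have hd : ∀ x ∈ Ioo 0 r, HasDerivAt h (φ' (a + x) - φ' (b - x)) x := by
      intro x hx
      have h1 := (hφ' (a + x) ⟨by linarith [hx.1], by linarith [hx.2, hr.2]⟩).comp_const_add a x
      have h2 := (hφ' (b - x) ⟨by linarith [hx.2, hr.2], by linarith [hx.1]⟩).comp_const_sub b x
      exact (h1.add h2).congr_deriv (by ring)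
    have := abs_sub_le_of_deriv_bound hr.1.le hc hd (C := cellInc τ V j) fun x hx =>
      hVab _ ⟨by linarith [hx.2, hr.2], by linarith [hx.1]⟩ _
        ⟨by linarith [hx.1], by linarith [hx.2, hr.2]⟩
    rw [e, Real.norm_eq_abs]
    refine this.trans ?_
    rw [sub_zero, mul_comm]
    exact mul_le_mul_of_nonneg_right hr.2 (cellInc_nonneg hτ hVmono j)
  have := intervalIntegral.norm_integral_le_of_norm_le_const hpt
  rw [Real.norm_eq_abs, sub_zero, abs_of_pos hτ] at this
  rw [hsum, abs_mul, abs_of_pos (by norm_num : (0 : ℝ) < 1 / 2)]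
  have h0 : 0 ≤ τ * cellInc τ V j * τ := by
    have := cellInc_nonneg hτ hVmono j
    positivity
  nlinarith

/-- Deviations on neighbouring cells differ by second differences of `F(x) = φ(x + τ) - φ(x)`-type
increments, and the Lipschitz constant of `F` on the cell is the variation of `φ'` over the two
cells. -/
theorem abs_cellDev_succ_sub_le {j N : ℕ} (hτ : 0 < τ) (hj : j + 1 < N) (hN : N * τ ≤ T)
    (hφ : ContinuousOn φ (Icc 0 T)) (hφ' : ∀ t ∈ Ioo 0 T, HasDerivAt φ (φ' t) t)
    (hVmono : MonotoneOn V (Ici 0))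
    (hV : ∀ s t, 0 < s → s ≤ t → t < T → |φ' t - φ' s| ≤ V t - V s) {r : ℝ} (hr : r ∈ Icc 0 τ) :
    |cellDev τ φ (j + 1) r - cellDev τ φ j r| ≤ τ * (cellInc τ V j + cellInc τ V (j + 1)) := by
  set a : ℝ := j * τ with ha
  set b : ℝ := ((j : ℝ) + 1) * τ with hb
  have hab : b = a + τ := by rw [ha, hb]; ring
  have hc2 : ((j + 1 : ℕ) + 1 : ℝ) * τ = b + τ := by push_cast; rw [hb]; ring
  have hcb : ((j + 1 : ℕ) : ℝ) * τ = b := by push_cast; rfl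
  have ha0 : 0 ≤ a := by positivity
  have hsub1 : Icc a b ⊆ Icc 0 T := fun x hx => mem_cell hτ (by omega : j < N) hN hx
  have hsub2 : Icc b (b + τ) ⊆ Icc 0 T := fun x hx => by
    refine mem_cell hτ hj hN ?_
    rw [hcb]; rw [hb] at *; push_cast; exact ⟨hx.1, by linarith [hx.2]⟩
  have hbT : b + τ ≤ T := (hsub2 ⟨by linarith, le_rfl⟩).2
  have hinc : cellInc τ V j + cellInc τ V (j + 1) = V (b + τ) - V a := by
    simp only [cellInc, hcb, hc2]; rw [← ha, ← hb]; ring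
  set F : ℝ → ℝ := fun x => φ (x + τ) - φ x with hF
  have hlip : ∀ x ∈ Icc a b, ∀ y ∈ Icc a b, x ≤ y → |F y - F x| ≤ (V (b + τ) - V a) * (y - x) := by
    intro x hx y hy hxy
    refine abs_sub_le_of_deriv_bound hxy (f' := fun t => φ' (t + τ) - φ' t) ?_ ?_ ?_
    · refine ContinuousOn.sub (hφ.comp (by fun_prop) fun z hz => hsub2 ?_)
        (hφ.mono fun z hz => hsub1 ?_)
      · exact ⟨by linarith [hz.1, hx.1], by linarith [hz.2, hy.2]⟩
      · exact ⟨by linarith [hz.1, hx.1], by linarith [hz.2, hy.2]⟩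
    · intro z hz
      have z1 : a < z := hx.1.trans_lt hz.1
      have z2 : z < b := hz.2.trans_le hy.2
      exact ((hφ' (z + τ) ⟨by linarith, by linarith⟩).comp_add_const z τ).sub
        (hφ' z ⟨by linarith, by linarith⟩)
    · intro z hz
      have z1 : a < z := hx.1.trans_lt hz.1
      have z2 : z < b := hz.2.trans_le hy.2
      have h1 := hV z (z + τ) (by linarith) (by linarith) (by linarith)
      have h2 : V a ≤ V z := hVmono ha0 (ha0.trans z1.le) z1.le
      have h3 : V (z + τ) ≤ V (b + τ) :=
        hVmono (show (0 : ℝ) ≤ z + τ by linarith) (show (0 : ℝ) ≤ b + τ by linarith) (by linarith)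
      linarith
  have hV0 : 0 ≤ V (b + τ) - V a := by
    rw [← hinc]; exact add_nonneg (cellInc_nonneg hτ hVmono _) (cellInc_nonneg hτ hVmono _)
  have hmid : b - r ∈ Icc a b := ⟨by linarith [hr.2], by linarith [hr.1]⟩
  have hal : a ∈ Icc a b := ⟨le_rfl, by linarith⟩
  have hbl : b ∈ Icc a b := ⟨by linarith, le_rfl⟩
  have e : cellDev τ φ (j + 1) r - cellDev τ φ j r = ((F (b - r) - F a) - (F b - F (b - r))) / 2 := by
    simp only [cellDev, hF, hcb, hc2]
    rw [← ha, ← hb, show b + τ - r = b - r + τ by ring, show a + τ = b from hab.symm]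
    ring
  have h1 := abs_le.1 (hlip _ hal _ hmid hmid.1)
  have h2 := abs_le.1 (hlip _ hmid _ hbl hmid.2)
  have h3 : (V (b + τ) - V a) * (b - r - a) ≤ τ * (V (b + τ) - V a) := by nlinarith [hr.1]
  have h4 : (V (b + τ) - V a) * (b - (b - r)) ≤ τ * (V (b + τ) - V a) := by nlinarith [hr.2]
  rw [e, hinc, abs_le]
  constructor <;> linarith [h1.1, h1.2, h2.1, h2.2]

theorem abs_integral_mul_le {b X : ℝ → ℝ} {β ξ : ℝ} (hτ : 0 < τ) (hβ : ∀ r ∈ Icc 0 τ, |b r| ≤ β)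
    (hξ : ∀ r ∈ Icc 0 τ, |X r| ≤ ξ) :
    |∫ r in (0 : ℝ)..τ, b r * X r| ≤ τ * (β * ξ) := by
  have h := intervalIntegral.norm_integral_le_of_norm_le_const (f := fun r => b r * X r)
    (C := β * ξ) (a := 0) (b := τ) fun r hr => by
      rw [uIoc_of_le hτ.le] at hr
      have hr' : r ∈ Icc 0 τ := ⟨hr.1.le, hr.2⟩
      rw [Real.norm_eq_abs, abs_mul]
      exact mul_le_mul (hβ r hr') (hξ r hr') (abs_nonneg _) ((abs_nonneg _).trans (hβ r hr'))
  rw [Real.norm_eq_abs, sub_zero, abs_of_pos hτ] at h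
  linarith

/-- On each cell `B` is split into its value at the left end and the increment `B(mτ + r) - B(mτ)`.
In the frozen part the cell of `φ` is kept and the difference falls on `B`, against the small mean
of `cellDev`. In the other part the cell of `B` is kept and the difference falls on `cellDev`. Each
product thus pairs an increment of `VB` with increments of `V`; only the first cell of `φ` has no
predecessor and is bounded through `M`. -/
theorem abs_trapSum_succ_sub_le {n N : ℕ} (hτ : 0 < τ) (hn : n < N) (hN : N * τ ≤ T)
    (hBc : ContinuousOn B (Icc 0 T)) (hB0 : B 0 = 0) (hVBmono : MonotoneOn VB (Ici 0))
    (hB : ∀ s t, 0 ≤ s → s ≤ t → t ≤ T → |B t - B s| ≤ VB t - VB s)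
    (hφ : ContinuousOn φ (Icc 0 T)) (hφ' : ∀ t ∈ Ioo 0 T, HasDerivAt φ (φ' t) t)
    (hM : ∀ t ∈ Ioo 0 T, |φ' t| ≤ M) (hVmono : MonotoneOn V (Ici 0))
    (hV : ∀ s t, 0 < s → s ≤ t → t < T → |φ' t - φ' s| ≤ V t - V s) :
    |trapSum τ B φ (n + 1) - trapSum τ B φ n| ≤ trapBound τ VB V M n := by
  have hcell : ∀ m : ℕ, m < N → ∀ r ∈ Icc 0 τ, (m : ℝ) * τ + r ∈ Icc 0 T := fun m hm r hr =>
    mem_cell hτ hm hN ⟨by linarith [hr.1], by linarith [hr.2]⟩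
  have hBm : ∀ m : ℕ, m < N → ContinuousOn (fun r => B (m * τ + r)) (Icc 0 τ) := fun m hm =>
    hBc.comp (by fun_prop) fun r hr => hcell m hm r hr
  have hint : ∀ m j : ℕ, m < N → j < N →
      IntervalIntegrable (fun r => B (m * τ + r) * cellDev τ φ j r) MeasureTheory.volume 0 τ := by
    intro m j hm hj
    refine ContinuousOn.intervalIntegrable ?_
    rw [uIcc_of_le hτ.le]
    exact (hBm m hm).mul (continuousOn_cellDev hτ hj hN hφ)
  have hint1 : ∀ j : ℕ, j < N →
      IntervalIntegrable (cellDev τ φ j) MeasureTheory.volume 0 τ := by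
    intro j hj
    refine ContinuousOn.intervalIntegrable ?_
    rw [uIcc_of_le hτ.le]
    exact continuousOn_cellDev hτ hj hN hφ
  set Q : ℕ → (ℝ → ℝ) → ℝ := fun m X => ∫ r in (0 : ℝ)..τ, (B (m * τ + r) - B (m * τ)) * X r with hQ
  have hsplit : ∀ m j : ℕ, m < N → j < N → ∫ r in (0 : ℝ)..τ, B (m * τ + r) * cellDev τ φ j r
      = B (m * τ) * (∫ r in (0 : ℝ)..τ, cellDev τ φ j r) + Q m (cellDev τ φ j) := by
    intro m j hm hj
    have : Q m (cellDev τ φ j) = ∫ r in (0 : ℝ)..τ,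
        (B (m * τ + r) * cellDev τ φ j r - B (m * τ) * cellDev τ φ j r) := by
      simp only [hQ, sub_mul]
    rw [this, intervalIntegral.integral_sub (hint m j hm hj) ((hint1 j hj).const_mul _),
      intervalIntegral.integral_const_mul]
    ring
  have hQsub : ∀ m j : ℕ, m < N → j + 1 < N →
      Q m (cellDev τ φ (j + 1)) - Q m (cellDev τ φ j)
        = Q m (fun r => cellDev τ φ (j + 1) r - cellDev τ φ j r) := by
    intro m j hm hj
    have hi : ∀ i : ℕ, i < N → IntervalIntegrable
        (fun r => (B (m * τ + r) - B (m * τ)) * cellDev τ φ i r) MeasureTheory.volume 0 τ := by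
      intro i hi
      refine ContinuousOn.intervalIntegrable ?_
      rw [uIcc_of_le hτ.le]
      exact ((hBm m hm).sub continuousOn_const).mul (continuousOn_cellDev hτ hi hN hφ)
    simp only [hQ]
    rw [← intervalIntegral.integral_sub (hi _ hj) (hi _ (by omega))]
    simp only [mul_sub]
  have hBinc : ∀ m : ℕ, m < N → ∀ r ∈ Icc 0 τ, |B (m * τ + r) - B (m * τ)| ≤ cellInc τ VB m := by
    intro m hm r hr
    have h0 : (0 : ℝ) ≤ m * τ := by positivity
    have h1 := hB (m * τ) (m * τ + r) h0 (by linarith [hr.1]) (hcell m hm r hr).2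
    have h2 : VB (m * τ + r) ≤ VB ((m + 1) * τ) :=
      hVBmono (show (0 : ℝ) ≤ _ by linarith [hr.1]) (show (0 : ℝ) ≤ _ by positivity)
        (by linarith [hr.2])
    unfold cellInc; linarith
  have hQle : ∀ m : ℕ, m < N → ∀ (X : ℝ → ℝ) (ξ : ℝ), (∀ r ∈ Icc 0 τ, |X r| ≤ ξ) →
      |Q m X| ≤ τ * (cellInc τ VB m * ξ) := fun m hm X ξ hX =>
    abs_integral_mul_le hτ (hBinc m hm) hX
  have hexp : trapSum τ B φ (n + 1) - trapSum τ B φ n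
      = ∑ j ∈ Finset.range n, ((B (((n - 1 - j : ℕ) : ℝ) * τ + τ) - B (((n - 1 - j : ℕ) : ℝ) * τ))
          * (∫ r in (0 : ℝ)..τ, cellDev τ φ j r)
          + Q (n - 1 - j) (fun r => cellDev τ φ (j + 1) r - cellDev τ φ j r))
        + Q n (cellDev τ φ 0) := by
    have e1 : trapSum τ B φ (n + 1) = ∑ j ∈ Finset.range (n + 1),
        (B (((n - j : ℕ) : ℝ) * τ) * (∫ r in (0 : ℝ)..τ, cellDev τ φ j r)
          + Q (n - j) (cellDev τ φ j)) := by
      refine Finset.sum_congr rfl fun j hj => ?_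
      rw [Finset.mem_range] at hj
      rw [Nat.add_sub_cancel, hsplit _ _ (by omega) (by omega)]
    have e2 : trapSum τ B φ n = ∑ j ∈ Finset.range n,
        (B (((n - 1 - j : ℕ) : ℝ) * τ) * (∫ r in (0 : ℝ)..τ, cellDev τ φ j r)
          + Q (n - 1 - j) (cellDev τ φ j)) := by
      refine Finset.sum_congr rfl fun j hj => ?_
      rw [Finset.mem_range] at hj
      rw [hsplit _ _ (by omega) (by omega)]
    have e3 : ∑ j ∈ Finset.range (n + 1), Q (n - j) (cellDev τ φ j)
        = ∑ j ∈ Finset.range n, Q (n - 1 - j) (cellDev τ φ (j + 1)) + Q n (cellDev τ φ 0) := by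
      rw [Finset.sum_range_succ', Nat.sub_zero]
      congr 1
      exact Finset.sum_congr rfl fun j _ => by rw [show n - (j + 1) = n - 1 - j by omega]
    -- The hypothesis `B 0 = 0` removes the unpaired last summand of the frozen part.
    have e4 : ∑ j ∈ Finset.range (n + 1),
        B (((n - j : ℕ) : ℝ) * τ) * (∫ r in (0 : ℝ)..τ, cellDev τ φ j r)
        = ∑ j ∈ Finset.range n, B (((n - 1 - j : ℕ) : ℝ) * τ + τ)
          * (∫ r in (0 : ℝ)..τ, cellDev τ φ j r) := by
      rw [Finset.sum_range_succ, Nat.sub_self, Nat.cast_zero, zero_mul, hB0, zero_mul, add_zero]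
      refine Finset.sum_congr rfl fun j hj => ?_
      rw [Finset.mem_range] at hj
      rw [show n - j = (n - 1 - j) + 1 by omega]
      push_cast
      rw [add_mul, one_mul]
    rw [e1, Finset.sum_add_distrib, e3, e4, e2, Finset.sum_add_distrib, Finset.sum_add_distrib]
    have e5 : ∑ j ∈ Finset.range n, Q (n - 1 - j) (fun r => cellDev τ φ (j + 1) r - cellDev τ φ j r)
        = ∑ j ∈ Finset.range n, Q (n - 1 - j) (cellDev τ φ (j + 1))
          - ∑ j ∈ Finset.range n, Q (n - 1 - j) (cellDev τ φ j) := by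
      rw [← Finset.sum_sub_distrib]
      refine Finset.sum_congr rfl fun j hj => ?_
      rw [Finset.mem_range] at hj
      rw [hQsub _ _ (by omega) (by omega)]
    rw [e5]
    simp only [sub_mul, Finset.sum_sub_distrib]
    ring
  rw [hexp]
  refine (abs_add_le _ _).trans ?_
  have hlast := hQle n hn (cellDev τ φ 0) (τ * M) fun r hr =>
    abs_cellDev_le hτ (by omega : 0 < N) hN hφ hφ' hM hr
  have hterm : ∀ j ∈ Finset.range n,
      |(B (((n - 1 - j : ℕ) : ℝ) * τ + τ) - B (((n - 1 - j : ℕ) : ℝ) * τ))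
          * (∫ r in (0 : ℝ)..τ, cellDev τ φ j r)
          + Q (n - 1 - j) (fun r => cellDev τ φ (j + 1) r - cellDev τ φ j r)|
      ≤ τ ^ 2 * (cellInc τ VB (n - 1 - j) * (2 * cellInc τ V j + cellInc τ V (j + 1))) := by
    intro j hj
    rw [Finset.mem_range] at hj
    refine (abs_add_le _ _).trans ?_
    have h1 := hQle (n - 1 - j) (by omega) _ _ fun r hr =>
      abs_cellDev_succ_sub_le hτ (by omega : j + 1 < N) hN hφ hφ' hVmono hV hr
    have h2 := hBinc (n - 1 - j) (by omega) τ ⟨hτ.le, le_rfl⟩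
    have h3 := abs_integral_cellDev_le hτ (by omega : j < N) hN hφ hφ' hVmono hV
    rw [abs_mul]
    have h4 := mul_le_mul h2 h3 (abs_nonneg _) (cellInc_nonneg hτ hVBmono _)
    refine (add_le_add h4 h1).trans (le_of_eq ?_)
    ring
  refine (add_le_add ((Finset.abs_sum_le_sum_abs _ _).trans (Finset.sum_le_sum hterm)) hlast).trans
    (le_of_eq ?_)
  rw [trapBound, ← Finset.mul_sum]
  ring

end

end DiffusionWave

namespace DiffusionWave

/-! ### Bilinear forms of the compact operators -/

theorem sum_Ioo_zero_succ (f : ℕ → ℝ) (K : ℕ) :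
    ∑ i ∈ Finset.Ioo 0 (K + 1), f i = ∑ i ∈ Finset.range K, f (i + 1) := by
  have : Finset.Ioo 0 (K + 1) = Finset.Ico 1 (K + 1) := by
    ext i; simp only [Finset.mem_Ioo, Finset.mem_Ico]; omega
  rw [this, Finset.sum_Ico_eq_sum_range]
  simp [add_comm]

theorem sum_range_mul_add {M : ℕ} (s w : ℕ → ℝ) (h0 : w 0 = 0) (hM : w M = 0) :
    ∑ i ∈ Finset.range M, s i * (w i + w (i + 1))
      = ∑ i ∈ Finset.Ioo 0 M, (s (i - 1) + s i) * w i := by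
  rcases M with _ | K
  · simp
  rw [sum_Ioo_zero_succ]
  simp only [mul_add, add_mul, Finset.sum_add_distrib, Nat.add_sub_cancel]
  rw [Finset.sum_range_succ', Finset.sum_range_succ (fun i => s i * w (i + 1)), h0, hM]
  ring

theorem sum_range_mul_sub {M : ℕ} (s w : ℕ → ℝ) (h0 : w 0 = 0) (hM : w M = 0) :
    ∑ i ∈ Finset.range M, s i * (w (i + 1) - w i)
      = ∑ i ∈ Finset.Ioo 0 M, (s (i - 1) - s i) * w i := by
  rcases M with _ | K
  · simp
  rw [sum_Ioo_zero_succ]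
  simp only [mul_sub, sub_mul, Finset.sum_sub_distrib, Nat.add_sub_cancel]
  rw [Finset.sum_range_succ' (fun i => s i * w i),
    Finset.sum_range_succ (fun i => s i * w (i + 1)), h0, hM]
  ring

/-- The stencil `(1, 10, 1)` is `8` times the identity plus `(1, 2, 1)`, and the latter is the
forward sum composed with its adjoint. This makes the form visibly symmetric and bounded below. -/
theorem sum_avg_mul {M : ℕ} (v w : ℕ → ℝ) (h0 : w 0 = 0) (hM : w M = 0) :
    ∑ i ∈ Finset.Ioo 0 M, (v (i - 1) + 10 * v i + v (i + 1)) / 12 * w i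
      = (8 * ∑ i ∈ Finset.Ioo 0 M, v i * w i
        + ∑ i ∈ Finset.range M, (v i + v (i + 1)) * (w i + w (i + 1))) / 12 := by
  rw [sum_range_mul_add (fun i => v i + v (i + 1)) w h0 hM, Finset.mul_sum,
    ← Finset.sum_add_distrib, Finset.sum_div]
  refine Finset.sum_congr rfl fun i hi => ?_
  rw [Finset.mem_Ioo] at hi
  rw [show i - 1 + 1 = i by omega]
  ring

theorem sum_neg_diff_mul {M : ℕ} (v w : ℕ → ℝ) (h0 : w 0 = 0) (hM : w M = 0) :
    ∑ i ∈ Finset.Ioo 0 M, -(v (i + 1) - 2 * v i + v (i - 1)) * w i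
      = ∑ i ∈ Finset.range M, (v (i + 1) - v i) * (w (i + 1) - w i) := by
  rw [sum_range_mul_sub (fun i => v (i + 1) - v i) w h0 hM]
  refine Finset.sum_congr rfl fun i hi => ?_
  rw [Finset.mem_Ioo] at hi
  rw [show i - 1 + 1 = i by omega]
  ring

/-- Grid functions that vanish at the boundary grid points. -/
def VanishesOnBdry (Mx My : ℕ) (v : ℕ → ℕ → ℝ) : Prop :=
  ∀ i ≤ Mx, ∀ j ≤ My, (i = 0 ∨ i = Mx ∨ j = 0 ∨ j = My) → v i j = 0

/-- The sum of `v w` over the interior grid points. -/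
def gridSum (Mx My : ℕ) (v w : ℕ → ℕ → ℝ) : ℝ :=
  ∑ i ∈ Finset.Ioo 0 Mx, ∑ j ∈ Finset.Ioo 0 My, v i j * w i j

variable {Mx My : ℕ} {v w : ℕ → ℕ → ℝ}

theorem sum_avgX_mul (hw0 : ∀ j ∈ Finset.Ioo 0 My, w 0 j = 0)
    (hwM : ∀ j ∈ Finset.Ioo 0 My, w Mx j = 0) :
    gridSum Mx My (avgX Mx v) w = (8 * gridSum Mx My v w
      + ∑ i ∈ Finset.range Mx, ∑ j ∈ Finset.Ioo 0 My,
        (v i j + v (i + 1) j) * (w i j + w (i + 1) j)) / 12 := by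
  unfold gridSum
  rw [Finset.sum_comm, Finset.sum_comm (s := Finset.Ioo 0 Mx), Finset.sum_comm (s := Finset.range Mx),
    Finset.mul_sum, ← Finset.sum_add_distrib, Finset.sum_div]
  refine Finset.sum_congr rfl fun j hj => ?_
  rw [← sum_avg_mul (fun i => v i j) (fun i => w i j) (hw0 j hj) (hwM j hj)]
  refine Finset.sum_congr rfl fun i hi => ?_
  rw [Finset.mem_Ioo] at hi
  simp only [avgX, if_pos hi]

theorem sum_avgY_mul (i : ℕ) (h0 : w i 0 = 0) (hM : w i My = 0) :
    ∑ j ∈ Finset.Ioo 0 My, avgY My v i j * w i j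
      = (8 * ∑ j ∈ Finset.Ioo 0 My, v i j * w i j
        + ∑ j ∈ Finset.range My, (v i j + v i (j + 1)) * (w i j + w i (j + 1))) / 12 := by
  rw [← sum_avg_mul _ _ h0 hM]
  refine Finset.sum_congr rfl fun j hj => ?_
  rw [Finset.mem_Ioo] at hj
  simp only [avgY, if_pos hj]

theorem avgY_add_shift (v : ℕ → ℕ → ℝ) (i j : ℕ) :
    avgY My v i j + avgY My v (i + 1) j = avgY My (fun i j => v i j + v (i + 1) j) i j := by
  unfold avgY
  split_ifs
  · ring
  · rfl

/-- Tensor product of the one-dimensional identity in both directions. Every summand is `ℓ(v) ℓ(w)`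
for one linear functional `ℓ`, whence symmetry; the first one alone yields the lower bound `64/144 =
4/9`. -/
theorem gridSum_avg (hw : VanishesOnBdry Mx My w) :
    gridSum Mx My (avg Mx My v) w = (64 * gridSum Mx My v w
      + 8 * ∑ i ∈ Finset.Ioo 0 Mx, ∑ j ∈ Finset.range My,
          (v i j + v i (j + 1)) * (w i j + w i (j + 1))
      + 8 * ∑ i ∈ Finset.range Mx, ∑ j ∈ Finset.Ioo 0 My,
          (v i j + v (i + 1) j) * (w i j + w (i + 1) j)
      + ∑ i ∈ Finset.range Mx, ∑ j ∈ Finset.range My,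
          (v i j + v (i + 1) j + (v i (j + 1) + v (i + 1) (j + 1)))
            * (w i j + w (i + 1) j + (w i (j + 1) + w (i + 1) (j + 1)))) / 144 := by
  have hmem : ∀ j ∈ Finset.Ioo 0 My, j ≤ My := fun j hj => by rw [Finset.mem_Ioo] at hj; omega
  rw [avg, sum_avgX_mul (fun j hj => hw 0 (by omega) j (hmem j hj) (by simp))
    (fun j hj => hw Mx le_rfl j (hmem j hj) (by simp))]
  have h1 : gridSum Mx My (avgY My v) w = (8 * gridSum Mx My v w
      + ∑ i ∈ Finset.Ioo 0 Mx, ∑ j ∈ Finset.range My,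
          (v i j + v i (j + 1)) * (w i j + w i (j + 1))) / 12 := by
    unfold gridSum
    rw [Finset.mul_sum, ← Finset.sum_add_distrib, Finset.sum_div]
    refine Finset.sum_congr rfl fun i hi => ?_
    rw [Finset.mem_Ioo] at hi
    exact sum_avgY_mul i (hw i (by omega) 0 (by omega) (by simp))
      (hw i (by omega) My le_rfl (by simp))
  have h2 : ∑ i ∈ Finset.range Mx, ∑ j ∈ Finset.Ioo 0 My,
        (avgY My v i j + avgY My v (i + 1) j) * (w i j + w (i + 1) j)
      = (8 * ∑ i ∈ Finset.range Mx, ∑ j ∈ Finset.Ioo 0 My,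
          (v i j + v (i + 1) j) * (w i j + w (i + 1) j)
        + ∑ i ∈ Finset.range Mx, ∑ j ∈ Finset.range My,
          (v i j + v (i + 1) j + (v i (j + 1) + v (i + 1) (j + 1)))
            * (w i j + w (i + 1) j + (w i (j + 1) + w (i + 1) (j + 1)))) / 12 := by
    rw [Finset.mul_sum, ← Finset.sum_add_distrib, Finset.sum_div]
    refine Finset.sum_congr rfl fun i hi => ?_
    rw [Finset.mem_range] at hi
    rw [← sum_avgY_mul (v := fun i j => v i j + v (i + 1) j)
      (w := fun i j => w i j + w (i + 1) j) i]
    · exact Finset.sum_congr rfl fun j _ => by rw [avgY_add_shift]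
    · simp only [hw i (by omega) 0 (by omega) (by simp),
        hw (i + 1) (by omega) 0 (by omega) (by simp), add_zero]
    · simp only [hw i (by omega) My (by omega) (by simp),
        hw (i + 1) (by omega) My (by omega) (by simp), add_zero]
  rw [h1, h2]
  ring

theorem gridSum_avg_comm (hv : VanishesOnBdry Mx My v) (hw : VanishesOnBdry Mx My w) :
    gridSum Mx My (avg Mx My v) w = gridSum Mx My (avg Mx My w) v := by
  rw [gridSum_avg hw, gridSum_avg hv]
  simp only [gridSum, mul_comm]

theorem le_gridSum_avg_self (hv : VanishesOnBdry Mx My v) :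
    4 / 9 * gridSum Mx My v v ≤ gridSum Mx My (avg Mx My v) v := by
  rw [gridSum_avg hv]
  have h : ∀ (s t : Finset ℕ) (f : ℕ → ℕ → ℝ), 0 ≤ ∑ i ∈ s, ∑ j ∈ t, f i j * f i j :=
    fun s t f => Finset.sum_nonneg fun i _ => Finset.sum_nonneg fun j _ => mul_self_nonneg _
  have h1 := h (Finset.Ioo 0 Mx) (Finset.range My) (fun i j => v i j + v i (j + 1))
  have h2 := h (Finset.range Mx) (Finset.Ioo 0 My) (fun i j => v i j + v (i + 1) j)
  have h3 := h (Finset.range Mx) (Finset.range My)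
    (fun i j => v i j + v (i + 1) j + (v i (j + 1) + v (i + 1) (j + 1)))
  linarith

theorem sq_avg_le (a b c : ℝ) : ((a + 10 * b + c) / 12) ^ 2 ≤ (a ^ 2 + 10 * b ^ 2 + c ^ 2) / 12 := by
  nlinarith [sq_nonneg (a - b), sq_nonneg (b - c), sq_nonneg (a - c)]

theorem sum_avg_le {M : ℕ} {u : ℕ → ℝ} (hu : ∀ i, 0 ≤ u i) (h0 : u 0 = 0) (hM : u M = 0) :
    ∑ i ∈ Finset.Ioo 0 M, (u (i - 1) + 10 * u i + u (i + 1)) / 12 ≤ ∑ i ∈ Finset.Ioo 0 M, u i := by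
  rcases M with _ | K
  · simp
  rw [sum_Ioo_zero_succ, sum_Ioo_zero_succ, ← Finset.sum_div]
  simp only [Finset.sum_add_distrib, ← Finset.mul_sum, Nat.add_sub_cancel]
  have e1 := Finset.sum_range_succ u K
  have e2 := Finset.sum_range_succ' u K
  have e3 := Finset.sum_range_succ (fun i => u (i + 1)) K
  have e4 := Finset.sum_range_succ' (fun i => u (i + 1)) K
  have := hu K
  have := hu (0 + 1)
  simp only [hM, h0] at *
  linarith

/-- `𝒜` is a contraction: convexity of the square passes to averages of squares in each direction,
and for data vanishing at the ends the sum of the averages does not exceed the sum. -/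
theorem gridSum_avg_avg_le (hv : VanishesOnBdry Mx My v) :
    gridSum Mx My (avg Mx My v) (avg Mx My v) ≤ gridSum Mx My v v := by
  have hy : ∀ i ∈ Finset.Ioo 0 Mx, ∑ j ∈ Finset.Ioo 0 My, avgY My v i j ^ 2
      ≤ ∑ j ∈ Finset.Ioo 0 My, v i j ^ 2 := by
    intro i hi
    rw [Finset.mem_Ioo] at hi
    refine le_trans (Finset.sum_le_sum fun j hj => ?_) (sum_avg_le (u := fun j => v i j ^ 2)
      (fun j => sq_nonneg _) (by simp [hv i (by omega) 0 (by omega) (by simp)])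
      (by simp [hv i (by omega) My (by omega) (by simp)]))
    rw [Finset.mem_Ioo] at hj
    simp only [avgY, if_pos hj]
    exact sq_avg_le _ _ _
  have hbd : ∀ i, (i = 0 ∨ i = Mx) → ∀ j ∈ Finset.Ioo 0 My, avgY My v i j = 0 := by
    intro i hi j hj
    rw [Finset.mem_Ioo] at hj
    have hv' : ∀ k ≤ My, v i k = 0 := fun k hk => hv i (by omega) k hk (by tauto)
    simp only [avgY, if_pos hj, hv' (j - 1) (by omega), hv' j (by omega), hv' (j + 1) (by omega)]
    norm_num
  have hx : ∀ j ∈ Finset.Ioo 0 My, ∑ i ∈ Finset.Ioo 0 Mx, avg Mx My v i j ^ 2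
      ≤ ∑ i ∈ Finset.Ioo 0 Mx, avgY My v i j ^ 2 := by
    intro j hj
    refine le_trans (Finset.sum_le_sum fun i hi => ?_) (sum_avg_le (u := fun i => avgY My v i j ^ 2)
      (fun i => sq_nonneg _) (by simp [hbd 0 (by simp) j hj]) (by simp [hbd Mx (by simp) j hj]))
    rw [Finset.mem_Ioo] at hi
    simp only [avg, avgX, if_pos hi]
    exact sq_avg_le _ _ _
  unfold gridSum
  simp only [← sq]
  refine le_trans ?_ (Finset.sum_le_sum hy)
  rw [Finset.sum_comm, Finset.sum_comm (s := Finset.Ioo 0 Mx)]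
  exact Finset.sum_le_sum hx

theorem gridSum_self_nonneg : 0 ≤ gridSum Mx My v v :=
  Finset.sum_nonneg fun _ _ => Finset.sum_nonneg fun _ _ => mul_self_nonneg _

theorem abs_gridSum_le (v w : ℕ → ℕ → ℝ) :
    |gridSum Mx My v w| ≤ √(gridSum Mx My v v) * √(gridSum Mx My w w) := by
  rw [← Real.sqrt_mul gridSum_self_nonneg]
  refine Real.abs_le_sqrt ?_
  unfold gridSum
  simp only [← Finset.sum_product', ← sq]
  exact Finset.sum_mul_sq_le_sq_mul_sq _ _ _

theorem abs_gridSum_avg_le (hv : VanishesOnBdry Mx My v) (w : ℕ → ℕ → ℝ) :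
    |gridSum Mx My (avg Mx My v) w| ≤ √(gridSum Mx My v v) * √(gridSum Mx My w w) :=
  (abs_gridSum_le _ _).trans (mul_le_mul_of_nonneg_right
    (Real.sqrt_le_sqrt (gridSum_avg_avg_le hv)) (Real.sqrt_nonneg _))

/-- Summation by parts in `x` and the averaging identity in `y` present the form as a combination,
with nonnegative coefficients, of products `ℓ(v) ℓ(w)`. This shape lets positivity for scalar
sequences pass to grid functions. -/
theorem neg_gridSum_avgY_diffX (h : ℝ) (hw : VanishesOnBdry Mx My w) :
    -gridSum Mx My (avgY My (diffX h v)) w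
      = (8 * ∑ j ∈ Finset.Ioo 0 My, ∑ i ∈ Finset.range Mx,
          (v (i + 1) j - v i j) * (w (i + 1) j - w i j)
        + ∑ j ∈ Finset.range My, ∑ i ∈ Finset.range Mx,
          (v (i + 1) j + v (i + 1) (j + 1) - (v i j + v i (j + 1)))
            * (w (i + 1) j + w (i + 1) (j + 1) - (w i j + w i (j + 1)))) / (12 * h ^ 2) := by
  have h1 : gridSum Mx My (avgY My (diffX h v)) w = (8 * gridSum Mx My (diffX h v) w
      + ∑ i ∈ Finset.Ioo 0 Mx, ∑ j ∈ Finset.range My,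
          (diffX h v i j + diffX h v i (j + 1)) * (w i j + w i (j + 1))) / 12 := by
    unfold gridSum
    rw [Finset.mul_sum, ← Finset.sum_add_distrib, Finset.sum_div]
    refine Finset.sum_congr rfl fun i hi => ?_
    rw [Finset.mem_Ioo] at hi
    exact sum_avgY_mul i (hw i (by omega) 0 (by omega) (by simp))
      (hw i (by omega) My le_rfl (by simp))
  have h2 : ∑ j ∈ Finset.Ioo 0 My, ∑ i ∈ Finset.range Mx,
      (v (i + 1) j - v i j) * (w (i + 1) j - w i j) = -(gridSum Mx My
        (fun i j => v (i + 1) j - 2 * v i j + v (i - 1) j) w) := by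
    unfold gridSum
    rw [Finset.sum_comm (s := Finset.Ioo 0 Mx), ← Finset.sum_neg_distrib]
    refine Finset.sum_congr rfl fun j hj => ?_
    rw [Finset.mem_Ioo] at hj
    rw [← sum_neg_diff_mul (fun i => v i j) (fun i => w i j) (hw 0 (by omega) j (by omega) (by simp))
      (hw Mx (by omega) j (by omega) (by simp)), ← Finset.sum_neg_distrib]
    exact Finset.sum_congr rfl fun i _ => by ring
  have h3 : ∑ j ∈ Finset.range My, ∑ i ∈ Finset.range Mx,
          (v (i + 1) j + v (i + 1) (j + 1) - (v i j + v i (j + 1)))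
            * (w (i + 1) j + w (i + 1) (j + 1) - (w i j + w i (j + 1)))
      = -∑ i ∈ Finset.Ioo 0 Mx, ∑ j ∈ Finset.range My,
          (v (i + 1) j - 2 * v i j + v (i - 1) j
            + (v (i + 1) (j + 1) - 2 * v i (j + 1) + v (i - 1) (j + 1))) * (w i j + w i (j + 1)) := by
    rw [Finset.sum_comm (s := Finset.Ioo 0 Mx), ← Finset.sum_neg_distrib]
    refine Finset.sum_congr rfl fun j hj => ?_
    rw [Finset.mem_range] at hj
    rw [← sum_neg_diff_mul (fun i => v i j + v i (j + 1)) (fun i => w i j + w i (j + 1))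
      (by simp only [hw 0 (by omega) j (by omega) (by simp),
        hw 0 (by omega) (j + 1) (by omega) (by simp), add_zero])
      (by simp only [hw Mx (by omega) j (by omega) (by simp),
        hw Mx (by omega) (j + 1) (by omega) (by simp), add_zero]), ← Finset.sum_neg_distrib]
    exact Finset.sum_congr rfl fun i _ => by ring
  have h4 : gridSum Mx My (diffX h v) w
      = (gridSum Mx My (fun i j => v (i + 1) j - 2 * v i j + v (i - 1) j) w) / h ^ 2 := by
    simp only [gridSum, diffX, Finset.sum_div, div_mul_eq_mul_div]
  have h5 : ∑ i ∈ Finset.Ioo 0 Mx, ∑ j ∈ Finset.range My,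
          (diffX h v i j + diffX h v i (j + 1)) * (w i j + w i (j + 1))
      = (∑ i ∈ Finset.Ioo 0 Mx, ∑ j ∈ Finset.range My,
          (v (i + 1) j - 2 * v i j + v (i - 1) j
            + (v (i + 1) (j + 1) - 2 * v i (j + 1) + v (i - 1) (j + 1))) * (w i j + w i (j + 1)))
          / h ^ 2 := by
    simp only [diffX, Finset.sum_div, div_mul_eq_mul_div, ← add_div]
  rw [h1, h2, h3, h4, h5]
  rw [mul_comm (12 : ℝ), ← div_div]
  ring

theorem gridSum_swap (v w : ℕ → ℕ → ℝ) :
    gridSum Mx My v w = gridSum My Mx (fun i j => v j i) (fun i j => w j i) :=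
  Finset.sum_comm

theorem VanishesOnBdry.swap (hw : VanishesOnBdry Mx My w) :
    VanishesOnBdry My Mx (fun i j => w j i) := fun i hi j hj h =>
  hw j hj i hi (by tauto)

section
variable {s : Finset ℕ} {t : ℕ → Finset ℕ} {W : ℕ → ℕ → ℝ}

/-- Positivity of a sum of values of a form, weighted by `W`. -/
def PosWeighted (s : Finset ℕ) (t : ℕ → Finset ℕ) (W b : ℕ → ℕ → ℝ) : Prop :=
  0 ≤ ∑ m ∈ s, ∑ j ∈ t m, W m j * b j m

theorem PosWeighted.add {b c : ℕ → ℕ → ℝ} (hb : PosWeighted s t W b) (hc : PosWeighted s t W c) :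
    PosWeighted s t W (fun j m => b j m + c j m) := by
  unfold PosWeighted at *
  simp only [mul_add, Finset.sum_add_distrib]
  exact add_nonneg hb hc

theorem PosWeighted.const_mul {b : ℕ → ℕ → ℝ} {c : ℝ} (hc : 0 ≤ c) (hb : PosWeighted s t W b) :
    PosWeighted s t W (fun j m => c * b j m) := by
  unfold PosWeighted at *
  simp only [mul_left_comm _ c, ← Finset.mul_sum]
  exact mul_nonneg hc hb

theorem PosWeighted.div_const {b : ℕ → ℕ → ℝ} {c : ℝ} (hc : 0 ≤ c) (hb : PosWeighted s t W b) :
    PosWeighted s t W (fun j m => b j m / c) := by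
  simpa only [div_eq_inv_mul] using hb.const_mul (inv_nonneg.2 hc)

theorem PosWeighted.sum {ι : Type*} {σ : Finset ι} {b : ι → ℕ → ℕ → ℝ}
    (hb : ∀ k ∈ σ, PosWeighted s t W (b k)) :
    PosWeighted s t W (fun j m => ∑ k ∈ σ, b k j m) := by
  unfold PosWeighted at *
  have : ∑ m ∈ s, ∑ j ∈ t m, W m j * ∑ k ∈ σ, b k j m
      = ∑ k ∈ σ, ∑ m ∈ s, ∑ j ∈ t m, W m j * b k j m := by
    simp only [Finset.mul_sum]
    exact (Finset.sum_congr rfl fun m _ => Finset.sum_comm).trans Finset.sum_comm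
  rw [this]
  exact Finset.sum_nonneg hb

/-- For each of the functionals `ℓ` above, the hypothesis on `W` is applied to the scalar sequence
`ℓ(V m)`, and the results are added. -/
theorem posWeighted_neg_gridSum_avgY_diffX (h : ℝ)
    (hW : ∀ x : ℕ → ℝ, PosWeighted s t W (fun j m => x j * x m)) {V : ℕ → ℕ → ℕ → ℝ}
    (hV : ∀ m ∈ s, VanishesOnBdry Mx My (V m)) :
    PosWeighted s t W (fun j m => -gridSum Mx My (avgY My (diffX h (V j))) (V m)) := by
  have key := ((PosWeighted.sum (σ := Finset.Ioo 0 My) fun l _ =>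
      PosWeighted.sum (σ := Finset.range Mx) fun i _ =>
        hW (fun m => V m (i + 1) l - V m i l)).const_mul (by norm_num : (0 : ℝ) ≤ 8)).add
    (PosWeighted.sum (σ := Finset.range My) fun l _ =>
      PosWeighted.sum (σ := Finset.range Mx) fun i _ =>
        hW (fun m => V m (i + 1) l + V m (i + 1) (l + 1) - (V m i l + V m i (l + 1))))
  have key2 := key.div_const (by positivity : (0 : ℝ) ≤ 12 * h ^ 2)
  unfold PosWeighted at *
  refine key2.trans (le_of_eq ?_)
  refine Finset.sum_congr rfl fun m hm => Finset.sum_congr rfl fun j _ => ?_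
  beta_reduce
  rw [neg_gridSum_avgY_diffX h (hV m hm)]

theorem posWeighted_neg_gridSum_lap (D : Rectangle)
    (hW : ∀ x : ℕ → ℝ, PosWeighted s t W (fun j m => x j * x m)) {V : ℕ → ℕ → ℕ → ℝ}
    (hV : ∀ m ∈ s, VanishesOnBdry Mx My (V m)) :
    PosWeighted s t W (fun j m => -gridSum Mx My (D.lap Mx My (V j)) (V m)) := by
  have h1 := posWeighted_neg_gridSum_avgY_diffX (D.stepX Mx) hW hV
  have h2 := posWeighted_neg_gridSum_avgY_diffX (Mx := My) (My := Mx) (D.stepY My) hW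
    (V := fun m i j => V m j i) (fun m hm => (hV m hm).swap)
  have h3 := h1.add h2
  have e : ∀ j m, -gridSum Mx My (D.lap Mx My (V j)) (V m)
      = -gridSum Mx My (avgY My (diffX (D.stepX Mx) (V j))) (V m)
        + -gridSum My Mx (avgY Mx (diffX (D.stepY My) fun i k => V j k i)) (fun i k => V m k i) := by
    intro j m
    have : gridSum My Mx (avgY Mx (diffX (D.stepY My) fun i k => V j k i)) (fun i k => V m k i)
        = gridSum Mx My (avgX Mx (diffY (D.stepY My) (V j))) (V m) := by
      rw [gridSum_swap]; rfl
    rw [this, ← neg_add]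
    simp only [gridSum, Rectangle.lap, add_mul, Finset.sum_add_distrib]
  simp only [e]
  exact h3

end

end DiffusionWave

namespace DiffusionWave
open MeasureTheory

/-! ### The averaged product integration weights -/

/-- The primitive `t^a / Γ(a+1)` of the Abel kernel. -/
noncomputable def abelPrimitive (a t : ℝ) : ℝ := t ^ a / Real.Gamma (a + 1)

variable {a τ : ℝ}

theorem abelPrimitive_zero (ha : 0 < a) : abelPrimitive a 0 = 0 := by
  simp [abelPrimitive, Real.zero_rpow ha.ne']

theorem continuous_abelPrimitive (ha : 0 < a) : Continuous (abelPrimitive a) := by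
  unfold abelPrimitive
  exact (Real.continuous_rpow_const ha.le).div_const _

theorem abelPrimitive_mono (ha : 0 < a) : MonotoneOn (abelPrimitive a) (Ici 0) := by
  intro x hx y _ hxy
  have := Real.Gamma_pos_of_pos (show 0 < a + 1 by linarith)
  unfold abelPrimitive
  have := Real.rpow_le_rpow hx hxy ha.le
  gcongr

theorem integral_abelKernel_sub (ha : 0 < a) (l m t : ℝ) :
    ∫ s in l..m, abelKernel a (t - s) = abelPrimitive a (t - l) - abelPrimitive a (t - m) := by
  rw [intervalIntegral.integral_comp_sub_left (abelKernel a)]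
  unfold abelKernel abelPrimitive
  rw [intervalIntegral.integral_div, integral_rpow (Or.inl (by linarith)), Real.Gamma_add_one ha.ne']
  have := (Real.Gamma_pos_of_pos ha).ne'
  simp only [sub_add_cancel]
  field_simp

/-- The integral of the primitive of the Abel kernel over the `m`-th cell. -/
noncomputable def cellWeight (a τ : ℝ) (m : ℕ) : ℝ :=
  ∫ r in (0 : ℝ)..τ, abelPrimitive a ((m : ℝ) * τ + r)

theorem integral_abelPrimitive_sub (n j : ℕ) (hj : j < n) :
    ∫ t in (((n : ℝ) - 1) * τ)..((n : ℝ) * τ), abelPrimitive a (t - j * τ)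
      = cellWeight a τ (n - 1 - j) := by
  unfold cellWeight
  have h : ((n - 1 - j : ℕ) : ℝ) = n - 1 - j := by
    rw [Nat.cast_sub (by omega), Nat.cast_sub (by omega), Nat.cast_one]
  have e : ∀ r : ℝ, abelPrimitive a (((n - 1 - j : ℕ) : ℝ) * τ + r)
      = (fun t => abelPrimitive a (t - j * τ)) (((n : ℝ) - 1) * τ + r) := fun r => by
    simp only; congr 1; rw [h]; ring
  simp only [e]
  rw [intervalIntegral.integral_comp_add_left (fun t => abelPrimitive a (t - j * τ))]
  congr 1 <;> ring

/-- The `j`-th cell lies to the left of the `n`-th, so the minimum is inactive and the inner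
integral is a difference of values of the primitive. The weights depend on `n - j` only. -/
theorem piWeight_lt (ha : 0 < a) (hτ : 0 < τ) {n j : ℕ} (hj : 1 ≤ j) (hjn : j < n) :
    piWeight a τ n j = (cellWeight a τ (n - j) - cellWeight a τ (n - 1 - j)) / τ := by
  unfold piWeight
  have h1 : ((n : ℝ) - 1) * τ ≤ n * τ := by nlinarith
  have h2 : (j : ℝ) * τ ≤ ((n : ℝ) - 1) * τ := by
    have : (j : ℝ) + 1 ≤ n := by exact_mod_cast hjn
    nlinarith
  have e : ∫ t in (((n : ℝ) - 1) * τ)..((n : ℝ) * τ),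
      ∫ s in (((j : ℝ) - 1) * τ)..(min t ((j : ℝ) * τ)), abelKernel a (t - s)
      = ∫ t in (((n : ℝ) - 1) * τ)..((n : ℝ) * τ),
        (abelPrimitive a (t - (j - 1 : ℕ) * τ) - abelPrimitive a (t - j * τ)) := by
    refine intervalIntegral.integral_congr fun t ht => ?_
    rw [uIcc_of_le h1] at ht
    rw [integral_abelKernel_sub ha, min_eq_right (h2.trans ht.1), Nat.cast_sub hj, Nat.cast_one]
  have hc : ∀ x : ℝ, IntervalIntegrable (fun t => abelPrimitive a (t - x)) volume
      (((n : ℝ) - 1) * τ) ((n : ℝ) * τ) := fun x =>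
    ((continuous_abelPrimitive ha).comp (continuous_sub_right x)).intervalIntegrable _ _
  rw [e, intervalIntegral.integral_sub (hc _) (hc _), integral_abelPrimitive_sub n (j - 1) (by omega),
    integral_abelPrimitive_sub n j hjn, show n - 1 - (j - 1) = n - j by omega]
  ring

theorem piWeight_self (ha : 0 < a) (hτ : 0 < τ) {n : ℕ} (hn : 1 ≤ n) :
    piWeight a τ n n = cellWeight a τ 0 / τ := by
  unfold piWeight
  have h1 : ((n : ℝ) - 1) * τ ≤ n * τ := by nlinarith
  have e : ∫ t in (((n : ℝ) - 1) * τ)..((n : ℝ) * τ),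
      ∫ s in (((n : ℝ) - 1) * τ)..(min t ((n : ℝ) * τ)), abelKernel a (t - s)
      = ∫ t in (((n : ℝ) - 1) * τ)..((n : ℝ) * τ), abelPrimitive a (t - (n - 1 : ℕ) * τ) := by
    refine intervalIntegral.integral_congr fun t ht => ?_
    rw [uIcc_of_le h1] at ht
    rw [integral_abelKernel_sub ha, min_eq_left ht.2, Nat.cast_sub hn, Nat.cast_one, sub_self,
      abelPrimitive_zero ha, sub_zero]
  rw [e, integral_abelPrimitive_sub n (n - 1) (by omega), Nat.sub_self]
  ring

theorem cellWeight_intervalIntegrable (ha : 0 < a) (x : ℝ) :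
    IntervalIntegrable (fun r => abelPrimitive a (x + r)) volume 0 τ :=
  ((continuous_abelPrimitive ha).comp (continuous_const.add continuous_id)).intervalIntegrable _ _

theorem cellWeight_mono (ha : 0 < a) (hτ : 0 < τ) : Monotone (cellWeight a τ) := by
  intro m n hmn
  refine intervalIntegral.integral_mono_on hτ.le (cellWeight_intervalIntegrable ha _)
    (cellWeight_intervalIntegrable ha _) fun r hr => ?_
  have h1 : (m : ℝ) * τ ≤ n * τ := by gcongr
  have h0 : 0 ≤ (m : ℝ) * τ := by positivity
  exact abelPrimitive_mono ha (add_nonneg h0 hr.1) (add_nonneg (h0.trans h1) hr.1) (by linarith)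

theorem abelPrimitive_nonneg (ha : 0 < a) {x : ℝ} (hx : 0 ≤ x) : 0 ≤ abelPrimitive a x := by
  have := abelPrimitive_mono ha (mem_Ici.2 le_rfl) hx hx
  rwa [abelPrimitive_zero ha] at this

theorem cellWeight_nonneg (ha : 0 < a) (hτ : 0 < τ) (m : ℕ) : 0 ≤ cellWeight a τ m :=
  intervalIntegral.integral_nonneg hτ.le fun r hr =>
    abelPrimitive_nonneg ha (add_nonneg (by positivity) hr.1)

theorem cellWeight_le (ha : 0 < a) (hτ : 0 < τ) {m : ℕ} {T : ℝ} (hT : ((m : ℝ) + 1) * τ ≤ T) :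
    cellWeight a τ m ≤ τ * abelPrimitive a T := by
  have : τ * abelPrimitive a T = ∫ _ in (0 : ℝ)..τ, abelPrimitive a T := by simp
  rw [this]
  refine intervalIntegral.integral_mono_on hτ.le (cellWeight_intervalIntegrable ha _)
    (by simp) fun r hr => ?_
  have h0 : 0 ≤ (m : ℝ) * τ := by positivity
  have h1 : (m : ℝ) * τ + r ≤ T := by linarith [hr.2]
  have h2 : (0 : ℝ) ≤ m * τ + r := add_nonneg h0 hr.1
  exact abelPrimitive_mono ha h2 (mem_Ici.2 (h2.trans h1)) h1

theorem piWeight_nonneg (ha : 0 < a) (hτ : 0 < τ) {n j : ℕ} (hj : 1 ≤ j) (hjn : j ≤ n) :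
    0 ≤ piWeight a τ n j := by
  rcases hjn.eq_or_lt with rfl | h
  · rw [piWeight_self ha hτ hj]; exact div_nonneg (cellWeight_nonneg ha hτ 0) hτ.le
  · rw [piWeight_lt ha hτ hj h]
    exact div_nonneg (sub_nonneg.2 (cellWeight_mono ha hτ (by omega))) hτ.le

/-- The sum with the weights `λ` is the increment, between two consecutive levels, of the discrete
convolution with `cellWeight`. In this form it is compared with the increment of `B * φ`. -/
theorem sum_piWeight_mul (ha : 0 < a) (hτ : 0 < τ) (n : ℕ) (c : ℕ → ℝ) :
    τ * ∑ j ∈ Finset.Icc 1 (n + 1), piWeight a τ (n + 1) j * c j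
      = ∑ j ∈ Finset.range (n + 1), cellWeight a τ (n - j) * c (j + 1)
        - ∑ j ∈ Finset.range n, cellWeight a τ (n - 1 - j) * c (j + 1) := by
  have e : ∑ j ∈ Finset.Icc 1 (n + 1), piWeight a τ (n + 1) j * c j
      = ∑ j ∈ Finset.range (n + 1), piWeight a τ (n + 1) (j + 1) * c (j + 1) := by
    rw [← Finset.Ico_add_one_right_eq_Icc, Finset.sum_Ico_eq_sum_range]
    simp [add_comm]
  rw [e, Finset.sum_range_succ, Finset.sum_range_succ, piWeight_self ha hτ (by omega), mul_add,
    Nat.sub_self, add_sub_right_comm, ← Finset.sum_sub_distrib, Finset.mul_sum]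
  congr 1
  · refine Finset.sum_congr rfl fun j hj => ?_
    rw [Finset.mem_range] at hj
    rw [piWeight_lt ha hτ (by omega) (by omega), show n + 1 - (j + 1) = n - j by omega,
      show n + 1 - 1 - (j + 1) = n - 1 - j by omega]
    field_simp
  · field_simp

theorem sum_piWeight_le (ha : 0 < a) (hτ : 0 < τ) {n : ℕ} {T : ℝ} (hn : 1 ≤ n)
    (hT : (n : ℝ) * τ ≤ T) : ∑ j ∈ Finset.Icc 1 n, piWeight a τ n j ≤ abelPrimitive a T := by
  obtain ⟨n, rfl⟩ : ∃ m, n = m + 1 := ⟨n - 1, by omega⟩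
  have h := sum_piWeight_mul ha hτ n (fun _ => 1)
  simp only [mul_one] at h
  rw [Finset.sum_range_succ', Nat.sub_zero] at h
  have e : ∑ k ∈ Finset.range n, cellWeight a τ (n - (k + 1))
      = ∑ k ∈ Finset.range n, cellWeight a τ (n - 1 - k) :=
    Finset.sum_congr rfl fun k _ => by rw [show n - (k + 1) = n - 1 - k by omega]
  rw [e, add_sub_cancel_left] at h
  have h2 := cellWeight_le ha hτ (m := n) (T := T) (by push_cast at hT; exact hT)
  rw [← h] at h2
  exact le_of_mul_le_mul_left h2 hτ

theorem piRule_eq_sum {n : ℕ} (hn : 1 ≤ n) (φ : ℕ → ℝ) :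
    piRule a τ n φ = ∑ j ∈ Finset.Icc 1 n,
      piWeight a τ n j * (if j = 1 then φ 1 else (φ j + φ (j - 1)) / 2) := by
  unfold piRule
  have : Finset.Icc 1 n = insert 1 (Finset.Icc 2 n) := by
    ext x; simp only [Finset.mem_Icc, Finset.mem_insert]; omega
  rw [this, Finset.sum_insert (by simp)]
  simp only [if_true]
  congr 1
  refine Finset.sum_congr rfl fun j hj => ?_
  rw [Finset.mem_Icc] at hj
  rw [if_neg (by omega)]

theorem abs_piRule_le (ha : 0 < a) (hτ : 0 < τ) {n : ℕ} {T : ℝ} (hn : 1 ≤ n)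
    (hT : (n : ℝ) * τ ≤ T) {φ : ℕ → ℝ} {Y : ℝ} (hφ : ∀ j, 1 ≤ j → j ≤ n → |φ j| ≤ Y) :
    |piRule a τ n φ| ≤ abelPrimitive a T * Y := by
  have hY : 0 ≤ Y := (abs_nonneg _).trans (hφ 1 le_rfl hn)
  rw [piRule_eq_sum hn]
  refine (Finset.abs_sum_le_sum_abs _ _).trans ?_
  calc _ ≤ ∑ j ∈ Finset.Icc 1 n, piWeight a τ n j * Y := by
        refine Finset.sum_le_sum fun j hj => ?_
        rw [Finset.mem_Icc] at hj
        rw [abs_mul, abs_of_nonneg (piWeight_nonneg ha hτ hj.1 hj.2)]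
        refine mul_le_mul_of_nonneg_left ?_ (piWeight_nonneg ha hτ hj.1 hj.2)
        split_ifs with h
        · exact hφ 1 le_rfl hn
        · have h1 := abs_le.1 (hφ j hj.1 hj.2)
          have h2 := abs_le.1 (hφ (j - 1) (by omega) (by omega))
          rw [abs_le]
          constructor <;> linarith [h1.1, h1.2, h2.1, h2.2]
    _ ≤ _ := by
        rw [← Finset.sum_mul]
        exact mul_le_mul_of_nonneg_right (sum_piWeight_le ha hτ hn hT) hY

/-! ### Positivity of the weights -/

/-- The one-sided power `(t - r)_+^q`. -/
noncomputable def truncPow (q t r : ℝ) : ℝ := if r < t then (t - r) ^ q else 0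

theorem truncPow_nonneg (q t r : ℝ) : 0 ≤ truncPow q t r := by
  unfold truncPow
  split_ifs with h
  · exact Real.rpow_nonneg (by linarith) _
  · exact le_rfl

theorem measurable_truncPow (q : ℝ) : Measurable (fun p : ℝ × ℝ => truncPow q p.1 p.2) := by
  unfold truncPow
  exact Measurable.ite (measurableSet_lt measurable_snd measurable_fst)
    ((measurable_fst.sub measurable_snd).pow_const q) measurable_const

/-- `q > -1` gives integrability at `0`, and `2q < -1` gives it at infinity. -/
theorem integrableOn_rpow_mul_rpow {q d : ℝ} (hq : -1 < q) (hq2 : q < -1 / 2) (hd : 0 < d) :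
    IntegrableOn (fun y : ℝ => y ^ q * (y + d) ^ q) (Ioi 0) := by
  have hmeas : Measurable (fun y : ℝ => y ^ q * (y + d) ^ q) := by fun_prop
  rw [← Ioc_union_Ioi_eq_Ioi (zero_le_one (α := ℝ))]
  refine IntegrableOn.union ?_ ?_
  · have h1 : IntegrableOn (fun y : ℝ => y ^ q * d ^ q) (Ioc 0 1) := by
      refine Integrable.mul_const ?_ _
      exact (intervalIntegrable_iff_integrableOn_Ioc_of_le zero_le_one).1
        (intervalIntegral.intervalIntegrable_rpow' hq)
    refine h1.mono' hmeas.aestronglyMeasurable ?_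
    filter_upwards [ae_restrict_mem measurableSet_Ioc] with y hy
    have hy0 : 0 < y := hy.1
    rw [Real.norm_eq_abs, abs_of_nonneg (by positivity)]
    exact mul_le_mul_of_nonneg_left (Real.rpow_le_rpow_of_nonpos hd (by linarith) (by linarith))
      (by positivity)
  · have h1 : IntegrableOn (fun y : ℝ => y ^ (2 * q)) (Ioi 1) :=
      integrableOn_Ioi_rpow_of_lt (by linarith) one_pos
    refine h1.mono' hmeas.aestronglyMeasurable ?_
    filter_upwards [ae_restrict_mem measurableSet_Ioi] with y hy
    have hy0 : 0 < y := lt_trans one_pos hy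
    rw [Real.norm_eq_abs, abs_of_nonneg (by positivity), two_mul, Real.rpow_add hy0]
    exact mul_le_mul_of_nonneg_left (Real.rpow_le_rpow_of_nonpos hy0 (by linarith) (by linarith))
      (by positivity)

theorem integral_rpow_mul_rpow {q d : ℝ} (hd : 0 < d) :
    ∫ y in Ioi (0 : ℝ), y ^ q * (y + d) ^ q
      = d ^ (2 * q + 1) * ∫ y in Ioi (0 : ℝ), y ^ q * (y + 1) ^ q := by
  have h := integral_comp_mul_left_Ioi (fun y : ℝ => y ^ q * (y + d) ^ q) 0 hd
  rw [mul_zero, smul_eq_mul] at h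
  have e : ∫ x in Ioi (0 : ℝ), (fun y : ℝ => y ^ q * (y + d) ^ q) (d * x)
      = ∫ x in Ioi (0 : ℝ), d ^ (2 * q) * (x ^ q * (x + 1) ^ q) := by
    refine setIntegral_congr_fun measurableSet_Ioi fun x hx => ?_
    have hx0 : 0 < x := hx
    simp only
    rw [show d * x + d = d * (x + 1) by ring, Real.mul_rpow hd.le hx0.le,
      Real.mul_rpow hd.le (by linarith), two_mul, Real.rpow_add hd]
    ring
  rw [e, integral_const_mul] at h
  rw [Real.rpow_add hd, Real.rpow_one]
  field_simp at h
  linarith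

/-- After reflection about `s` this is the scaling identity for `y^q (y + d)^q`. With `q = a/2 - 1`
the exponent `2q + 1` is `a - 1`, so the Abel kernel is an `L²` pairing of translates. -/
theorem truncPow_integral {q s t : ℝ} (hq : -1 < q) (hq2 : q < -1 / 2) (hst : s < t) :
    Integrable (fun r => truncPow q t r * truncPow q s r) ∧
    ∫ r, truncPow q t r * truncPow q s r
      = (t - s) ^ (2 * q + 1) * ∫ y in Ioi (0 : ℝ), y ^ q * (y + 1) ^ q := by
  have hd : 0 < t - s := by linarith
  have e : (fun y => truncPow q t (s - y) * truncPow q s (s - y))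
      = (Ioi (0 : ℝ)).indicator (fun y => y ^ q * (y + (t - s)) ^ q) := by
    funext y
    by_cases hy : 0 < y
    · rw [indicator_of_mem (show y ∈ Ioi (0 : ℝ) from hy)]
      unfold truncPow
      rw [if_pos (by linarith), if_pos (by linarith), show t - (s - y) = y + (t - s) by ring,
        show s - (s - y) = y by ring, mul_comm]
    · rw [indicator_of_notMem (show y ∉ Ioi (0 : ℝ) from hy)]
      unfold truncPow
      rw [if_neg (show ¬ s - y < s by linarith), mul_zero]
  constructor
  · have h : Integrable (fun y => truncPow q t (s - y) * truncPow q s (s - y)) := by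
      rw [e, integrable_indicator_iff measurableSet_Ioi]
      exact integrableOn_rpow_mul_rpow hq hq2 hd
    have := h.comp_sub_left s
    simpa using this
  · rw [← integral_sub_left_eq_self (fun r => truncPow q t r * truncPow q s r) volume s, e,
      integral_indicator measurableSet_Ioi, integral_rpow_mul_rpow hd]

end DiffusionWave

namespace DiffusionWave
open MeasureTheory
open scoped ENNReal

variable {a τ : ℝ}

/-- The `n`-th time cell. -/
def timeCell (τ : ℝ) (n : ℕ) : Set ℝ := Ioc (((n : ℝ) - 1) * τ) (n * τ)

theorem measurableSet_timeCell (τ : ℝ) (n : ℕ) : MeasurableSet (timeCell τ n) := measurableSet_Ioc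

/-- The double integral of `(t - s)_+^(a-1)` over a product of two cells. -/
noncomputable def lowerIntegral (a τ : ℝ) (n j : ℕ) : ℝ≥0∞ :=
  ∫⁻ t in timeCell τ n, ∫⁻ s in timeCell τ j, ENNReal.ofReal (truncPow (a - 1) t s)

theorem lowerIntegral_of_lt (hτ : 0 < τ) {n j : ℕ} (h : n < j) : lowerIntegral a τ n j = 0 := by
  unfold lowerIntegral
  have h2 : (n : ℝ) * τ ≤ ((j : ℝ) - 1) * τ := by
    have : (n : ℝ) + 1 ≤ j := by exact_mod_cast h
    nlinarith
  refine (setLIntegral_congr_fun (measurableSet_timeCell τ n) (g := fun _ => 0) fun t ht => ?_).trans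
    (by simp)
  refine (setLIntegral_congr_fun (measurableSet_timeCell τ j) (g := fun _ => 0) fun s hs => ?_).trans
    (by simp)
  have : ¬ s < t := by
    have := ht.2; have := hs.1; linarith
  simp [truncPow, this]

/-- Relates the truncated power on a full cell to the inner integral of `piWeight`, where the cut at
`min t u` replaces the truncation. At `s = t` the real power takes the value `0`, so both integrands
agree there. -/
theorem lintegral_truncPow (ha : 0 < a) (ha1 : a < 1) {l u t : ℝ} (hlu : l ≤ u) (hlt : l ≤ t) :
    ∫⁻ s in Ioc l u, ENNReal.ofReal (truncPow (a - 1) t s)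
      = ENNReal.ofReal (Real.Gamma a * ∫ s in l..(min t u), abelKernel a (t - s)) := by
  have hm : l ≤ min t u := le_min hlt hlu
  have e : ∫⁻ s in Ioc l u, ENNReal.ofReal (truncPow (a - 1) t s)
      = ∫⁻ s in Ioc l (min t u), ENNReal.ofReal ((t - s) ^ (a - 1)) := by
    rw [← lintegral_indicator measurableSet_Ioc, ← lintegral_indicator measurableSet_Ioc]
    congr 1
    funext s
    by_cases h1 : s ∈ Ioc l u
    · rw [indicator_of_mem h1]
      rcases lt_trichotomy s t with h | h | h
      · rw [indicator_of_mem (show s ∈ Ioc l (min t u) from ⟨h1.1, le_min h.le h1.2⟩), truncPow,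
          if_pos h]
      · rw [indicator_of_mem (show s ∈ Ioc l (min t u) from ⟨h1.1, le_min h.le h1.2⟩), truncPow,
          if_neg (by linarith), h, sub_self, Real.zero_rpow (by linarith)]
      · rw [indicator_of_notMem, truncPow, if_neg (by linarith), ENNReal.ofReal_zero]
        exact fun h2 => by have := h2.2.trans (min_le_left _ _); linarith
    · rw [indicator_of_notMem h1, indicator_of_notMem]
      exact fun h2 => h1 ⟨h2.1, h2.2.trans (min_le_right _ _)⟩
  have hint : IntegrableOn (fun s => (t - s) ^ (a - 1)) (Ioc l (min t u)) := by
    rw [← intervalIntegrable_iff_integrableOn_Ioc_of_le hm]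
    have := (intervalIntegral.intervalIntegrable_rpow' (r := a - 1) (a := t - l)
      (b := t - min t u) (by linarith)).comp_sub_left t
    simpa using this
  rw [e, ← ofReal_integral_eq_lintegral_ofReal hint]
  · congr 1
    unfold abelKernel
    rw [intervalIntegral.integral_div, mul_div_cancel₀ _ (Real.Gamma_pos_of_pos ha).ne',
      intervalIntegral.integral_of_le hm]
  · filter_upwards [ae_restrict_mem measurableSet_Ioc] with s hs
    exact Real.rpow_nonneg (by linarith [hs.2.trans (min_le_left t u)]) _

theorem lowerIntegral_eq (ha : 0 < a) (ha1 : a < 1) (hτ : 0 < τ) {n j : ℕ}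
    (hjn : j ≤ n) :
    lowerIntegral a τ n j = ENNReal.ofReal (Real.Gamma a * τ * piWeight a τ n j) := by
  have hl : ((j : ℝ) - 1) * τ ≤ j * τ := by nlinarith
  have hn : ((n : ℝ) - 1) * τ ≤ n * τ := by nlinarith
  have hln : ((j : ℝ) - 1) * τ ≤ ((n : ℝ) - 1) * τ := by
    have : (j : ℝ) ≤ n := by exact_mod_cast hjn
    nlinarith
  have hΓ := Real.Gamma_pos_of_pos ha
  set F : ℝ → ℝ := fun t => abelPrimitive a (t - ((j : ℝ) - 1) * τ)
    - abelPrimitive a (t - min t ((j : ℝ) * τ)) with hF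
  have hFc : Continuous F := by
    have := continuous_abelPrimitive ha
    rw [hF]; fun_prop
  have hFi : ∀ t, ∫ s in (((j : ℝ) - 1) * τ)..(min t ((j : ℝ) * τ)), abelKernel a (t - s) = F t :=
    fun t => integral_abelKernel_sub ha _ _ _
  have hF0 : ∀ t ∈ timeCell τ n, 0 ≤ F t := by
    intro t ht
    have h1 : ((j : ℝ) - 1) * τ ≤ t := hln.trans ht.1.le
    have h2 := le_min h1 hl
    exact sub_nonneg.2 (abelPrimitive_mono ha (mem_Ici.2 (sub_nonneg.2 (min_le_left _ _)))
      (mem_Ici.2 (sub_nonneg.2 h1)) (by linarith))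
  unfold lowerIntegral
  have e1 : ∫⁻ t in timeCell τ n, ∫⁻ s in timeCell τ j, ENNReal.ofReal (truncPow (a - 1) t s)
      = ∫⁻ t in timeCell τ n, ENNReal.ofReal (Real.Gamma a * F t) := by
    refine setLIntegral_congr_fun (measurableSet_timeCell τ n) fun t ht => ?_
    rw [timeCell, lintegral_truncPow ha ha1 hl (hln.trans ht.1.le), hFi]
  rw [e1, ← ofReal_integral_eq_lintegral_ofReal]
  · congr 1
    rw [integral_const_mul, mul_assoc]
    congr 1
    unfold piWeight
    simp only [hFi]
    rw [intervalIntegral.integral_of_le hn, ← mul_assoc, mul_one_div_cancel hτ.ne', one_mul]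
    rfl
  · exact ((hFc.const_mul _).integrableOn_Icc).mono_set Ioc_subset_Icc_self
  · filter_upwards [ae_restrict_mem (measurableSet_timeCell τ n)] with t ht
    exact mul_nonneg hΓ.le (hF0 t ht)

/-- The integral of `(t - r)_+^q` over the `n`-th cell. -/
noncomputable def cellPow (q τ : ℝ) (n : ℕ) (r : ℝ) : ℝ≥0∞ :=
  ∫⁻ t in timeCell τ n, ENNReal.ofReal (truncPow q t r)

theorem measurable_cellPow (q τ : ℝ) (n : ℕ) : Measurable (cellPow q τ n) := by
  unfold cellPow
  exact Measurable.lintegral_prod_left' (f := fun p : ℝ × ℝ => ENNReal.ofReal (truncPow q p.1 p.2))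
    (measurable_truncPow q).ennreal_ofReal

/-- The constant in the representation of a power as a convolution of one-sided powers. -/
noncomputable def powConst (q : ℝ) : ℝ := ∫ y in Ioi (0 : ℝ), y ^ q * (y + 1) ^ q

theorem powConst_pos {q : ℝ} (hq : -1 < q) (hq2 : q < -1 / 2) : 0 < powConst q := by
  unfold powConst
  have hint := integrableOn_rpow_mul_rpow hq hq2 one_pos
  rw [setIntegral_pos_iff_support_of_nonneg_ae _ hint]
  · have : Function.support (fun y : ℝ => y ^ q * (y + 1) ^ q) ∩ Ioi 0 = Ioi 0 := by
      refine inter_eq_right.2 fun y hy => ?_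
      have hy0 : (0 : ℝ) < y := hy
      rw [Function.mem_support]
      positivity
    rw [this]; simp
  · filter_upwards [ae_restrict_mem measurableSet_Ioi] with y hy
    have hy0 : (0 : ℝ) < y := hy
    simp only [Pi.zero_apply]; positivity

/-- Only one of the two one-sided powers on the right is nonzero. The diagonal is excluded because
the integral on the left diverges there; it is a null set in the next step. -/
theorem lintegral_truncPow_mul {q : ℝ} (hq : -1 < q) (hq2 : q < -1 / 2) {s t : ℝ} (h : s ≠ t) :
    ∫⁻ r, ENNReal.ofReal (truncPow q t r) * ENNReal.ofReal (truncPow q s r)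
      = ENNReal.ofReal (powConst q) * (ENNReal.ofReal (truncPow (2 * q + 1) t s)
        + ENNReal.ofReal (truncPow (2 * q + 1) s t)) := by
  have key : ∀ s t : ℝ, s < t →
      ∫⁻ r, ENNReal.ofReal (truncPow q t r) * ENNReal.ofReal (truncPow q s r)
      = ENNReal.ofReal (powConst q) * (ENNReal.ofReal (truncPow (2 * q + 1) t s)
        + ENNReal.ofReal (truncPow (2 * q + 1) s t)) := by
    intro s t h
    obtain ⟨h1, h2⟩ := truncPow_integral hq hq2 h
    simp only [← ENNReal.ofReal_mul (truncPow_nonneg _ _ _)]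
    rw [← ofReal_integral_eq_lintegral_ofReal h1
      (Filter.Eventually.of_forall fun r => mul_nonneg (truncPow_nonneg _ _ _) (truncPow_nonneg _ _ _)),
      h2, ← powConst, mul_comm, ENNReal.ofReal_mul (powConst_pos hq hq2).le]
    congr 1
    simp [truncPow, h, not_lt.2 h.le]
  rcases lt_or_gt_of_ne h with h | h
  · exact key s t h
  · have := key t s h
    simp only [mul_comm (ENNReal.ofReal (truncPow q t _)), this]
    rw [add_comm]

/-- Tonelli's theorem, applied twice. Working in `ℝ≥0∞` makes all exchanges free; finiteness is
recovered afterwards from `lowerIntegral_eq`. -/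
theorem lintegral_cellPow_mul (ha : 0 < a) (ha1 : a < 1) (n j : ℕ) :
    ∫⁻ r, cellPow (a / 2 - 1) τ n r * cellPow (a / 2 - 1) τ j r
      = ENNReal.ofReal (powConst (a / 2 - 1)) * (lowerIntegral a τ n j + lowerIntegral a τ j n) := by
  set q := a / 2 - 1 with hqdef
  have hq : -1 < q := by linarith
  have hq2 : q < -1 / 2 := by linarith
  have h2q : 2 * q + 1 = a - 1 := by rw [hqdef]; ring
  have hm := (measurable_truncPow q).ennreal_ofReal
  have hm1 := (measurable_truncPow (a - 1)).ennreal_ofReal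
  have hr : ∀ q t, Measurable fun r => ENNReal.ofReal (truncPow q t r) := fun q t =>
    (measurable_truncPow q).ennreal_ofReal.comp (measurable_const.prodMk measurable_id)
  have ht : ∀ q r, Measurable fun t => ENNReal.ofReal (truncPow q t r) := fun q t =>
    (measurable_truncPow q).ennreal_ofReal.comp (measurable_id.prodMk measurable_const)
  have e1 : ∀ r, cellPow q τ n r * cellPow q τ j r = ∫⁻ t in timeCell τ n, ∫⁻ s in timeCell τ j,
      ENNReal.ofReal (truncPow q t r) * ENNReal.ofReal (truncPow q s r) := by
    intro r
    unfold cellPow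
    rw [← lintegral_mul_const _ (ht q r)]
    refine lintegral_congr fun t => ?_
    rw [← lintegral_const_mul _ (ht q r)]
  have hj3 : Measurable fun p : (ℝ × ℝ) × ℝ =>
      ENNReal.ofReal (truncPow q p.1.2 p.1.1) * ENNReal.ofReal (truncPow q p.2 p.1.1) :=
    (hm.comp ((measurable_snd.comp measurable_fst).prodMk (measurable_fst.comp measurable_fst))).mul
      (hm.comp (measurable_snd.prodMk (measurable_fst.comp measurable_fst)))
  simp only [e1]
  rw [lintegral_lintegral_swap (Measurable.aemeasurable (Measurable.lintegral_prod_right' hj3))]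
  have e2 : ∀ t, ∫⁻ r, ∫⁻ s in timeCell τ j,
      ENNReal.ofReal (truncPow q t r) * ENNReal.ofReal (truncPow q s r)
      = ENNReal.ofReal (powConst q) * (∫⁻ s in timeCell τ j,
        (ENNReal.ofReal (truncPow (a - 1) t s) + ENNReal.ofReal (truncPow (a - 1) s t))) := by
    intro t
    have hj2 : Measurable fun p : ℝ × ℝ =>
        ENNReal.ofReal (truncPow q t p.1) * ENNReal.ofReal (truncPow q p.2 p.1) :=
      ((hr q t).comp measurable_fst).mul (hm.comp measurable_swap)
    rw [lintegral_lintegral_swap hj2.aemeasurable,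
      ← lintegral_const_mul' _ _ ENNReal.ofReal_ne_top]
    refine lintegral_congr_ae ?_
    have : ∀ᵐ s : ℝ ∂volume.restrict (timeCell τ j), s ≠ t :=
      ae_restrict_of_ae (Measure.ae_ne volume t)
    filter_upwards [this] with s hs
    rw [lintegral_truncPow_mul hq hq2 hs, h2q]
  simp only [e2]
  have hmL : Measurable fun t => ∫⁻ s in timeCell τ j, ENNReal.ofReal (truncPow (a - 1) t s) :=
    Measurable.lintegral_prod_right' hm1
  have hmS : Measurable fun p : ℝ × ℝ =>
      ENNReal.ofReal (truncPow (a - 1) p.2 p.1) := hm1.comp measurable_swap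
  have e3 : ∀ t, ∫⁻ s in timeCell τ j,
        (ENNReal.ofReal (truncPow (a - 1) t s) + ENNReal.ofReal (truncPow (a - 1) s t))
      = (∫⁻ s in timeCell τ j, ENNReal.ofReal (truncPow (a - 1) t s))
        + ∫⁻ s in timeCell τ j, ENNReal.ofReal (truncPow (a - 1) s t) := fun t =>
    lintegral_add_left (hr (a - 1) t) _
  simp only [e3]
  rw [lintegral_const_mul' _ _ ENNReal.ofReal_ne_top, lintegral_add_left hmL]
  congr 1
  congr 1
  exact lintegral_lintegral_swap (Measurable.aemeasurable hmS)

/-- The weights of the averaged product integration rule are of positive type. -/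
theorem piWeight_posWeighted (ha : 0 < a) (ha1 : a < 1) (hτ : 0 < τ) (N : ℕ) (x : ℕ → ℝ) :
    PosWeighted (Finset.Icc 1 N) (fun m => Finset.Icc 1 m) (piWeight a τ)
      (fun j m => x j * x m) := by
  set q := a / 2 - 1 with hqdef
  have hc := powConst_pos (q := q) (by linarith) (by linarith)
  have hΓ := Real.Gamma_pos_of_pos ha
  have hfin : ∀ n j, lowerIntegral a τ n j ≠ ∞ := by
    intro n j
    rcases le_or_gt j n with h | h
    · rw [lowerIntegral_eq ha ha1 hτ h]; exact ENNReal.ofReal_ne_top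
    · rw [lowerIntegral_of_lt hτ h]; simp
  have hfin2 : ∀ n j, ∫⁻ r, cellPow q τ n r * cellPow q τ j r ≠ ∞ := by
    intro n j
    rw [lintegral_cellPow_mul ha ha1]
    exact ENNReal.mul_ne_top ENNReal.ofReal_ne_top
      (ENNReal.add_ne_top.2 ⟨hfin n j, hfin j n⟩)
  have hmeas : ∀ n j, AEMeasurable (fun r => cellPow q τ n r * cellPow q τ j r) := fun n j =>
    ((measurable_cellPow q τ n).mul (measurable_cellPow q τ j)).aemeasurable
  set h : ℕ → ℝ → ℝ := fun n r => (cellPow q τ n r).toReal with hh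
  have hint : ∀ n j, Integrable (fun r => h n r * h j r) := by
    intro n j
    have := integrable_toReal_of_lintegral_ne_top (hmeas n j) (hfin2 n j)
    simpa only [ENNReal.toReal_mul] using this
  set L : ℕ → ℕ → ℝ := fun n j => (lowerIntegral a τ n j).toReal with hL
  have hval : ∀ n j, ∫ r, h n r * h j r = powConst q * (L n j + L j n) := by
    intro n j
    have := integral_toReal (hmeas n j) (ae_lt_top' (hmeas n j) (hfin2 n j))
    rw [lintegral_cellPow_mul ha ha1, ENNReal.toReal_mul, ENNReal.toReal_ofReal hc.le,
      ENNReal.toReal_add (hfin n j) (hfin j n)] at this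
    rw [← this]
    simp only [ENNReal.toReal_mul, hh]
  -- The symmetrized quadratic form is the integral of `(∑ x_n h_n)²`.
  have hsq : 0 ≤ ∑ n ∈ Finset.Icc 1 N, ∑ j ∈ Finset.Icc 1 N, x n * x j * ∫ r, h n r * h j r := by
    have e : ∑ n ∈ Finset.Icc 1 N, ∑ j ∈ Finset.Icc 1 N, x n * x j * ∫ r, h n r * h j r
        = ∫ r, (∑ n ∈ Finset.Icc 1 N, x n * h n r) ^ 2 := by
      have e2 : ∀ r, (∑ n ∈ Finset.Icc 1 N, x n * h n r) ^ 2
          = ∑ n ∈ Finset.Icc 1 N, ∑ j ∈ Finset.Icc 1 N, x n * x j * (h n r * h j r) := by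
        intro r
        rw [sq, Finset.sum_mul_sum]
        exact Finset.sum_congr rfl fun n _ => Finset.sum_congr rfl fun j _ => by ring
      simp only [e2]
      rw [integral_finsetSum]
      · refine Finset.sum_congr rfl fun n _ => ?_
        rw [integral_finsetSum]
        · exact Finset.sum_congr rfl fun j _ => (integral_const_mul _ _).symm
        · exact fun j _ => (hint n j).const_mul _
      · exact fun n _ => integrable_finsetSum _ fun j _ => (hint n j).const_mul _
    rw [e]
    exact integral_nonneg fun r => sq_nonneg _
  have hsum : ∑ n ∈ Finset.Icc 1 N, ∑ j ∈ Finset.Icc 1 N, x n * x j * ∫ r, h n r * h j r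
      = 2 * powConst q * ∑ n ∈ Finset.Icc 1 N, ∑ j ∈ Finset.Icc 1 N, x n * x j * L n j := by
    have e1 : ∑ n ∈ Finset.Icc 1 N, ∑ j ∈ Finset.Icc 1 N, x n * x j * ∫ r, h n r * h j r
        = ∑ n ∈ Finset.Icc 1 N, ∑ j ∈ Finset.Icc 1 N,
          (powConst q * (x n * x j * L n j) + powConst q * (x j * x n * L j n)) := by
      refine Finset.sum_congr rfl fun n _ => Finset.sum_congr rfl fun j _ => ?_
      rw [hval n j]; ring
    rw [e1]
    simp only [Finset.sum_add_distrib]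
    rw [Finset.sum_comm (f := fun n j => powConst q * (x j * x n * L j n))]
    simp only [← Finset.mul_sum]
    ring
  rw [hsum] at hsq
  have hpos : 0 ≤ ∑ n ∈ Finset.Icc 1 N, ∑ j ∈ Finset.Icc 1 N, x n * x j * L n j := by
    exact nonneg_of_mul_nonneg_right hsq (by positivity)
  -- Causality: the double integral vanishes for `j > n`, so the full square sum reduces to the
  -- triangle `j ≤ n`.
  have hfinal : ∑ n ∈ Finset.Icc 1 N, ∑ j ∈ Finset.Icc 1 N, x n * x j * L n j
      = Real.Gamma a * τ * ∑ m ∈ Finset.Icc 1 N, ∑ j ∈ Finset.Icc 1 m,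
          piWeight a τ m j * (x j * x m) := by
    rw [Finset.mul_sum]
    refine Finset.sum_congr rfl fun n hn => ?_
    rw [Finset.mem_Icc] at hn
    rw [Finset.mul_sum]
    have hsub : Finset.Icc 1 n ⊆ Finset.Icc 1 N := Finset.Icc_subset_Icc le_rfl hn.2
    rw [← Finset.sum_subset hsub]
    · refine Finset.sum_congr rfl fun j hj => ?_
      rw [Finset.mem_Icc] at hj
      simp only [hL]
      rw [lowerIntegral_eq ha ha1 hτ hj.2, ENNReal.toReal_ofReal]
      · ring
      · have := piWeight_nonneg ha hτ hj.1 hj.2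
        positivity
    · intro j hj hj'
      rw [Finset.mem_Icc] at hj hj'
      simp only [hL]
      rw [lowerIntegral_of_lt hτ (by omega)]
      simp
  rw [hfinal] at hpos
  exact nonneg_of_mul_nonneg_right hpos (by positivity)

end DiffusionWave

namespace DiffusionWave

/-! ### Taylor expansions and difference quotients -/

/-- `F 0, …, F n` are successive derivatives of each other on `I`. -/
def DerivChain (F : ℕ → ℝ → ℝ) (n : ℕ) (I : Set ℝ) : Prop :=
  ∀ k < n, ∀ x ∈ I, HasDerivWithinAt (F k) (F (k + 1) x) I x

/-- Induction on the order: the derivative of the remainder is the remainder of the derived chain,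
and the mean value inequality integrates its bound. The factor `1/n!` is given away. -/
theorem DerivChain.taylor {n : ℕ} : ∀ {F : ℕ → ℝ → ℝ} {l r C : ℝ}, DerivChain F n (Icc l r) →
    (∀ x ∈ Icc l r, |F n x| ≤ C) → ∀ x ∈ Icc l r, ∀ y ∈ Icc l r,
    |F 0 y - ∑ k ∈ Finset.range n, F k x * ((y - x) ^ k / k.factorial)| ≤ C * |y - x| ^ n := by
  induction n with
  | zero => intro F l r C _ hC x _ y hy; simpa using hC y hy
  | succ n ih =>
    intro F l r C hF hC x hx y hy
    have hF' : DerivChain (fun k => F (k + 1)) n (Icc l r) := fun k hk => hF (k + 1) (by omega)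
    have ih' := ih hF' hC x hx
    have hC0 : 0 ≤ C := (abs_nonneg _).trans (hC x hx)
    set R : ℝ → ℝ := fun z => F 0 z - ∑ k ∈ Finset.range (n + 1), F k x * ((z - x) ^ k / k.factorial)
      with hR
    set R' : ℝ → ℝ := fun z =>
      F 1 z - ∑ k ∈ Finset.range n, F (k + 1) x * ((z - x) ^ k / k.factorial) with hR'
    have hsub : uIcc x y ⊆ Icc l r := uIcc_subset_Icc hx hy
    have hd : ∀ z ∈ uIcc x y, HasDerivWithinAt R (R' z) (uIcc x y) z := by
      intro z hz
      have h1 := (hF 0 (by omega) z (hsub hz)).mono hsub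
      refine h1.sub ?_
      have h2 : HasDerivWithinAt
          (fun z => ∑ k ∈ Finset.range (n + 1), F k x * ((z - x) ^ k / k.factorial))
          (∑ k ∈ Finset.range (n + 1), F k x * ((k : ℝ) * (z - x) ^ (k - 1) * 1 / k.factorial))
          (uIcc x y) z := by
        refine HasDerivWithinAt.fun_sum fun k _ => ?_
        exact ((((hasDerivAt_id z).sub_const x).pow k).div_const _ |>.const_mul _).hasDerivWithinAt
      refine h2.congr_deriv ?_
      rw [Finset.sum_range_succ']
      simp only [Nat.cast_zero, zero_mul, zero_div, mul_zero, add_zero, mul_one]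
      refine Finset.sum_congr rfl fun k _ => ?_
      rw [Nat.factorial_succ, Nat.add_sub_cancel]
      push_cast
      have : (k.factorial : ℝ) ≠ 0 := by positivity
      have : (k : ℝ) + 1 ≠ 0 := by positivity
      field_simp
    have hb : ∀ z ∈ uIcc x y, ‖R' z‖ ≤ C * |y - x| ^ n := by
      intro z hz
      refine (ih' z (hsub hz)).trans ?_
      have : |z - x| ≤ |y - x| := abs_sub_left_of_mem_uIcc hz
      gcongr
    have := (convex_uIcc x y).norm_image_sub_le_of_norm_hasDerivWithin_le hd hb
      left_mem_uIcc right_mem_uIcc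
    have hRx : R x = 0 := by
      simp only [hR]
      rw [Finset.sum_range_succ']
      simp
    rw [hRx, sub_zero, Real.norm_eq_abs, Real.norm_eq_abs] at this
    rw [pow_succ, ← mul_assoc]
    exact this

theorem DerivChain.shift {F : ℕ → ℝ → ℝ} {n m : ℕ} {I : Set ℝ} (hF : DerivChain F (m + n) I) :
    DerivChain (fun k => F (m + k)) n I := fun k hk => hF (m + k) (by omega)

/-- All Taylor terms of order at most five cancel. The remainders `r1`, `r2` of `F 0` contribute `2
C h^4` after division by `h²`, and those of `F 2` at most `C h^4`. -/
theorem DerivChain.abs_compact_sub_le {F : ℕ → ℝ → ℝ} {l r C x h : ℝ}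
    (hF : DerivChain F 6 (Icc l r)) (hC : ∀ x ∈ Icc l r, |F 6 x| ≤ C) (hh : 0 < h)
    (hx1 : x - h ∈ Icc l r) (hx2 : x + h ∈ Icc l r) :
    |(F 2 (x - h) + 10 * F 2 x + F 2 (x + h)) / 12 - (F 0 (x + h) - 2 * F 0 x + F 0 (x - h)) / h ^ 2|
      ≤ 3 * C * h ^ 4 := by
  have hx : x ∈ Icc l r := ⟨by linarith [hx1.1], by linarith [hx2.2]⟩
  have hF2 : DerivChain (fun k => F (2 + k)) 4 (Icc l r) := DerivChain.shift hF
  have a1 := hF.taylor hC x hx _ hx1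
  have a2 := hF.taylor hC x hx _ hx2
  have a3 := hF2.taylor hC x hx _ hx1
  have a4 := hF2.taylor hC x hx _ hx2
  simp only [Finset.sum_range_succ, Finset.range_zero, Finset.sum_empty, sub_sub_cancel_left,
    add_sub_cancel_left, abs_neg, abs_of_pos hh, Nat.factorial, Nat.reduceAdd, Nat.reduceMul,
    Nat.cast_ofNat, Nat.cast_one, add_zero, Nat.succ_eq_add_one] at a1 a2 a3 a4
  have hh2 : 0 < h ^ 2 := by positivity
  set r1 := F 0 (x - h) - (0 + F 0 x * ((-h) ^ 0 / 1) + F 1 x * ((-h) ^ 1 / 1)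
    + F 2 x * ((-h) ^ 2 / 2) + F 3 x * ((-h) ^ 3 / 6) + F 4 x * ((-h) ^ 4 / 24)
    + F 5 x * ((-h) ^ 5 / 120)) with hr1
  set r2 := F 0 (x + h) - (0 + F 0 x * (h ^ 0 / 1) + F 1 x * (h ^ 1 / 1)
    + F 2 x * (h ^ 2 / 2) + F 3 x * (h ^ 3 / 6) + F 4 x * (h ^ 4 / 24)
    + F 5 x * (h ^ 5 / 120)) with hr2
  set r3 := F 2 (x - h) - (0 + F 2 x * ((-h) ^ 0 / 1) + F 3 x * ((-h) ^ 1 / 1)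
    + F 4 x * ((-h) ^ 2 / 2) + F 5 x * ((-h) ^ 3 / 6)) with hr3
  set r4 := F 2 (x + h) - (0 + F 2 x * (h ^ 0 / 1) + F 3 x * (h ^ 1 / 1)
    + F 4 x * (h ^ 2 / 2) + F 5 x * (h ^ 3 / 6)) with hr4
  have e : (F 2 (x - h) + 10 * F 2 x + F 2 (x + h)) / 12
      - (F 0 (x + h) - 2 * F 0 x + F 0 (x - h)) / h ^ 2 = (r3 + r4) / 12 - (r1 + r2) / h ^ 2 := by
    rw [hr1, hr2, hr3, hr4]
    field_simp
    ring
  have b : |(r1 + r2) / h ^ 2| ≤ 2 * C * h ^ 4 := by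
    rw [abs_div, abs_of_pos hh2, div_le_iff₀ hh2]
    have := abs_add_le r1 r2
    have : 2 * C * h ^ 4 * h ^ 2 = C * h ^ 6 + C * h ^ 6 := by ring
    linarith
  have b2 := abs_add_le r3 r4
  have b3 : |(r3 + r4) / 12| ≤ C * h ^ 4 := by
    rw [abs_div, abs_of_pos (by norm_num : (0 : ℝ) < 12), div_le_iff₀ (by norm_num)]
    have : 0 ≤ C * h ^ 4 := (abs_nonneg _).trans a3
    linarith
  rw [e]
  refine (abs_sub _ _).trans ?_
  linarith

/-- The six-point one-sided approximation of a second derivative. -/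
noncomputable def oneSidedDiff (F : ℝ → ℝ) (x h : ℝ) : ℝ :=
  (15 / 4 * F x - 77 / 6 * F (x + h) + 107 / 6 * F (x + 2 * h) - 13 * F (x + 3 * h)
    + 61 / 12 * F (x + 4 * h) - 5 / 6 * F (x + 5 * h)) / h ^ 2

/-- The six-point formula is exact up to degree five. Each remainder is at most `5^6 C h^6`, and the
moduli of the coefficients involved add up to less than `50`. A negative `h` is allowed, for points
near the right end. -/
theorem DerivChain.abs_oneSidedDiff_sub_le {F : ℕ → ℝ → ℝ} {l r C x h : ℝ}
    (hF : DerivChain F 6 (Icc l r)) (hC : ∀ x ∈ Icc l r, |F 6 x| ≤ C) (hh : h ≠ 0)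
    (hx : x ∈ Icc l r) (hx5 : x + 5 * h ∈ Icc l r) :
    |oneSidedDiff (F 0) x h - F 2 x| ≤ 10 ^ 6 * C * h ^ 4 := by
  have hmem : ∀ c : ℝ, 0 ≤ c → c ≤ 5 → x + c * h ∈ Icc l r := by
    intro c h0 h5
    have := (convex_Icc l r) hx hx5 (a := 1 - c / 5) (b := c / 5) (by linarith) (by linarith)
      (by ring)
    simp only [smul_eq_mul] at this
    convert this using 1
    ring
  set R : ℝ → ℝ := fun c => F 0 (x + c * h) - (F 0 x + F 1 x * (c * h) + F 2 x * ((c * h) ^ 2 / 2)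
    + F 3 x * ((c * h) ^ 3 / 6) + F 4 x * ((c * h) ^ 4 / 24) + F 5 x * ((c * h) ^ 5 / 120)) with hR
  have hC0 : 0 ≤ C := (abs_nonneg _).trans (hC x hx)
  have hRb : ∀ c : ℝ, 0 ≤ c → c ≤ 5 → |R c| ≤ 15625 * C * h ^ 6 := by
    intro c h0 h5
    have a := hF.taylor hC x hx _ (hmem c h0 h5)
    simp only [Finset.sum_range_succ, Finset.range_zero, Finset.sum_empty,
      add_sub_cancel_left, Nat.factorial, Nat.reduceAdd, Nat.reduceMul,
      Nat.cast_ofNat, Nat.cast_one, zero_add, Nat.succ_eq_add_one, pow_zero, pow_one,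
      div_one, mul_one] at a
    refine a.trans ?_
    rw [abs_mul, abs_of_nonneg h0, mul_pow, Even.pow_abs (by decide)]
    have : c ^ 6 ≤ 5 ^ 6 := pow_le_pow_left₀ h0 h5 6
    have h6 : 0 ≤ h ^ 6 := by positivity
    have : c ^ 6 * h ^ 6 ≤ 15625 * h ^ 6 := by
      refine mul_le_mul_of_nonneg_right ?_ h6
      linarith
    nlinarith
  have e : oneSidedDiff (F 0) x h - F 2 x
      = (-(77 / 6) * R 1 + 107 / 6 * R 2 - 13 * R 3 + 61 / 12 * R 4 - 5 / 6 * R 5) / h ^ 2 := by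
    simp only [oneSidedDiff, hR]
    rw [one_mul]
    field_simp
    ring
  have h2 : 0 < h ^ 2 := by positivity
  have b1 := abs_le.1 (hRb 1 (by norm_num) (by norm_num))
  have b2 := abs_le.1 (hRb 2 (by norm_num) (by norm_num))
  have b3 := abs_le.1 (hRb 3 (by norm_num) (by norm_num))
  have b4 := abs_le.1 (hRb 4 (by norm_num) (by norm_num))
  have b5 := abs_le.1 (hRb 5 (by norm_num) (by norm_num))
  have h6 : 0 ≤ C * h ^ 6 := by positivity
  rw [e, abs_div, abs_of_pos h2, div_le_iff₀ h2]
  have e2 : 10 ^ 6 * C * h ^ 4 * h ^ 2 = 10 ^ 6 * (C * h ^ 6) := by ring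
  rw [e2, abs_le]
  constructor <;> linarith [b1.1, b1.2, b2.1, b2.2, b3.1, b3.2, b4.1, b4.2, b5.1, b5.2]

/-- If the functions `F 0 · y` depend continuously on `y` at each point and have uniformly bounded
sixth derivatives, then their second derivatives depend continuously on `y`. -/
theorem continuousOn_second_deriv {F : ℕ → ℝ → ℝ → ℝ} {l r C : ℝ} {J : Set ℝ} (hlr : l < r)
    (hF : ∀ y ∈ J, DerivChain (fun k x => F k x y) 6 (Icc l r))
    (hC : ∀ y ∈ J, ∀ x ∈ Icc l r, |F 6 x y| ≤ C)
    (hc : ∀ x ∈ Icc l r, ContinuousOn (fun y => F 0 x y) J) {x : ℝ} (hx : x ∈ Icc l r) :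
    ContinuousOn (fun y => F 2 x y) J := by
  rcases J.eq_empty_or_nonempty with rfl | ⟨y₀, hy₀⟩
  · exact continuousOn_empty _
  have hC0 : 0 ≤ C := (abs_nonneg _).trans (hC y₀ hy₀ x hx)
  refine continuousOn_of_uniform_approx_of_continuousOn fun U hU => ?_
  obtain ⟨ε, hε, hεU⟩ := Metric.mem_uniformity_dist.1 hU
  -- The step points towards the farther end of the interval and is so small that the error, uniform
  -- in `y`, stays below `ε`. The second derivative is thus a uniform limit of difference quotients
  -- that are continuous in `y`.
  obtain ⟨h, hh0, hx5, hhε⟩ : ∃ h : ℝ, h ≠ 0 ∧ x + 5 * h ∈ Icc l r ∧ 10 ^ 6 * C * h ^ 4 < ε := by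
    set η := min 1 (min ((r - l) / 10) (ε / (10 ^ 6 * C + 1))) with hη
    have hη0 : 0 < η := by
      have : 0 < r - l := by linarith
      refine lt_min one_pos (lt_min (by linarith) (by positivity))
    have hη1 : η ≤ 1 := min_le_left _ _
    have hη2 : η ≤ (r - l) / 10 := (min_le_right _ _).trans (min_le_left _ _)
    have hη3 : η ≤ ε / (10 ^ 6 * C + 1) := (min_le_right _ _).trans (min_le_right _ _)
    have h4 : η ^ 4 ≤ η := by
      calc η ^ 4 ≤ η ^ 1 := pow_le_pow_of_le_one hη0.le hη1 (by norm_num)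
        _ = η := pow_one η
    have hlast : 10 ^ 6 * C * η ^ 4 < ε := by
      rw [le_div_iff₀ (by positivity)] at hη3
      have : 10 ^ 6 * C * η ^ 4 ≤ 10 ^ 6 * C * η := mul_le_mul_of_nonneg_left h4 (by positivity)
      linarith
    rcases le_total x ((l + r) / 2) with hm | hm
    · exact ⟨η, hη0.ne', ⟨by linarith [hx.1], by linarith⟩, hlast⟩
    · refine ⟨-η, by linarith, ⟨by linarith, by linarith [hx.2]⟩, ?_⟩
      rwa [Even.neg_pow (by decide)]
  have hmem : ∀ c : ℝ, 0 ≤ c → c ≤ 5 → x + c * h ∈ Icc l r := by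
    intro c h0 h5
    have := (convex_Icc l r) hx hx5 (a := 1 - c / 5) (b := c / 5) (by linarith) (by linarith)
      (by ring)
    simp only [smul_eq_mul] at this
    convert this using 1
    ring
  refine ⟨fun y => oneSidedDiff (fun x => F 0 x y) x h, ?_, fun y hy => hεU ?_⟩
  · unfold oneSidedDiff
    have h1 := hc _ (by simpa using hmem 1 (by norm_num) (by norm_num))
    have h2 := hc _ (hmem 2 (by norm_num) (by norm_num))
    have h3 := hc _ (hmem 3 (by norm_num) (by norm_num))
    have h4 := hc _ (hmem 4 (by norm_num) (by norm_num))
    have h5 := hc _ hx5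
    have h0 := hc _ hx
    fun_prop
  · rw [dist_comm, Real.dist_eq]
    exact ((hF y hy).abs_oneSidedDiff_sub_le (hC y hy) hh0 hx hx5).trans_lt hhε

/-! ### The spatial truncation error -/

section
variable {D : Rectangle} {T α₀ C : ℝ} {u : ℝ → ℝ → ℝ → ℝ}

theorem RegularityA1.chain_x (h : RegularityA1 D T α₀ C u) {y t : ℝ} (hy : y ∈ Icc D.ly D.ry)
    (ht : t ∈ Icc 0 T) : DerivChain (fun k x => D.dx^[k] u x y t) 6 (Icc D.lx D.rx) := by
  intro k hk x hx
  simp only [Function.iterate_succ_apply']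
  exact (h.has_x k hk x y t ⟨hx, hy⟩ ht).hasDerivWithinAt

theorem RegularityA1.chain_y (h : RegularityA1 D T α₀ C u) {x t : ℝ} (hx : x ∈ Icc D.lx D.rx)
    (ht : t ∈ Icc 0 T) : DerivChain (fun k y => D.dy^[k] u x y t) 6 (Icc D.ly D.ry) := by
  intro k hk y hy
  simp only [Function.iterate_succ_apply']
  exact (h.has_y k hk x y t ⟨hx, hy⟩ ht).hasDerivWithinAt

theorem RegularityA1.abs_dx6_le (h : RegularityA1 D T α₀ C u) {x y t : ℝ}
    (hx : x ∈ Icc D.lx D.rx) (hy : y ∈ Icc D.ly D.ry) (ht : t ∈ Ioc 0 T) :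
    |D.dx^[6] u x y t| ≤ C := by
  have := h.bound_x x y t ⟨hx, hy⟩ ht
  rwa [Real.rpow_zero, mul_one] at this

theorem RegularityA1.abs_dy6_le (h : RegularityA1 D T α₀ C u) {x y t : ℝ}
    (hx : x ∈ Icc D.lx D.rx) (hy : y ∈ Icc D.ly D.ry) (ht : t ∈ Ioc 0 T) :
    |D.dy^[6] u x y t| ≤ C := by
  have := h.bound_y x y t ⟨hx, hy⟩ ht
  rwa [Real.rpow_zero, mul_one] at this

theorem RegularityA1.continuousOn_dxx (h : RegularityA1 D T α₀ C u) {x t : ℝ}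
    (hx : x ∈ Icc D.lx D.rx) (ht : t ∈ Ioc 0 T) :
    ContinuousOn (fun y => D.dx^[2] u x y t) (Icc D.ly D.ry) :=
  continuousOn_second_deriv (F := fun k x y => D.dx^[k] u x y t) D.hx
    (fun _ hy => h.chain_x hy (Ioc_subset_Icc_self ht)) (fun _ hy _ hx => h.abs_dx6_le hx hy ht)
    (fun x' hx' y hy =>
      (h.has_y 0 (by norm_num) x' y t ⟨hx', hy⟩ (Ioc_subset_Icc_self ht)).continuousWithinAt) hx

theorem RegularityA1.continuousOn_dyy (h : RegularityA1 D T α₀ C u) {y t : ℝ}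
    (hy : y ∈ Icc D.ly D.ry) (ht : t ∈ Ioc 0 T) :
    ContinuousOn (fun x => D.dy^[2] u x y t) (Icc D.lx D.rx) :=
  continuousOn_second_deriv (F := fun k y x => D.dy^[k] u x y t) D.hy
    (fun _ hx => h.chain_y hx (Ioc_subset_Icc_self ht)) (fun _ hx _ hy => h.abs_dy6_le hx hy ht)
    (fun y' hy' x hx =>
      (h.has_x 0 (by norm_num) x y' t ⟨hx, hy'⟩ (Ioc_subset_Icc_self ht)).continuousWithinAt) hy

theorem Rectangle.stepX_pos (D : Rectangle) {Mx : ℕ} (h : 0 < Mx) : 0 < D.stepX Mx :=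
  div_pos (sub_pos.2 D.hx) (by exact_mod_cast h)

theorem Rectangle.stepY_pos (D : Rectangle) {My : ℕ} (h : 0 < My) : 0 < D.stepY My :=
  div_pos (sub_pos.2 D.hy) (by exact_mod_cast h)

theorem Rectangle.ptX_last (D : Rectangle) {Mx : ℕ} (h : 0 < Mx) : D.ptX Mx Mx = D.rx := by
  have : (Mx : ℝ) ≠ 0 := by exact_mod_cast h.ne'
  unfold ptX stepX
  field_simp
  ring

theorem Rectangle.ptY_last (D : Rectangle) {My : ℕ} (h : 0 < My) : D.ptY My My = D.ry := by
  have : (My : ℝ) ≠ 0 := by exact_mod_cast h.ne'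
  unfold ptY stepY
  field_simp
  ring

theorem Rectangle.ptX_mem (D : Rectangle) {Mx i : ℕ} (h : 0 < Mx) (hi : i ≤ Mx) :
    D.ptX Mx i ∈ Icc D.lx D.rx := by
  have h0 := D.stepX_pos h
  have hi' : (i : ℝ) ≤ Mx := by exact_mod_cast hi
  refine ⟨by unfold ptX; have : 0 ≤ (i : ℝ) * D.stepX Mx := by positivity
             linarith, ?_⟩
  rw [← D.ptX_last h]
  unfold ptX
  nlinarith

theorem Rectangle.ptY_mem (D : Rectangle) {My j : ℕ} (h : 0 < My) (hj : j ≤ My) :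
    D.ptY My j ∈ Icc D.ly D.ry := by
  have h0 := D.stepY_pos h
  have hj' : (j : ℝ) ≤ My := by exact_mod_cast hj
  refine ⟨by unfold ptY; have : 0 ≤ (j : ℝ) * D.stepY My := by positivity
             linarith, ?_⟩
  rw [← D.ptY_last h]
  unfold ptY
  nlinarith

theorem abs_avgX_le {Mx i j : ℕ} {v : ℕ → ℕ → ℝ} {Y : ℝ} (hi0 : 0 < i) (hi : i < Mx)
    (h : ∀ k ≤ Mx, |v k j| ≤ Y) : |avgX Mx v i j| ≤ Y := by
  rw [avgX, if_pos ⟨hi0, hi⟩]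
  have h1 := abs_le.1 (h (i - 1) (by omega))
  have h2 := abs_le.1 (h i (by omega))
  have h3 := abs_le.1 (h (i + 1) (by omega))
  rw [abs_le]
  constructor <;> linarith [h1.1, h1.2, h2.1, h2.2, h3.1, h3.2]

theorem abs_avgY_le {My i j : ℕ} {v : ℕ → ℕ → ℝ} {Y : ℝ} (hj0 : 0 < j) (hj : j < My)
    (h : ∀ k ≤ My, |v i k| ≤ Y) : |avgY My v i j| ≤ Y :=
  abs_avgX_le (v := fun i j => v j i) hj0 hj h

theorem abs_avg_le {Mx My i j : ℕ} {v : ℕ → ℕ → ℝ} {Y : ℝ} (hi0 : 0 < i) (hi : i < Mx)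
    (hj0 : 0 < j) (hj : j < My) (h : ∀ k ≤ Mx, ∀ l ≤ My, |v k l| ≤ Y) :
    |avg Mx My v i j| ≤ Y :=
  abs_avgX_le hi0 hi fun k hk => abs_avgY_le hj0 hj (h k hk)

theorem avgX_avgY_comm (Mx My : ℕ) (v : ℕ → ℕ → ℝ) (i j : ℕ) :
    avgX Mx (avgY My v) i j = avgY My (avgX Mx v) i j := by
  by_cases h1 : 0 < i ∧ i < Mx <;> by_cases h2 : 0 < j ∧ j < My <;>
    simp only [avgX, avgY, h1, h2, and_self, if_true, if_false]
  ring

theorem avgX_sub (Mx : ℕ) (v w : ℕ → ℕ → ℝ) (i j : ℕ) :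
    avgX Mx (fun i j => v i j - w i j) i j = avgX Mx v i j - avgX Mx w i j := by
  unfold avgX
  split_ifs <;> ring

theorem avgY_sub (My : ℕ) (v w : ℕ → ℕ → ℝ) (i j : ℕ) :
    avgY My (fun i j => v i j - w i j) i j = avgY My v i j - avgY My w i j := by
  unfold avgY
  split_ifs <;> ring

theorem avg_add (Mx My : ℕ) (v w : ℕ → ℕ → ℝ) (i j : ℕ) :
    avg Mx My (fun i j => v i j + w i j) i j = avg Mx My v i j + avg Mx My w i j := by
  unfold avg avgX avgY
  split_ifs <;> ring

/-- Since `𝒜_x` and `𝒜_y` commute, the error is `𝒜_y (𝒜_x u_xx - δ_x² u) + 𝒜_x (𝒜_y u_yy - δ_y² u)`.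
The averages do not increase the maximum, and the one-dimensional expansion applies on every grid
line, boundary lines included. -/
theorem RegularityA1.abs_avg_laplacian_sub_lap_le (h : RegularityA1 D T α₀ C u) {Mx My i j : ℕ}
    (hi0 : 0 < i) (hi : i < Mx) (hj0 : 0 < j) (hj : j < My) {t : ℝ} (ht : t ∈ Ioc 0 T) :
    |avg Mx My (fun i j => D.dx^[2] u (D.ptX Mx i) (D.ptY My j) t
        + D.dy^[2] u (D.ptX Mx i) (D.ptY My j) t) i j
      - D.lap Mx My (fun i j => u (D.ptX Mx i) (D.ptY My j) t) i j|
      ≤ 3 * C * (D.stepX Mx ^ 4 + D.stepY My ^ 4) := by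
  have hMx : 0 < Mx := by omega
  have hMy : 0 < My := by omega
  let E : ℕ → ℕ → ℝ := fun i j => avgX Mx (fun i j => D.dx^[2] u (D.ptX Mx i) (D.ptY My j) t) i j
    - diffX (D.stepX Mx) (fun i j => u (D.ptX Mx i) (D.ptY My j) t) i j
  let E' : ℕ → ℕ → ℝ := fun i j => avgY My (fun i j => D.dy^[2] u (D.ptX Mx i) (D.ptY My j) t) i j
    - diffY (D.stepY My) (fun i j => u (D.ptX Mx i) (D.ptY My j) t) i j
  have hx : ∀ k ≤ My, |E i k| ≤ 3 * C * D.stepX Mx ^ 4 := by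
    intro k hk
    have e1 : D.ptX Mx (i - 1) = D.ptX Mx i - D.stepX Mx := by
      unfold Rectangle.ptX; rw [Nat.cast_sub hi0]; push_cast; ring
    have e2 : D.ptX Mx (i + 1) = D.ptX Mx i + D.stepX Mx := by
      unfold Rectangle.ptX; push_cast; ring
    have := (h.chain_x (D.ptY_mem hMy hk) (Ioc_subset_Icc_self ht)).abs_compact_sub_le
      (fun x hx => h.abs_dx6_le hx (D.ptY_mem hMy hk) ht) (D.stepX_pos hMx) (x := D.ptX Mx i)
      (by rw [← e1]; exact D.ptX_mem hMx (by omega)) (by rw [← e2]; exact D.ptX_mem hMx (by omega))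
    rw [← e1, ← e2] at this
    simpa only [E, avgX, diffX, if_pos (And.intro hi0 hi), Function.iterate_zero, id] using this
  have hy : ∀ k ≤ Mx, |E' k j| ≤ 3 * C * D.stepY My ^ 4 := by
    intro k hk
    have e1 : D.ptY My (j - 1) = D.ptY My j - D.stepY My := by
      unfold Rectangle.ptY; rw [Nat.cast_sub hj0]; push_cast; ring
    have e2 : D.ptY My (j + 1) = D.ptY My j + D.stepY My := by
      unfold Rectangle.ptY; push_cast; ring
    have := (h.chain_y (D.ptX_mem hMx hk) (Ioc_subset_Icc_self ht)).abs_compact_sub_le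
      (fun y hy => h.abs_dy6_le (D.ptX_mem hMx hk) hy ht) (D.stepY_pos hMy) (x := D.ptY My j)
      (by rw [← e1]; exact D.ptY_mem hMy (by omega)) (by rw [← e2]; exact D.ptY_mem hMy (by omega))
    rw [← e1, ← e2] at this
    simpa only [E', avgY, diffY, if_pos (And.intro hj0 hj), Function.iterate_zero, id] using this
  have h1 := abs_avgY_le hj0 hj hx
  have h2 := abs_avgX_le hi0 hi hy
  rw [avgY_sub] at h1
  rw [avgX_sub] at h2
  rw [avg_add]
  unfold avg Rectangle.lap
  rw [avgX_avgY_comm Mx My (fun i j => D.dx^[2] u (D.ptX Mx i) (D.ptY My j) t)]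
  refine le_trans (le_of_eq ?_) ((abs_add_le _ _).trans ((add_le_add h1 h2).trans (le_of_eq ?_)))
  · congr 1; ring
  · ring

end

end DiffusionWave

namespace DiffusionWave
open MeasureTheory Filter Topology

/-! ### The generalized identity function -/

/-- Difference quotients are dominated by the mean value inequality on the convex set `S`. The
version within `S` covers the one-sided derivatives at `0` and `T`. -/
theorem hasDerivWithinAt_integral_of_dominated {μ : Measure ℝ} {F F' : ℝ → ℝ → ℝ} {S : Set ℝ}
    {t : ℝ} {b : ℝ → ℝ} (hS : Convex ℝ S) (ht : t ∈ S) (hint : ∀ s ∈ S, Integrable (F s) μ)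
    (hd : ∀ᵐ z ∂μ, ∀ s ∈ S, HasDerivWithinAt (fun s => F s z) (F' s z) S s)
    (hb : ∀ᵐ z ∂μ, ∀ s ∈ S, |F' s z| ≤ b z) (hbi : Integrable b μ) :
    HasDerivWithinAt (fun s => ∫ z, F s z ∂μ) (∫ z, F' t z ∂μ) S t := by
  rw [hasDerivWithinAt_iff_tendsto_slope]
  have hev : ∀ᶠ s in 𝓝[S \ {t}] t, s ∈ S \ {t} := self_mem_nhdsWithin
  have e : ∀ᶠ s in 𝓝[S \ {t}] t,
      ∫ z, slope (fun s => F s z) t s ∂μ = slope (fun s => ∫ z, F s z ∂μ) t s := by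
    filter_upwards [hev] with s hs
    simp only [slope_def_field]
    rw [integral_div, integral_sub (hint s hs.1) (hint t ht)]
  refine Tendsto.congr' e ?_
  refine tendsto_integral_filter_of_dominated_convergence b ?_ ?_ hbi ?_
  · filter_upwards [hev] with s hs
    simp only [slope_def_field]
    exact (((hint s hs.1).sub (hint t ht)).div_const _).aestronglyMeasurable
  · filter_upwards [hev] with s hs
    filter_upwards [hd, hb] with z hz hbz
    have h1 := hS.norm_image_sub_le_of_norm_hasDerivWithin_le hz hbz ht hs.1
    have hne : s - t ≠ 0 := sub_ne_zero.2 hs.2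
    rw [slope_def_field, norm_div]
    exact (div_le_iff₀ (norm_pos_iff.2 hne)).2 h1
  · filter_upwards [hd] with z hz
    exact hasDerivWithinAt_iff_tendsto_slope.1 (hz t ht)

/-- The reciprocal of the Gamma function. -/
noncomputable def invGamma (x : ℝ) : ℝ := (Real.Gamma x)⁻¹

/-- `1/Γ` is entire, so its derivatives are bounded on `[0, 1]`, the range of `2 - α`, including the
end where `Γ` has a pole. -/
theorem contDiff_invGamma {n : WithTop ℕ∞} : ContDiff ℝ n invGamma := by
  have h : ContDiff ℝ n fun x : ℝ => ((Complex.Gamma x)⁻¹).re :=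
    ContDiff.real_of_complex Complex.differentiable_one_div_Gamma.contDiff
  have e : (fun x : ℝ => ((Complex.Gamma x)⁻¹).re) = invGamma := by
    funext x
    rw [Complex.Gamma_ofReal, ← Complex.ofReal_inv, Complex.ofReal_re, invGamma]
  rwa [e] at h

/-- The regular factor `t^(α(0) - α(t)) / Γ(2 - α(t))` of the kernel. -/
noncomputable def kernelProfile (α : ℝ → ℝ) (t : ℝ) : ℝ :=
  Real.exp ((α 0 - α t) * Real.log t) * invGamma (2 - α t)

section
variable {T Qα : ℝ} {α : ℝ → ℝ}

theorem IsAdmissibleExponent.chain (h : IsAdmissibleExponent T Qα α) :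
    DerivChain (fun k => iteratedDerivWithin k α (Icc 0 T)) 3 (Icc 0 T) := by
  intro k hk x hx
  have := (h.diff k hk x hx).hasDerivWithinAt
  rwa [← iteratedDerivWithin_succ] at this

theorem exists_abs_le_of_continuous {f : ℝ → ℝ} (hf : Continuous f) (a b : ℝ) :
    ∃ c, 0 ≤ c ∧ ∀ x ∈ Icc a b, |f x| ≤ c := by
  obtain ⟨c, hc⟩ := isCompact_Icc.exists_bound_of_continuousOn (hf.continuousOn (s := Icc a b))
  exact ⟨|c|, abs_nonneg _, fun x hx => (hc x hx).trans (le_abs_self c)⟩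

theorem abs_sum_le_of_bounds {e E m m1 R R1 R2 me me1 r r1 r2 : ℝ} (hE : |E| ≤ e) (hm : |m| ≤ me)
    (hm1 : |m1| ≤ me1) (hR : |R| ≤ r) (hR1 : |R1| ≤ r1) (hR2 : |R2| ≤ r2) :
    |E * (m * (m * R + R1) + (m1 * R + m * R1 + R2))|
      ≤ e * (me * (me * r + r1) + (me1 * r + me * r1 + r2)) := by
  have := abs_nonneg E
  have := abs_nonneg m
  have := abs_nonneg m1
  have := abs_nonneg R
  have := abs_nonneg R1
  have he : 0 ≤ e := by linarith
  have hme : 0 ≤ me := by linarith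
  have hme1 : 0 ≤ me1 := by linarith
  have h1 : |m * R + R1| ≤ me * r + r1 :=
    (abs_add_le _ _).trans (add_le_add (by rw [abs_mul]; gcongr) hR1)
  have h2 : |m1 * R + m * R1 + R2| ≤ me1 * r + me * r1 + r2 :=
    (abs_add_le _ _).trans (add_le_add ((abs_add_le _ _).trans
      (add_le_add (by rw [abs_mul]; gcongr) (by rw [abs_mul]; gcongr))) hR2)
  have h3 : |m * (m * R + R1) + (m1 * R + m * R1 + R2)|
      ≤ me * (me * r + r1) + (me1 * r + me * r1 + r2) :=
    (abs_add_le _ _).trans (add_le_add (by rw [abs_mul]; gcongr) h2)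
  rw [abs_mul]
  gcongr

/-- The assumption `α'(0) = 0` gives `α' = O(t)` and `α₀ - α = O(t²)`. One power of `t` thus beats
the logarithm in `κ'`, and in `κ''` a bare logarithm remains. -/
theorem IsAdmissibleExponent.exists_profile_derivs (hT : 0 < T)
    (h : IsAdmissibleExponent T Qα α) :
    ∃ κ₁ κ₂ : ℝ → ℝ, ∃ K : ℝ, 0 ≤ K ∧
      (∀ t ∈ Icc 0 T, HasDerivWithinAt (kernelProfile α) (κ₁ t) (Icc 0 T) t) ∧
      (∀ t ∈ Ioc 0 T, HasDerivWithinAt κ₁ (κ₂ t) (Icc 0 T) t) ∧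
      (∀ t ∈ Icc 0 T, |κ₁ t| ≤ K) ∧ (∀ t ∈ Ioc 0 T, |κ₂ t| ≤ K * (|Real.log t| + 1)) := by
  set Q := Qα with hQdef
  set α₁ := iteratedDerivWithin 1 α (Icc 0 T) with hα₁
  set α₂ := iteratedDerivWithin 2 α (Icc 0 T) with hα₂
  have h00 : (0 : ℝ) ∈ Icc 0 T := ⟨le_rfl, hT.le⟩
  have hd0 : ∀ t ∈ Icc 0 T, HasDerivWithinAt α (α₁ t) (Icc 0 T) t := by
    intro t ht
    have := h.chain 0 (by norm_num) t ht
    simpa only [iteratedDerivWithin_zero] using this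
  have hd1 : ∀ t ∈ Icc 0 T, HasDerivWithinAt α₁ (α₂ t) (Icc 0 T) t := fun t ht =>
    h.chain 1 (by norm_num) t ht
  have b2 : ∀ t ∈ Icc 0 T, |α₂ t| ≤ Q := fun t ht => by
    have := h.bound t ht
    have := abs_nonneg (iteratedDerivWithin 1 α (Icc 0 T) t)
    have := abs_nonneg (iteratedDerivWithin 3 α (Icc 0 T) t)
    linarith
  have hQ : 0 ≤ Q := (abs_nonneg _).trans (b2 0 h00)
  have b1 : ∀ t ∈ Icc 0 T, |α₁ t| ≤ Q * t := by
    intro t ht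
    have := DerivChain.taylor (F := fun k => iteratedDerivWithin (1 + k) α (Icc 0 T)) (n := 1)
      (fun k hk => h.chain (1 + k) (by omega)) b2 0 h00 t ht
    simpa [h.deriv_zero, abs_of_nonneg ht.1, ← hα₁] using this
  have b0 : ∀ t ∈ Icc 0 T, |α 0 - α t| ≤ Q * t ^ 2 := by
    intro t ht
    have := DerivChain.taylor (F := fun k => iteratedDerivWithin k α (Icc 0 T)) (n := 2)
      (fun k hk => h.chain k (by omega)) b2 0 h00 t ht
    rw [abs_sub_comm]
    simpa [Finset.sum_range_succ, h.deriv_zero, abs_of_nonneg ht.1] using this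
  set P := invGamma
  have hP1 : ∀ x, HasDerivAt P (deriv P x) x := fun x =>
    (contDiff_invGamma (n := 1)).differentiable (by norm_num) x |>.hasDerivAt
  have hP2' : ContDiff ℝ 1 (deriv P) :=
    ((contDiff_succ_iff_deriv (n := 1)).1 contDiff_invGamma).2.2
  have hP2 : ∀ x, HasDerivAt (deriv P) (deriv (deriv P) x) x := fun x =>
    (hP2'.differentiable (by norm_num) x).hasDerivAt
  obtain ⟨p0, hp0, hp0'⟩ := exists_abs_le_of_continuous (contDiff_invGamma (n := 1)).continuous 0 1
  obtain ⟨p1, hp1, hp1'⟩ := exists_abs_le_of_continuous hP2'.continuous 0 1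
  obtain ⟨p2, hp2, hp2'⟩ := exists_abs_le_of_continuous (hP2'.continuous_deriv (by norm_num)) 0 1
  have hmem : ∀ t ∈ Icc 0 T, 2 - α t ∈ Icc (0 : ℝ) 1 := fun t ht => by
    have := h.range t ht
    exact ⟨by linarith [this.2], by linarith [this.1]⟩
  obtain ⟨Λ, hΛ, hΛ'⟩ := exists_abs_le_of_continuous Real.continuous_mul_log 0 T
  have hlog : ∀ t ∈ Icc 0 T, t * |Real.log t| ≤ Λ := fun t ht => by
    have := hΛ' t ht
    rwa [abs_mul, abs_of_nonneg ht.1] at this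
  set E : ℝ → ℝ := fun t => Real.exp ((α 0 - α t) * Real.log t) with hE
  -- `m` is the logarithmic derivative of the factor `E`, and `m₁` its derivative; `R₁`, `R₂` are
  -- the derivatives of the factor `R`.
  set m : ℝ → ℝ := fun t => -α₁ t * Real.log t + (α 0 - α t) / t with hm
  set m₁ : ℝ → ℝ := fun t =>
    (-α₂ t * Real.log t - α₁ t / t) + (-α₁ t * t - (α 0 - α t)) / t ^ 2 with hm₁
  set R : ℝ → ℝ := fun t => P (2 - α t) with hR
  set R₁ : ℝ → ℝ := fun t => -(deriv P (2 - α t) * α₁ t) with hR₁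
  set R₂ : ℝ → ℝ := fun t => deriv (deriv P) (2 - α t) * α₁ t * α₁ t - deriv P (2 - α t) * α₂ t with hR₂
  have bexp : ∀ t ∈ Icc 0 T, |(α 0 - α t) * Real.log t| ≤ Q * t * Λ := by
    intro t ht
    rw [abs_mul]
    calc _ ≤ Q * t ^ 2 * |Real.log t| := by gcongr; exact b0 t ht
      _ = Q * t * (t * |Real.log t|) := by ring
      _ ≤ Q * t * Λ := mul_le_mul_of_nonneg_left (hlog t ht) (mul_nonneg hQ ht.1)
  have bE : ∀ t ∈ Icc 0 T, |E t| ≤ Real.exp (Q * T * Λ) := by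
    intro t ht
    rw [hE, abs_of_pos (Real.exp_pos _)]
    refine Real.exp_le_exp.2 (((le_abs_self _).trans (bexp t ht)).trans ?_)
    have := ht.2
    gcongr
  have bm : ∀ t ∈ Icc 0 T, |m t| ≤ Q * (t * |Real.log t| + t) := by
    intro t ht
    refine (abs_add_le _ _).trans ?_
    rw [mul_add]
    refine add_le_add ?_ ?_
    · rw [abs_mul, abs_neg, ← mul_assoc]
      gcongr; exact b1 t ht
    · rcases ht.1.eq_or_lt with h0 | h0
      · simp [← h0]
      · rw [abs_div, abs_of_pos h0, div_le_iff₀ h0, mul_assoc, ← sq]; exact b0 t ht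
  have bm' : ∀ t ∈ Icc 0 T, |m t| ≤ Q * (Λ + T) := fun t ht =>
    (bm t ht).trans (mul_le_mul_of_nonneg_left (add_le_add (hlog t ht) ht.2) hQ)
  have bm1 : ∀ t ∈ Ioc 0 T, |m₁ t| ≤ 4 * Q * (|Real.log t| + 1) := by
    intro t ht
    have ht' := Ioc_subset_Icc_self ht
    have t0 : 0 < t := ht.1
    have c1 : |-α₂ t * Real.log t| ≤ Q * |Real.log t| := by
      rw [abs_mul, abs_neg]; gcongr; exact b2 t ht'
    have c2 : |α₁ t / t| ≤ Q := by
      rw [abs_div, abs_of_pos t0, div_le_iff₀ t0]; exact b1 t ht'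
    have c3 : |(-α₁ t * t - (α 0 - α t)) / t ^ 2| ≤ 2 * Q := by
      rw [abs_div, abs_of_pos (by positivity : 0 < t ^ 2), div_le_iff₀ (by positivity)]
      refine (abs_sub _ _).trans ?_
      have := b0 t ht'
      have : |-α₁ t * t| ≤ Q * t * t := by
        rw [abs_mul, abs_neg, abs_of_pos t0]; gcongr; exact b1 t ht'
      nlinarith
    have c4 := abs_sub (-α₂ t * Real.log t) (α₁ t / t)
    have c5 := abs_add_le (-α₂ t * Real.log t - α₁ t / t) ((-α₁ t * t - (α 0 - α t)) / t ^ 2)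
    have := mul_nonneg hQ (abs_nonneg (Real.log t))
    simp only [hm₁]
    linarith
  have bR : ∀ t ∈ Icc 0 T, |R t| ≤ p0 := fun t ht => hp0' _ (hmem t ht)
  have bR1 : ∀ t ∈ Icc 0 T, |R₁ t| ≤ p1 * (Q * t) := fun t ht => by
    rw [hR₁, abs_neg, abs_mul]
    exact mul_le_mul (hp1' _ (hmem t ht)) (b1 t ht) (abs_nonneg _) hp1
  have bR1' : ∀ t ∈ Icc 0 T, |R₁ t| ≤ p1 * (Q * T) := fun t ht =>
    (bR1 t ht).trans (by have := ht.2; gcongr)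
  have bR2 : ∀ t ∈ Icc 0 T, |R₂ t| ≤ p2 * (Q * T) * (Q * T) + p1 * Q := fun t ht => by
    have hb1 : |α₁ t| ≤ Q * T := (b1 t ht).trans (by have := ht.2; gcongr)
    refine (abs_sub _ _).trans (add_le_add ?_ ?_)
    · rw [abs_mul, abs_mul]
      have := hp2' _ (hmem t ht)
      gcongr
    · rw [abs_mul]
      have := hp1' _ (hmem t ht)
      have := b2 t ht
      gcongr
  have dR : ∀ t ∈ Icc 0 T, HasDerivWithinAt R (R₁ t) (Icc 0 T) t := fun t ht => by
    have := (hP1 (2 - α t)).comp_hasDerivWithinAt t ((hd0 t ht).const_sub 2)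
    exact this.congr_deriv (by simp only [hR₁]; ring)
  have dR1 : ∀ t ∈ Icc 0 T, HasDerivWithinAt R₁ (R₂ t) (Icc 0 T) t := fun t ht => by
    have := (((hP2 (2 - α t)).comp_hasDerivWithinAt t ((hd0 t ht).const_sub 2)).mul (hd1 t ht)).neg
    exact this.congr_deriv (by simp only [hR₂, Function.comp]; ring)
  have dlog : ∀ t ∈ Ioc 0 T, HasDerivWithinAt Real.log t⁻¹ (Icc 0 T) t := fun t ht =>
    (Real.hasDerivAt_log ht.1.ne').hasDerivWithinAt
  have dE : ∀ t ∈ Ioc 0 T, HasDerivWithinAt E (E t * m t) (Icc 0 T) t := fun t ht => by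
    have := (((hd0 t (Ioc_subset_Icc_self ht)).const_sub (α 0)).mul (dlog t ht)).exp
    exact this.congr_deriv (by
      simp only [hE, hm, Pi.mul_apply]
      rw [div_eq_mul_inv])
  have dm : ∀ t ∈ Ioc 0 T, HasDerivWithinAt m (m₁ t) (Icc 0 T) t := fun t ht => by
    have ht' := Ioc_subset_Icc_self ht
    have := ((hd1 t ht').neg.mul (dlog t ht)).add
      (((hd0 t ht').const_sub (α 0)).div (hasDerivWithinAt_id t (Icc 0 T)) ht.1.ne')
    refine this.congr_deriv ?_
    simp only [hm₁, Pi.neg_apply, id]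
    rw [div_eq_mul_inv (α₁ t) t]; ring
  set κ₁ : ℝ → ℝ := fun t => E t * (m t * R t + R₁ t) with hκ₁
  set κ₂ : ℝ → ℝ := fun t =>
    E t * (m t * (m t * R t + R₁ t) + (m₁ t * R t + m t * R₁ t + R₂ t)) with hκ₂
  have dκ : ∀ t ∈ Ioc 0 T, HasDerivWithinAt (kernelProfile α) (κ₁ t) (Icc 0 T) t := fun t ht => by
    have := (dE t ht).mul (dR t (Ioc_subset_Icc_self ht))
    exact this.congr_deriv (by simp only [hκ₁]; ring)
  have dκ₁ : ∀ t ∈ Ioc 0 T, HasDerivWithinAt κ₁ (κ₂ t) (Icc 0 T) t := fun t ht => by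
    have ht' := Ioc_subset_Icc_self ht
    have := (dE t ht).mul (((dm t ht).mul (dR t ht')).add (dR1 t ht'))
    exact this.congr_deriv (by simp only [hκ₂, Pi.add_apply, Pi.mul_apply]; ring)
  set e := Real.exp (Q * T * Λ) with he
  have he0 : 0 < e := Real.exp_pos _
  have bκ₁ : ∀ t ∈ Icc 0 T, |κ₁ t| ≤ e * (Q * (t * |Real.log t| + t) * p0 + p1 * (Q * t)) := by
    intro t ht
    rw [hκ₁, abs_mul]
    have h1 : |m t * R t + R₁ t| ≤ Q * (t * |Real.log t| + t) * p0 + p1 * (Q * t) := by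
      refine (abs_add_le _ _).trans (add_le_add ?_ (bR1 t ht))
      rw [abs_mul]
      exact mul_le_mul (bm t ht) (bR t ht) (abs_nonneg _) ((abs_nonneg _).trans (bm t ht))
    exact mul_le_mul (bE t ht) h1 (abs_nonneg _) he0.le
  have bκ₁' : ∀ t ∈ Icc 0 T, |κ₁ t| ≤ e * (Q * (Λ + T) * p0 + p1 * (Q * T)) := by
    intro t ht
    refine (bκ₁ t ht).trans ?_
    have := hlog t ht
    have := ht.2
    gcongr
  have ev0 : Ioo 0 T ∈ 𝓝[>] (0 : ℝ) := Ioo_mem_nhdsGT hT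
  have hcont0 : ContinuousWithinAt (kernelProfile α) (Ioo 0 T) 0 := by
    refine ContinuousWithinAt.mul ?_ (((dR 0 h00).continuousWithinAt).mono Ioo_subset_Icc_self)
    refine Real.continuous_exp.continuousAt.comp_continuousWithinAt ?_
    have hz : (α 0 - α 0) * Real.log 0 = 0 := by simp
    unfold ContinuousWithinAt
    beta_reduce
    rw [hz]
    refine squeeze_zero_norm' (a := fun t => Q * t * Λ) ?_ ?_
    · filter_upwards [self_mem_nhdsWithin] with t ht
      exact bexp t (Ioo_subset_Icc_self ht)
    · have : Continuous fun t : ℝ => Q * t * Λ := by fun_prop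
      have := this.tendsto 0
      simp only [mul_zero, zero_mul] at this
      exact this.mono_left nhdsWithin_le_nhds
  have hat : ∀ t ∈ Ioo 0 T, HasDerivAt (kernelProfile α) (κ₁ t) t := fun t ht =>
    (dκ t (Ioo_subset_Ioc_self ht)).hasDerivAt (Icc_mem_nhds ht.1 ht.2)
  -- With the conventions `log 0 = 0` and `x / 0 = 0` the formula for `κ₁` already takes the right
  -- value at `0`. The one-sided derivative there is then obtained from the limit of the
  -- derivatives.
  have hκ₁0 : κ₁ 0 = 0 := by
    have := bκ₁ 0 h00
    simpa using this
  have dκ0 : HasDerivWithinAt (kernelProfile α) (κ₁ 0) (Icc 0 T) 0 := by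
    rw [hκ₁0]
    refine (hasDerivWithinAt_Ici_of_tendsto_deriv (s := Ioo 0 T)
      (fun t ht => (hat t ht).differentiableAt.differentiableWithinAt) hcont0 ev0 ?_).mono
      Icc_subset_Ici_self
    refine squeeze_zero_norm' (a := fun t => e * (Q * (|t * Real.log t| + t) * p0 + p1 * (Q * t))) ?_ ?_
    · filter_upwards [ev0] with t ht
      rw [(hat t ht).deriv, Real.norm_eq_abs, abs_mul t, abs_of_pos ht.1]
      exact bκ₁ t (Ioo_subset_Icc_self ht)
    · have : Continuous fun t : ℝ => e * (Q * (|t * Real.log t| + t) * p0 + p1 * (Q * t)) := by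
        have := Real.continuous_mul_log
        fun_prop
      have := this.tendsto 0
      simp only [zero_mul, abs_zero, add_zero, mul_zero] at this
      exact this.mono_left nhdsWithin_le_nhds
  set r1 := p1 * (Q * T) with hr1
  set r2 := p2 * (Q * T) * (Q * T) + p1 * Q with hr2
  set M := Q * (Λ + T) with hM
  have hM0 : 0 ≤ M := by positivity
  have hr10 : 0 ≤ r1 := by positivity
  have hr20 : 0 ≤ r2 := by positivity
  refine ⟨κ₁, κ₂, e * (M * p0 + r1) + e * (M * (M * p0 + r1) + (4 * Q * p0 + M * r1 + r2)),
    by positivity, ?_, dκ₁, ?_, ?_⟩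
  · intro t ht
    rcases ht.1.eq_or_lt with h0 | h0
    · rw [← h0]; exact dκ0
    · exact dκ t ⟨h0, ht.2⟩
  · intro t ht
    have : 0 ≤ e * (M * (M * p0 + r1) + (4 * Q * p0 + M * r1 + r2)) := by positivity
    linarith [bκ₁' t ht]
  · intro t ht
    have ht' := Ioc_subset_Icc_self ht
    have h1 := abs_sum_le_of_bounds (bE t ht') (bm' t ht') (bm1 t ht) (bR t ht') (bR1' t ht') (bR2 t ht')
    refine h1.trans ?_
    have hl := abs_nonneg (Real.log t)
    have h2 : 0 ≤ e * (M * p0 + r1) * (|Real.log t| + 1) := by positivity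
    have h3 : 0 ≤ e * ((M * (M * p0 + r1) + M * r1 + r2) * |Real.log t|) := by positivity
    linarith

end

end DiffusionWave

/-! ### Beta averages of dilations and the derivatives of `g`. -/

namespace DiffusionWave
open MeasureTheory Filter Topology

section
variable {T Qα K : ℝ} {α κ κ₁ κ₂ W : ℝ → ℝ}

theorem integrableOn_mul_dilation {f : ℝ → ℝ} {s M : ℝ} {J : Set ℝ}
    (hW : IntegrableOn W (Ioo 0 1)) (hf : ContinuousOn f J) (hM : ∀ x ∈ J, |f x| ≤ M)
    (hs : ∀ z ∈ Ioo (0 : ℝ) 1, s * z ∈ J) :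
    IntegrableOn (fun z => W z * f (s * z)) (Ioo 0 1) := by
  refine Integrable.mul_bdd (c := M) hW ?_ ?_
  · exact ContinuousOn.aestronglyMeasurable (hf.comp (by fun_prop) hs) measurableSet_Ioo
  · filter_upwards [ae_restrict_mem measurableSet_Ioo] with z hz
    exact hM _ (hs z hz)

theorem mul_mem_Icc_of_mem {s z : ℝ} (hs : s ∈ Icc 0 T) (hz : z ∈ Ioo (0 : ℝ) 1) :
    s * z ∈ Icc 0 T :=
  ⟨mul_nonneg hs.1 hz.1.le, (mul_le_of_le_one_right hs.1 hz.2.le).trans hs.2⟩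

theorem mul_mem_Ioc_of_mem {s z : ℝ} (hs : s ∈ Ioc 0 T) (hz : z ∈ Ioo (0 : ℝ) 1) :
    s * z ∈ Ioc 0 T :=
  ⟨mul_pos hs.1 hz.1, (mul_le_of_le_one_right hs.1.le hz.2.le).trans hs.2⟩

theorem hasDerivWithinAt_dilation_mean (hW : IntegrableOn W (Ioo 0 1)) (hT : 0 < T)
    (hd : ∀ t ∈ Icc 0 T, HasDerivWithinAt κ (κ₁ t) (Icc 0 T) t)
    (hb : ∀ t ∈ Icc 0 T, |κ₁ t| ≤ K) {t : ℝ} (ht : t ∈ Icc 0 T) :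
    HasDerivWithinAt (fun s => ∫ z in Ioo (0 : ℝ) 1, W z * κ (s * z))
      (∫ z in Ioo (0 : ℝ) 1, W z * (z * κ₁ (t * z))) (Icc 0 T) t := by
  have hκc : ContinuousOn κ (Icc 0 T) := fun t ht => (hd t ht).continuousWithinAt
  obtain ⟨M, hM⟩ := isCompact_Icc.exists_bound_of_continuousOn hκc
  have hK : 0 ≤ K := (abs_nonneg _).trans (hb 0 ⟨le_rfl, hT.le⟩)
  refine hasDerivWithinAt_integral_of_dominated (b := fun z => |W z| * K)
    (F' := fun s z => W z * (z * κ₁ (s * z))) (convex_Icc 0 T) ht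
    (fun s hs => integrableOn_mul_dilation hW hκc hM fun z hz => mul_mem_Icc_of_mem hs hz)
    ?_ ?_ (hW.abs.mul_const K)
  · filter_upwards [ae_restrict_mem measurableSet_Ioo] with z hz s hs
    have h1 : HasDerivWithinAt (fun s : ℝ => s * z) z (Icc 0 T) s := by
      simpa using ((hasDerivAt_id s).mul_const z).hasDerivWithinAt
    have := ((hd _ (mul_mem_Icc_of_mem hs hz)).comp s h1
      (fun x hx => mul_mem_Icc_of_mem hx hz)).const_mul (W z)
    exact this.congr_deriv (by ring)
  · filter_upwards [ae_restrict_mem measurableSet_Ioo] with z hz s hs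
    have h1 := hb _ (mul_mem_Icc_of_mem hs hz)
    rw [abs_mul, abs_mul, abs_of_pos hz.1]
    have h2 : z * |κ₁ (s * z)| ≤ 1 * K := mul_le_mul hz.2.le h1 (abs_nonneg _) zero_le_one
    rw [one_mul] at h2
    gcongr

/-- `|log (s z)|` splits into `|log s| + |log z|`, and one factor `z` from the differentiation
controls `|log z|` because `z |log z| ≤ 1`. -/
theorem abs_dilation_second_le {s z : ℝ} (hK : 0 ≤ K)
    (hb : ∀ t ∈ Ioc 0 T, |κ₂ t| ≤ K * (|Real.log t| + 1)) (hs : s ∈ Ioc 0 T)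
    (hz : z ∈ Ioo (0 : ℝ) 1) :
    |W z * (z * (z * κ₂ (s * z)))| ≤ |W z| * (K * (|Real.log s| + 2)) := by
  have h1 := hb _ (mul_mem_Ioc_of_mem hs hz)
  have hz0 : 0 < z := hz.1
  have hz1 : z < 1 := hz.2
  rw [Real.log_mul hs.1.ne' hz0.ne'] at h1
  have h2 : |z * Real.log z| ≤ 1 := by
    rw [mul_comm]
    exact (Real.abs_log_mul_self_lt z hz0 hz1.le).le
  rw [abs_mul, abs_of_pos hz0] at h2
  have h3 := abs_add_le (Real.log s) (Real.log z)
  have h4 : z * |κ₂ (s * z)| ≤ K * (|Real.log s| + 2) := by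
    calc z * |κ₂ (s * z)| ≤ z * (K * (|Real.log s + Real.log z| + 1)) := by gcongr
      _ ≤ z * (K * (|Real.log s| + |Real.log z| + 1)) := by gcongr
      _ = K * (z * |Real.log s| + z * |Real.log z| + z) := by ring
      _ ≤ K * (1 * |Real.log s| + 1 + 1) := by gcongr
      _ = _ := by ring
  have h5 : z * (z * |κ₂ (s * z)|) ≤ 1 * (K * (|Real.log s| + 2)) :=
    mul_le_mul hz1.le h4 (by positivity) zero_le_one
  rw [one_mul] at h5
  rw [abs_mul, abs_mul, abs_mul, abs_of_pos hz0]
  gcongr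

/-- The bound on `κ₂` blows up at `0`, so the domination is made on `[t/2, T]`, where the logarithm
is bounded; this is a neighbourhood of `t` within `[0, T]`. -/
theorem hasDerivWithinAt_dilation_mean_deriv (hW : IntegrableOn W (Ioo 0 1)) (hT : 0 < T)
    (hd : ∀ t ∈ Ioc 0 T, HasDerivWithinAt κ₁ (κ₂ t) (Icc 0 T) t)
    (hb₁ : ∀ t ∈ Icc 0 T, |κ₁ t| ≤ K)
    (hb : ∀ t ∈ Ioc 0 T, |κ₂ t| ≤ K * (|Real.log t| + 1)) {t : ℝ} (ht : t ∈ Ioc 0 T) :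
    HasDerivWithinAt (fun s => ∫ z in Ioo (0 : ℝ) 1, W z * (z * κ₁ (s * z)))
      (∫ z in Ioo (0 : ℝ) 1, W z * (z * (z * κ₂ (t * z)))) (Icc 0 T) t := by
  have hK : 0 ≤ K := (abs_nonneg _).trans (hb₁ 0 ⟨le_rfl, hT.le⟩)
  have ht0 : 0 < t := ht.1
  have hκc : ContinuousOn κ₁ (Ioc 0 T) := fun s hs =>
    ((hd s hs).continuousWithinAt).mono Ioc_subset_Icc_self
  have hsub : Icc (t / 2) T ⊆ Ioc 0 T := fun s hs => ⟨by linarith [hs.1], hs.2⟩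
  obtain ⟨Λ, hΛ⟩ := isCompact_Icc.exists_bound_of_continuousOn (s := Icc (t / 2) T) (f := Real.log)
    (Real.continuousOn_log.mono fun s hs => (hsub hs).1.ne')
  have hW' : IntegrableOn (fun z => W z * z) (Ioo 0 1) := by
    refine Integrable.mul_bdd (c := 1) hW (by fun_prop) ?_
    filter_upwards [ae_restrict_mem measurableSet_Ioo] with z hz
    rw [Real.norm_eq_abs, abs_of_pos hz.1]; exact hz.2.le
  have key : HasDerivWithinAt (fun s => ∫ z in Ioo (0 : ℝ) 1, W z * (z * κ₁ (s * z)))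
      (∫ z in Ioo (0 : ℝ) 1, W z * (z * (z * κ₂ (t * z)))) (Icc (t / 2) T) t := by
    refine hasDerivWithinAt_integral_of_dominated (b := fun z => |W z| * (K * (Λ + 2)))
      (F' := fun s z => W z * (z * (z * κ₂ (s * z)))) (convex_Icc _ T) ⟨by linarith, ht.2⟩
      (fun s hs => ?_) ?_ ?_ (hW.abs.mul_const _)
    · have := integrableOn_mul_dilation hW' hκc
        (fun x hx => hb₁ x (Ioc_subset_Icc_self hx)) fun z hz => mul_mem_Ioc_of_mem (hsub hs) hz
      have h2 : IntegrableOn (fun z => W z * (z * κ₁ (s * z))) (Ioo 0 1) := by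
        simpa only [mul_assoc] using this
      exact h2
    · filter_upwards [ae_restrict_mem measurableSet_Ioo] with z hz s hs
      have h1 : HasDerivWithinAt (fun s : ℝ => s * z) z (Icc (t / 2) T) s := by
        simpa using ((hasDerivAt_id s).mul_const z).hasDerivWithinAt
      have := (((hd _ (mul_mem_Ioc_of_mem (hsub hs) hz)).comp s h1
        (fun x hx => mul_mem_Icc_of_mem (Ioc_subset_Icc_self (hsub hx)) hz)).const_mul z).const_mul
          (W z)
      exact this.congr_deriv (by ring)
    · filter_upwards [ae_restrict_mem measurableSet_Ioo] with z hz s hs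
      refine (abs_dilation_second_le hK hb (hsub hs) hz).trans ?_
      have : |Real.log s| ≤ Λ := hΛ s hs
      gcongr
  refine key.mono_of_mem_nhdsWithin ?_
  have : Ioi (t / 2) ∈ 𝓝 t := Ioi_mem_nhds (show t / 2 < t by linarith)
  filter_upwards [self_mem_nhdsWithin, mem_nhdsWithin_of_mem_nhds this] with s h1 h2
  exact ⟨le_of_lt h2, h1.2⟩

theorem varKernel_eq {s : ℝ} (hs : 0 < s) :
    varKernel α s = s ^ (1 - α 0) * kernelProfile α s := by
  rw [varKernel, kernelProfile, invGamma, div_eq_mul_inv, ← mul_assoc]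
  congr 1
  rw [mul_comm (α 0 - α s), ← Real.rpow_def_of_pos hs, ← Real.rpow_add hs]
  congr 1; ring

theorem kernelProfile_zero : kernelProfile α 0 = (Real.Gamma (1 - (α 0 - 1)))⁻¹ := by
  simp [kernelProfile, invGamma]
  congr 1; ring

open ProbabilityTheory in
theorem integrableOn_betaPDFReal {p q : ℝ} (hp : 0 < p) (hq : 0 < q) :
    IntegrableOn (betaPDFReal p q) (Ioo 0 1) ∧ ∫ z in Ioo (0 : ℝ) 1, betaPDFReal p q z = 1 := by
  have hl := lintegral_betaPDF_eq_one hp hq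
  rw [lintegral_betaPDF] at hl
  have e : ∫⁻ z in Ioo (0 : ℝ) 1, ENNReal.ofReal (betaPDFReal p q z) = 1 := by
    rw [← hl]
    refine setLIntegral_congr_fun measurableSet_Ioo fun z hz => ?_
    simp only [betaPDFReal, if_pos (show 0 < z ∧ z < 1 from hz)]
  have hnn : 0 ≤ᵐ[volume.restrict (Ioo 0 1)] betaPDFReal p q := by
    filter_upwards [ae_restrict_mem measurableSet_Ioo] with z hz
    exact (betaPDFReal_pos hz.1 hz.2 hp hq).le
  have hm := (measurable_betaPDFReal p q).aestronglyMeasurable (μ := volume.restrict (Ioo 0 1))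
  constructor
  · refine ⟨hm, ?_⟩
    rw [hasFiniteIntegral_iff_ofReal hnn, e]
    exact ENNReal.one_lt_top
  · rw [integral_eq_lintegral_of_nonneg_ae hnn hm, e, ENNReal.toReal_one]

open ProbabilityTheory in
-- After `s = t z` the powers of `t` cancel, as `t · t^(a-1) · t^(-a) = 1`, and `z^(-a) (1-z)^(a-1)`
-- is a Beta density up to `Γ(a) Γ(1-a)`. At `t = 0` the formula reproduces the prescribed value
-- `1`.
theorem genIdentity_eq (h0 : 1 < α 0) (h1 : α 0 < 2) {t : ℝ} (ht : 0 ≤ t) :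
    genIdentity α t = ∫ z in Ioo (0 : ℝ) 1,
      betaPDFReal (1 - (α 0 - 1)) (α 0 - 1) z
        * (Real.Gamma (1 - (α 0 - 1)) * kernelProfile α (t * z)) := by
  set a := α 0 - 1 with ha
  have ha0 : 0 < a := by linarith
  have ha1 : 0 < 1 - a := by linarith
  have hΓ := Real.Gamma_pos_of_pos ha0
  have hΓ' := Real.Gamma_pos_of_pos ha1
  rcases ht.eq_or_lt with rfl | ht
  · rw [genIdentity, if_pos rfl]
    simp only [zero_mul, kernelProfile_zero]
    rw [← ha, mul_inv_cancel₀ hΓ'.ne']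
    simp only [mul_one]
    exact (integrableOn_betaPDFReal ha1 ha0).2.symm
  · rw [genIdentity, if_neg ht.ne']
    have e := intervalIntegral.smul_integral_comp_mul_left (a := 0) (b := 1)
      (fun s => abelKernel a (t - s) * varKernel α s) t
    rw [mul_zero, mul_one] at e
    rw [← ha, ← e, smul_eq_mul, ← intervalIntegral.integral_const_mul,
      intervalIntegral.integral_of_le zero_le_one, integral_Ioc_eq_integral_Ioo]
    refine setIntegral_congr_fun measurableSet_Ioo fun z hz => ?_
    have hz0 : 0 < z := hz.1
    have hz1 : 0 < 1 - z := by linarith [hz.2]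
    rw [varKernel_eq (mul_pos ht hz0), abelKernel, betaPDFReal,
      if_pos (show 0 < z ∧ z < 1 from hz), beta]
    rw [show t - t * z = t * (1 - z) by ring, Real.mul_rpow ht.le hz1.le,
      Real.mul_rpow ht.le hz0.le, show 1 - a + a = 1 by ring, Real.Gamma_one,
      show 1 - α 0 = -a by rw [ha]; ring, show 1 - a - 1 = -a by ring, Real.rpow_sub_one ht.ne',
      Real.rpow_neg ht.le]
    have := Real.rpow_pos_of_pos ht a
    field_simp

open ProbabilityTheory in
/-- Every admissible exponent has a constant that controls the generalized identity function. -/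
theorem IsAdmissibleExponent.exists_kernelConstant (hT : 0 < T)
    (h : IsAdmissibleExponent T Qα α) : ∃ Qg > 0, IsKernelConstant T α Qg := by
  obtain ⟨κ₁, κ₂, K, hK, hd, hd₁, hb₁, hb₂⟩ := h.exists_profile_derivs hT
  have h00 : (0 : ℝ) ∈ Icc 0 T := ⟨le_rfl, hT.le⟩
  obtain ⟨h0, h1⟩ := h.range 0 h00
  set a := α 0 - 1 with ha
  set G := Real.Gamma (1 - a) with hG
  have hG0 : 0 < G := Real.Gamma_pos_of_pos (by linarith)
  set W : ℝ → ℝ := fun z => betaPDFReal (1 - a) a z * G with hWdef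
  obtain ⟨hβ, hβ1⟩ := integrableOn_betaPDFReal (p := 1 - a) (q := a) (by linarith) (by linarith)
  have hW : IntegrableOn W (Ioo 0 1) := hβ.mul_const _
  have hWabs : ∫ z in Ioo (0 : ℝ) 1, |W z| = G := by
    have : ∫ z in Ioo (0 : ℝ) 1, |W z| = ∫ z in Ioo (0 : ℝ) 1, betaPDFReal (1 - a) a z * G := by
      refine setIntegral_congr_fun measurableSet_Ioo fun z hz => ?_
      exact abs_of_nonneg (mul_nonneg (betaPDFReal_pos hz.1 hz.2 (by linarith) (by linarith)).le hG0.le)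
    rw [this, integral_mul_const, hβ1, one_mul]
  have hg : ∀ t, 0 ≤ t → genIdentity α t = ∫ z in Ioo (0 : ℝ) 1, W z * kernelProfile α (t * z) := by
    intro t ht
    rw [genIdentity_eq h0 h1 ht]
    simp only [hWdef, mul_assoc]
    rfl
  set g₁ : ℝ → ℝ := fun t => ∫ z in Ioo (0 : ℝ) 1, W z * (z * κ₁ (t * z))
  set g₂ : ℝ → ℝ := fun t => ∫ z in Ioo (0 : ℝ) 1, W z * (z * (z * κ₂ (t * z)))
  have hdg : ∀ t ∈ Icc 0 T, HasDerivWithinAt (genIdentity α) (g₁ t) (Icc 0 T) t := fun t ht =>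
    (hasDerivWithinAt_dilation_mean hW hT hd hb₁ ht).congr (fun s hs => hg s hs.1) (hg t ht.1)
  have hun := uniqueDiffOn_Icc hT
  have hder : ∀ t ∈ Icc 0 T, derivWithin (genIdentity α) (Icc 0 T) t = g₁ t := fun t ht =>
    (hdg t ht).derivWithin (hun t ht)
  have hdg₁ : ∀ t ∈ Ioc 0 T,
      HasDerivWithinAt (derivWithin (genIdentity α) (Icc 0 T)) (g₂ t) (Icc 0 T) t := fun t ht =>
    (hasDerivWithinAt_dilation_mean_deriv hW hT hd₁ hb₁ hb₂ ht).congr hder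
      (hder t (Ioc_subset_Icc_self ht))
  have hcont : ContinuousOn (genIdentity α) (Icc 0 T) := fun t ht => (hdg t ht).continuousWithinAt
  obtain ⟨M, hM⟩ := isCompact_Icc.exists_bound_of_continuousOn hcont
  have hint : ∀ c : ℝ, ∫ z in Ioo (0 : ℝ) 1, |W z| * c = G * c := fun c => by
    rw [integral_mul_const, hWabs]
  have hbg₁ : ∀ t ∈ Icc 0 T, |g₁ t| ≤ G * K := by
    intro t ht
    rw [← hint, ← Real.norm_eq_abs]
    refine norm_integral_le_of_norm_le (g := fun z => |W z| * K) (hW.abs.mul_const K) ?_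
    filter_upwards [ae_restrict_mem measurableSet_Ioo] with z hz
    have h2 : |z * κ₁ (t * z)| ≤ 1 * K := by
      rw [abs_mul, abs_of_pos hz.1]
      exact mul_le_mul hz.2.le (hb₁ _ (mul_mem_Icc_of_mem ht hz)) (abs_nonneg _) zero_le_one
    rw [one_mul] at h2
    exact (abs_mul (W z) (z * κ₁ (t * z))).trans_le
      (mul_le_mul_of_nonneg_left h2 (abs_nonneg (W z)))
  have hbg₂ : ∀ t ∈ Ioc 0 T, |g₂ t| ≤ G * (K * (|Real.log t| + 2)) := by
    intro t ht
    rw [← hint, ← Real.norm_eq_abs]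
    refine norm_integral_le_of_norm_le (g := fun z => |W z| * (K * (|Real.log t| + 2)))
      (hW.abs.mul_const _) ?_
    filter_upwards [ae_restrict_mem measurableSet_Ioo] with z hz
    exact abs_dilation_second_le hK hb₂ ht hz
  have hGK : 0 ≤ G * K := mul_nonneg hG0.le hK
  refine ⟨|M| + 2 * (G * K) + 1, by positivity, ?_, ?_, ?_, ?_, ?_⟩
  · intro t ht
    have : |genIdentity α t| ≤ M := hM t ht
    linarith [le_abs_self M]
  · exact fun t ht => (hdg t ht).differentiableWithinAt
  · intro t ht
    rw [hder t ht]
    linarith [hbg₁ t ht, abs_nonneg M]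
  · exact fun t ht => (hdg₁ t ht).differentiableWithinAt
  · intro t ht
    rw [(hdg₁ t ht).derivWithin (hun t (Ioc_subset_Icc_self ht))]
    refine (hbg₂ t ht).trans ?_
    have := abs_nonneg (Real.log t)
    have := mul_nonneg hGK (abs_nonneg (Real.log t))
    have := mul_nonneg (abs_nonneg M) (abs_nonneg (Real.log t))
    nlinarith [abs_nonneg M]

end

end DiffusionWave

/-! ### Causal convolutions and the integrated identity. -/

namespace DiffusionWave
open MeasureTheory Filter Topology
open scoped Convolution

section
variable {T a : ℝ} {f h F H H' k w v φ g : ℝ → ℝ}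

/-- The convolution of two real functions on the line. -/
noncomputable def lineConv (f h : ℝ → ℝ) : ℝ → ℝ := f ⋆[ContinuousLinearMap.mul ℝ ℝ, volume] h

theorem lineConv_apply (f h : ℝ → ℝ) (t : ℝ) : lineConv f h t = ∫ s, f s * h (t - s) := rfl

theorem lineConv_apply_swap (f h : ℝ → ℝ) (t : ℝ) : lineConv f h t = ∫ s, f (t - s) * h s :=
  convolution_mul_swap

theorem lineConv_comm (f h : ℝ → ℝ) : lineConv f h = lineConv h f := by
  funext t
  rw [lineConv_apply, lineConv_apply_swap]
  simp only [mul_comm]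

theorem integrable_lineConv (hf : Integrable f) (hh : Integrable h) : Integrable (lineConv f h) :=
  hf.integrable_convolution _ hh

/-- For integrable functions the iterated convolutions need only exist almost everywhere, hence the
almost-everywhere statement. -/
theorem lineConv_assoc (hf : Integrable f) (hh : Integrable h) (hk : Integrable k) :
    lineConv (lineConv f h) k =ᵐ[volume] lineConv f (lineConv h k) := by
  have h1 := hf.ae_convolution_exists (ContinuousLinearMap.mul ℝ ℝ) hh
  have h2 := hh.norm.ae_convolution_exists (ContinuousLinearMap.mul ℝ ℝ) hk.norm
  have h3 := hf.norm.ae_convolution_exists (ContinuousLinearMap.mul ℝ ℝ)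
    (hh.norm.integrable_convolution (ContinuousLinearMap.mul ℝ ℝ) hk.norm)
  filter_upwards [h3] with t ht
  exact convolution_assoc _ _ _ _ (fun x y z => mul_assoc x y z) hf.aestronglyMeasurable
    hh.aestronglyMeasurable hk.aestronglyMeasurable h1 h2 ht

/-- Causality: the value at `t` sees `H` only up to time `t`. The identities between convolutions,
known only up to `T`, can therefore be inserted. -/
theorem lineConv_congr_right (hf : ∀ t ≤ 0, f t = 0) (hH : ∀ t ≤ T, H t = H' t) {t : ℝ}
    (ht : t ≤ T) : lineConv f H t = lineConv f H' t := by
  rw [lineConv_apply, lineConv_apply]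
  refine integral_congr_ae (Eventually.of_forall fun s => ?_)
  rcases le_or_gt s 0 with hs | hs
  · simp only [hf s hs, zero_mul]
  · simp only [hH (t - s) (by linarith)]

/-- The restriction of a function to `(0, T]`, extended by zero. -/
noncomputable def causal (T : ℝ) (f : ℝ → ℝ) : ℝ → ℝ := (Ioc 0 T).indicator f

theorem causal_of_nonpos {t : ℝ} (ht : t ≤ 0) : causal T f t = 0 :=
  indicator_of_notMem (fun h => absurd h.1 (not_lt.2 ht)) _

theorem causal_of_mem {t : ℝ} (ht : t ∈ Ioc 0 T) : causal T f t = f t := indicator_of_mem ht _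

theorem integrable_causal (hf : IntegrableOn f (Ioc 0 T)) : Integrable (causal T f) :=
  hf.integrable_indicator measurableSet_Ioc

theorem lineConv_causal (h : ∀ t ∈ Ioc 0 T, ∫ s in (0 : ℝ)..t, f (t - s) * k s = H t) {t : ℝ}
    (ht : t ≤ T) : lineConv (causal T f) (causal T k) t = causal T H t := by
  rw [lineConv_apply_swap]
  rcases le_or_gt t 0 with ht0 | ht0
  · rw [causal_of_nonpos ht0, ← integral_zero ℝ ℝ (μ := volume)]
    refine integral_congr_ae (Eventually.of_forall fun s => ?_)
    rcases le_or_gt s 0 with hs | hs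
    · simp only [causal_of_nonpos hs, mul_zero]
    · simp only [causal_of_nonpos (show t - s ≤ 0 by linarith), zero_mul]
  · rw [causal_of_mem ⟨ht0, ht⟩, ← h t ⟨ht0, ht⟩,
      intervalIntegral.integral_of_le ht0.le, integral_Ioc_eq_integral_Ioo,
      ← integral_indicator measurableSet_Ioo]
    refine integral_congr_ae (Eventually.of_forall fun s => ?_)
    rcases le_or_gt s 0 with hs | hs
    · simp only [causal_of_nonpos hs, mul_zero]
      rw [indicator_of_notMem fun h => absurd h.1 (not_lt.2 hs)]
    · rcases le_or_gt t s with hs' | hs'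
      · simp only [causal_of_nonpos (show t - s ≤ 0 by linarith), zero_mul]
        rw [indicator_of_notMem fun h => absurd h.2 (not_lt.2 hs')]
      · rw [indicator_of_mem (show s ∈ Ioo 0 t from ⟨hs, hs'⟩)]
        simp only
        rw [causal_of_mem ⟨hs, by linarith⟩, causal_of_mem ⟨by linarith, by linarith⟩]

theorem continuousOn_conv (hT : 0 ≤ T) (hf : ContinuousOn f (Icc 0 T))
    (hh : ContinuousOn h (Icc 0 T)) :
    ContinuousOn (fun t => ∫ s in (0 : ℝ)..t, f (t - s) * h s) (Icc 0 T) := by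
  have hf' : Continuous (IccExtend hT ((Icc 0 T).domRestrict f)) :=
    (continuousOn_iff_continuous_domRestrict.1 hf).Icc_extend'
  have hh' : Continuous (IccExtend hT ((Icc 0 T).domRestrict h)) :=
    (continuousOn_iff_continuous_domRestrict.1 hh).Icc_extend'
  have hc : Continuous fun t => ∫ s in (0 : ℝ)..t, IccExtend hT ((Icc 0 T).domRestrict f) (t - s)
      * IccExtend hT ((Icc 0 T).domRestrict h) s := by
    refine intervalIntegral.continuous_parametric_intervalIntegral_of_continuous
      (f := fun t s => IccExtend hT ((Icc 0 T).domRestrict f) (t - s)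
        * IccExtend hT ((Icc 0 T).domRestrict h) s) ?_ continuous_id
    fun_prop
  refine hc.continuousOn.congr fun t ht => ?_
  refine intervalIntegral.integral_congr fun s hs => ?_
  rw [uIcc_of_le ht.1] at hs
  rw [IccExtend_of_mem hT _ (show s ∈ Icc 0 T from ⟨hs.1, hs.2.trans ht.2⟩),
    IccExtend_of_mem hT _ (show t - s ∈ Icc 0 T from ⟨by linarith [hs.2], by linarith [hs.1, ht.2]⟩)]
  rfl

/-- If `β_a * k = g`, `k * w = φ` and `v` is the primitive of `w`, then `v * g = (1 * β_a) * φ`. -/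
theorem conv_primitive_eq (hT : 0 < T) (ha : 0 < a) (hk : IntegrableOn k (Ioc 0 T))
    (hw : IntegrableOn w (Ioc 0 T)) (hv : ContinuousOn v (Icc 0 T)) (hv0 : v 0 = 0)
    (hvw : ∀ t ∈ Ioo 0 T, HasDerivAt v (w t) t) (hφc : ContinuousOn φ (Icc 0 T))
    (hgc : ContinuousOn g (Icc 0 T))
    (hφ : ∀ t ∈ Ioc 0 T, ∫ s in (0 : ℝ)..t, k (t - s) * w s = φ t)
    (hg : ∀ t ∈ Ioc 0 T, ∫ s in (0 : ℝ)..t, abelKernel a (t - s) * k s = g t) :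
    ∀ t ∈ Icc 0 T, ∫ s in (0 : ℝ)..t, v (t - s) * g s
      = ∫ s in (0 : ℝ)..t, abelPrimitive a (t - s) * φ s := by
  have hβ : IntegrableOn (abelKernel a) (Ioc 0 T) :=
    (intervalIntegrable_iff_integrableOn_Ioc_of_le hT.le).1
      ((intervalIntegral.intervalIntegrable_rpow' (by linarith)).div_const _)
  have h1 : IntegrableOn (fun _ : ℝ => (1 : ℝ)) (Ioc 0 T) := integrableOn_const (by simp)
  have Iβ := integrable_causal hβ
  have I1 := integrable_causal h1
  have Ik := integrable_causal hk
  have Iw := integrable_causal hw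
  have eB : ∀ t ≤ T, lineConv (causal T (abelKernel a)) (causal T fun _ => 1) t
      = causal T (abelPrimitive a) t := fun t ht =>
    lineConv_causal (fun t _ => by
      simp only [mul_one]
      rw [integral_abelKernel_sub ha, sub_zero, sub_self, abelPrimitive_zero ha, sub_zero]) ht
  have eφ : ∀ t ≤ T, lineConv (causal T k) (causal T w) t = causal T φ t := fun t ht =>
    lineConv_causal hφ ht
  have eg : ∀ t ≤ T, lineConv (causal T (abelKernel a)) (causal T k) t = causal T g t := fun t ht =>
    lineConv_causal hg ht
  have ev : ∀ t ≤ T, lineConv (causal T fun _ => 1) (causal T w) t = causal T v t := fun t ht =>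
    lineConv_causal (fun t ht => by
      simp only [one_mul]
      rw [intervalIntegral.integral_eq_sub_of_hasDerivAt_of_le ht.1.le
        (hv.mono (Icc_subset_Icc_right ht.2)) (fun s hs => hvw s ⟨hs.1, hs.2.trans_le ht.2⟩)
        ((intervalIntegrable_iff_integrableOn_Ioc_of_le ht.1.le).2
          (hw.mono_set (Ioc_subset_Ioc_right ht.2))), hv0, sub_zero]) ht
  -- The chain is `(β * 1) * (k * w) = β * (1 * (k * w)) = β * (k * (1 * w)) = (β * k) * (1 * w)`,
  -- that is, `B * φ = g * v`.
  have e1 := lineConv_assoc Iβ I1 (integrable_lineConv Ik Iw)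
  have e2 : lineConv (causal T fun _ => 1) (lineConv (causal T k) (causal T w))
      =ᵐ[volume] lineConv (causal T k) (lineConv (causal T fun _ => 1) (causal T w)) := by
    rw [lineConv_comm (causal T k) (causal T w), lineConv_comm (causal T k)]
    exact (lineConv_assoc I1 Iw Ik).symm
  have e3 : lineConv (causal T (abelKernel a))
        (lineConv (causal T fun _ => 1) (lineConv (causal T k) (causal T w)))
      = lineConv (causal T (abelKernel a))
        (lineConv (causal T k) (lineConv (causal T fun _ => 1) (causal T w))) :=
    convolution_congr _ (EventuallyEq.refl _ _) e2
  have e4 := lineConv_assoc Iβ Ik (integrable_lineConv I1 Iw)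
  have key : (fun t => ∫ s in (0 : ℝ)..t, v (t - s) * g s) =ᵐ[volume.restrict (Icc 0 T)]
      fun t => ∫ s in (0 : ℝ)..t, abelPrimitive a (t - s) * φ s := by
    rw [← Measure.restrict_congr_set Ioc_ae_eq_Icc]
    filter_upwards [ae_restrict_mem measurableSet_Ioc, ae_restrict_of_ae e1, ae_restrict_of_ae e4]
      with t ht h1 h4
    have hz : ∀ {p q : ℝ → ℝ}, ∀ t ≤ 0, lineConv (causal T p) (causal T q) t = 0 := by
      intro p q t ht
      rw [lineConv_apply_swap, ← integral_zero ℝ ℝ (μ := volume)]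
      refine integral_congr_ae (Eventually.of_forall fun s => ?_)
      rcases le_or_gt s 0 with hs | hs
      · simp only [causal_of_nonpos hs, mul_zero]
      · simp only [causal_of_nonpos (show t - s ≤ 0 by linarith), zero_mul]
    have hR : lineConv (causal T (abelPrimitive a)) (causal T φ) t
        = lineConv (lineConv (causal T (abelKernel a)) (causal T fun _ => 1))
          (lineConv (causal T k) (causal T w)) t := by
      rw [lineConv_congr_right hz eφ ht.2, lineConv_comm _ (causal T φ), lineConv_comm _ (causal T φ)]
      exact (lineConv_congr_right (fun _ h => causal_of_nonpos h) eB ht.2).symm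
    have hL : lineConv (causal T v) (causal T g) t
        = lineConv (lineConv (causal T (abelKernel a)) (causal T k))
          (lineConv (causal T fun _ => 1) (causal T w)) t := by
      rw [lineConv_congr_right hz ev ht.2, lineConv_comm _ (causal T v)]
      exact (lineConv_congr_right (fun _ h => causal_of_nonpos h) eg ht.2).symm
    have := lineConv_causal (f := v) (k := g) (T := T) (fun _ _ => rfl) ht.2
    rw [causal_of_mem ht] at this
    rw [← this]
    have := lineConv_causal (f := abelPrimitive a) (k := φ) (T := T) (fun _ _ => rfl) ht.2
    rw [causal_of_mem ht] at this
    rw [← this, hL, hR, h1, h4, e3]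
  -- Both sides are continuous in `t`, which turns equality almost everywhere into equality
  -- everywhere.
  exact Measure.eqOn_Icc_of_ae_eq volume hT.ne key (continuousOn_conv hT.le hv hgc)
    (continuousOn_conv hT.le (continuous_abelPrimitive ha).continuousOn hφc)

end

end DiffusionWave

/-! ### The equation up to the boundary, and its integrated form for `u`. -/

namespace DiffusionWave
open MeasureTheory Filter Topology

section
variable {T Qα Qf C a : ℝ} {α f : ℝ → ℝ} {u₀ v₀ : ℝ → ℝ → ℝ} {D : Rectangle}
  {u : ℝ → ℝ → ℝ → ℝ}

theorem IsAdmissibleExponent.exists_varKernel_le (hT : 0 < T) (h : IsAdmissibleExponent T Qα α) :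
    ∃ K, 0 ≤ K ∧ ContinuousOn (varKernel α) (Ioc 0 T) ∧
      ∀ s ∈ Ioc 0 T, |varKernel α s| ≤ K * s ^ (1 - α 0) := by
  obtain ⟨κ₁, κ₂, K, hK, hd, -, -, -⟩ := h.exists_profile_derivs hT
  have hc : ContinuousOn (kernelProfile α) (Icc 0 T) := fun t ht => (hd t ht).continuousWithinAt
  obtain ⟨M, hM⟩ := isCompact_Icc.exists_bound_of_continuousOn hc
  refine ⟨M, (norm_nonneg _).trans (hM 0 ⟨le_rfl, hT.le⟩), ?_, fun s hs => ?_⟩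
  · refine ContinuousOn.congr (f := fun s => s ^ (1 - α 0) * kernelProfile α s) ?_
      fun s hs => varKernel_eq hs.1
    exact (ContinuousOn.rpow_const continuousOn_id fun s hs => Or.inl hs.1.ne').mul
      (hc.mono Ioc_subset_Icc_self)
  · rw [varKernel_eq hs.1, abs_mul, abs_of_pos (Real.rpow_pos_of_pos hs.1 _), mul_comm]
    have := hM s (Ioc_subset_Icc_self hs)
    rw [Real.norm_eq_abs] at this
    exact mul_le_mul_of_nonneg_right this (Real.rpow_nonneg hs.1.le _)

theorem integrableOn_of_abs_le_rpow {w : ℝ → ℝ} {K q : ℝ} (hq : -1 < q) (hT : 0 ≤ T)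
    (hc : ContinuousOn w (Ioc 0 T)) (hw : ∀ s ∈ Ioc 0 T, |w s| ≤ K * s ^ q) :
    IntegrableOn w (Ioc 0 T) := by
  have h1 : IntegrableOn (fun s : ℝ => K * s ^ q) (Ioc 0 T) :=
    ((intervalIntegrable_iff_integrableOn_Ioc_of_le hT).1
      (intervalIntegral.intervalIntegrable_rpow' hq)).const_mul _
  refine h1.mono' (hc.aestronglyMeasurable measurableSet_Ioc) ?_
  filter_upwards [ae_restrict_mem measurableSet_Ioc] with s hs
  exact hw s hs

open ProbabilityTheory in
-- A rescaled Beta density. It dominates the memory integrand, which is singular at both ends of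
-- `(0, t)`.
theorem intervalIntegrable_beta_scaled {p q t : ℝ} (hp : 0 < p) (hq : 0 < q) (ht : 0 < t) :
    IntervalIntegrable (fun s => s ^ (p - 1) * (t - s) ^ (q - 1)) volume 0 t := by
  have h1 : IntervalIntegrable (betaPDFReal p q) volume 0 1 := by
    rw [intervalIntegrable_iff_integrableOn_Ioo_of_le zero_le_one]
    exact (integrableOn_betaPDFReal hp hq).1
  have h2 := (h1.comp_mul_left (c := t⁻¹)).const_mul (beta p q * t ^ (p - 1) * t ^ (q - 1))
  rw [zero_div, one_div, inv_inv] at h2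
  rw [intervalIntegrable_iff_integrableOn_Ioo_of_le ht.le] at h2 ⊢
  refine h2.congr_fun (fun s hs => ?_) measurableSet_Ioo
  have hs0 : 0 < s := hs.1
  have hst : 0 < t - s := sub_pos.2 hs.2
  have hz0 : 0 < t⁻¹ * s := by positivity
  have e1 : 1 - t⁻¹ * s = t⁻¹ * (t - s) := by field_simp
  have hz1 : t⁻¹ * s < 1 := by
    have : 0 < t⁻¹ * (t - s) := by positivity
    linarith
  have hb := beta_pos hp hq
  simp only [betaPDFReal, if_pos (show 0 < t⁻¹ * s ∧ t⁻¹ * s < 1 from ⟨hz0, hz1⟩)]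
  rw [e1, Real.mul_rpow (inv_nonneg.2 ht.le) hs0.le, Real.mul_rpow (inv_nonneg.2 ht.le) hst.le,
    Real.inv_rpow ht.le, Real.inv_rpow ht.le]
  have := Real.rpow_pos_of_pos ht (p - 1)
  have := Real.rpow_pos_of_pos ht (q - 1)
  field_simp

theorem PowerBound.nonneg {v : ℝ → ℝ → ℝ → ℝ} {r : ℝ} (hT : 0 < T) (h : PowerBound D T C r v) :
    0 ≤ C := by
  have h1 := h D.lx D.ly T ⟨⟨le_rfl, D.hx.le⟩, ⟨le_rfl, D.hy.le⟩⟩ ⟨hT, le_rfl⟩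
  have h2 := Real.rpow_pos_of_pos hT r
  have h3 := (abs_nonneg _).trans h1
  exact nonneg_of_mul_nonneg_left h3 h2

theorem JointlyContinuous.time {v : ℝ → ℝ → ℝ → ℝ} {I : Set ℝ} {x y : ℝ}
    (h : JointlyContinuous D I v) (hp : (x, y) ∈ D.closed) : ContinuousOn (v x y) I :=
  ContinuousOn.comp (f := fun t : ℝ => ((x, y), t)) h (by fun_prop) fun _ ht => ⟨hp, ht⟩

theorem JointlyContinuous.space {v : ℝ → ℝ → ℝ → ℝ} {I : Set ℝ} {t : ℝ}
    (h : JointlyContinuous D I v) (ht : t ∈ I) :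
    ContinuousOn (fun p : ℝ × ℝ => v p.1 p.2 t) D.closed :=
  ContinuousOn.comp (f := fun p : ℝ × ℝ => (p, t)) h (by fun_prop) fun _ hp => ⟨hp, ht⟩

/-- The right-hand side `Δu + f(u)` of the equation. -/
noncomputable def forcing (D : Rectangle) (f : ℝ → ℝ) (u : ℝ → ℝ → ℝ → ℝ) (x y t : ℝ) : ℝ :=
  D.dx^[2] u x y t + D.dy^[2] u x y t + f (u x y t)

theorem continuousOn_memory (hT : 0 < T) (hα : IsAdmissibleExponent T Qα α)
    (h2 : RegularityA2 D T (α 0) C u) {t : ℝ} (ht : t ∈ Ioc 0 T) :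
    ContinuousOn (fun p : ℝ × ℝ => ∫ s in (0 : ℝ)..t, varKernel α (t - s) * (dt T)^[2] u p.1 p.2 s)
      D.closed := by
  obtain ⟨K, hK, hkc, hk⟩ := hα.exists_varKernel_le hT
  obtain ⟨h0, h1⟩ := hα.range 0 ⟨le_rfl, hT.le⟩
  have hmem : ∀ s ∈ Ioo 0 t, s ∈ Ioc 0 T ∧ t - s ∈ Ioc 0 T := fun s hs =>
    ⟨⟨hs.1, (hs.2.trans_le ht.2).le⟩, ⟨by linarith [hs.2], by linarith [hs.1, ht.2]⟩⟩
  have hsub : ∀ᵐ s : ℝ, s ∈ Set.uIoc 0 t → s ∈ Ioo 0 t := by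
    have : ∀ᵐ s : ℝ, s ≠ t := by simp [ae_iff]
    filter_upwards [this] with s hs hs'
    rw [uIoc_of_le ht.1.le] at hs'
    exact ⟨hs'.1, lt_of_le_of_ne hs'.2 hs⟩
  intro p hp
  refine intervalIntegral.continuousWithinAt_of_dominated_interval
    (bound := fun s => K * C * (s ^ ((α 0 - 1) - 1) * (t - s) ^ ((2 - α 0) - 1))) ?_ ?_ ?_ ?_
  · filter_upwards [self_mem_nhdsWithin] with q hq
    rw [uIoc_of_le ht.1.le, Measure.restrict_congr_set Ioo_ae_eq_Ioc.symm]
    refine ContinuousOn.aestronglyMeasurable ?_ measurableSet_Ioo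
    refine ContinuousOn.mul (hkc.comp (by fun_prop) fun s hs => (hmem s hs).2) ?_
    exact (h2.cont_tt.time hq).mono fun s hs => (hmem s hs).1
  · filter_upwards [self_mem_nhdsWithin] with q hq
    filter_upwards [hsub] with s hs hs'
    obtain ⟨hs1, hs2⟩ := hmem s (hs hs')
    rw [Real.norm_eq_abs, abs_mul]
    have e1 := hk _ hs2
    have e2 := h2.bound_tt q.1 q.2 s hq hs1
    rw [show (2 - α 0) - 1 = 1 - α 0 by ring, show α 0 - 1 - 1 = α 0 - 2 by ring]
    calc _ ≤ (K * (t - s) ^ (1 - α 0)) * (C * s ^ (α 0 - 2)) :=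
          mul_le_mul e1 e2 (abs_nonneg _) ((abs_nonneg _).trans e1)
      _ = _ := by ring
  · exact (intervalIntegrable_beta_scaled (by linarith) (by linarith) ht.1).const_mul _
  · filter_upwards [hsub] with s hs hs'
    exact continuousWithinAt_const.mul (h2.cont_tt.space (hmem s (hs hs')).1 p hp)

theorem RegularityA1.continuousOn_forcing_x (h : RegularityA1 D T (α 0) C u) (hf : Continuous f)
    {y t : ℝ} (hy : y ∈ Icc D.ly D.ry) (ht : t ∈ Ioc 0 T) :
    ContinuousOn (fun x => forcing D f u x y t) (Icc D.lx D.rx) := by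
  have ht' := Ioc_subset_Icc_self ht
  refine ContinuousOn.add (ContinuousOn.add (fun x hx => ?_) (h.continuousOn_dyy hy ht))
    (hf.comp_continuousOn fun x hx => ?_)
  · exact (h.chain_x hy ht' 2 (by norm_num) x hx).continuousWithinAt
  · exact (h.chain_x hy ht' 0 (by norm_num) x hx).continuousWithinAt

theorem RegularityA1.continuousOn_forcing_y (h : RegularityA1 D T (α 0) C u) (hf : Continuous f)
    {x t : ℝ} (hx : x ∈ Icc D.lx D.rx) (ht : t ∈ Ioc 0 T) :
    ContinuousOn (fun y => forcing D f u x y t) (Icc D.ly D.ry) := by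
  have ht' := Ioc_subset_Icc_self ht
  refine ContinuousOn.add (ContinuousOn.add (h.continuousOn_dxx hx ht) (fun y hy => ?_))
    (hf.comp_continuousOn fun y hy => ?_)
  · exact (h.chain_y hx ht' 2 (by norm_num) y hy).continuousWithinAt
  · exact (h.chain_y hx ht' 0 (by norm_num) y hy).continuousWithinAt

/-- The equation extends to the boundary of the rectangle. -/
theorem IsSolution.equation_closed (hT : 0 < T) (hα : IsAdmissibleExponent T Qα α)
    (hf : Continuous f) (h : IsSolution D T α f u₀ v₀ u) (h1 : RegularityA1 D T (α 0) C u)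
    (h2 : RegularityA2 D T (α 0) C u) {x y t : ℝ} (hp : (x, y) ∈ D.closed) (ht : t ∈ Ioc 0 T) :
    ∫ s in (0 : ℝ)..t, varKernel α (t - s) * (dt T)^[2] u x y s = forcing D f u x y t := by
  have hL := continuousOn_memory hT hα h2 ht
  have hLx : ∀ y ∈ Icc D.ly D.ry, ContinuousOn
      (fun x => ∫ s in (0 : ℝ)..t, varKernel α (t - s) * (dt T)^[2] u x y s) (Icc D.lx D.rx) :=
    fun y hy => hL.comp (f := fun x : ℝ => (x, y)) (by fun_prop) fun x hx => ⟨hx, hy⟩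
  have hLy : ∀ x ∈ Icc D.lx D.rx, ContinuousOn
      (fun y => ∫ s in (0 : ℝ)..t, varKernel α (t - s) * (dt T)^[2] u x y s) (Icc D.ly D.ry) :=
    fun x hx => hL.comp (f := fun y : ℝ => (x, y)) (by fun_prop) fun y hy => ⟨hx, hy⟩
  -- The extension is made first in `x` on interior lines, then in `y`; continuity of both sides in
  -- each variable separately is enough.
  have s1 : ∀ y ∈ Ioo D.ly D.ry, EqOn
      (fun x => ∫ s in (0 : ℝ)..t, varKernel α (t - s) * (dt T)^[2] u x y s)
      (fun x => forcing D f u x y t) (Icc D.lx D.rx) := fun y hy => by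
    have hy' := Ioo_subset_Icc_self hy
    refine EqOn.of_subset_closure (s := Ioo D.lx D.rx) (fun x hx => ?_) (hLx y hy')
      (h1.continuousOn_forcing_x hf hy' ht) Ioo_subset_Icc_self (closure_Ioo D.hx.ne).symm.subset
    have := h.equation x y t ⟨hx, hy⟩ ht
    simp only [forcing]
    linarith
  exact EqOn.of_subset_closure (s := Ioo D.ly D.ry) (fun y hy => s1 y hy hp.1) (hLy x hp.1)
    (h1.continuousOn_forcing_y hf hp.1 ht) Ioo_subset_Icc_self (closure_Ioo D.hy.ne).symm.subset
    hp.2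

theorem eq_zero_of_abs_le_rpow {w : ℝ → ℝ} {q : ℝ} (hT : 0 < T) (hq : 0 < q)
    (hc : ContinuousOn w (Icc 0 T)) (hw : ∀ s ∈ Ioc 0 T, |w s| ≤ C * s ^ q) : w 0 = 0 := by
  have h1 : Tendsto (fun s => |w s|) (𝓝[>] 0) (𝓝 |w 0|) := by
    have := (hc 0 ⟨le_rfl, hT.le⟩).abs
    refine this.mono_left ?_
    rw [nhdsWithin_Icc_eq_nhdsGE hT]
    exact nhdsWithin_mono _ Ioi_subset_Ici_self
  have h2 : Tendsto (fun s : ℝ => C * s ^ q) (𝓝[>] 0) (𝓝 (C * 0 ^ q)) :=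
    (((Real.continuous_rpow_const hq.le).tendsto 0).const_mul C).mono_left nhdsWithin_le_nhds
  rw [Real.zero_rpow hq.ne', mul_zero] at h2
  have h3 : |w 0| ≤ 0 := le_of_tendsto_of_tendsto h1 h2 (by
    filter_upwards [Ioc_mem_nhdsGT hT] with s hs using hw s hs)
  exact abs_eq_zero.1 (le_antisymm h3 (abs_nonneg _))

theorem hasDerivAt_of_mem_Ioo {w : ℝ → ℝ} {t : ℝ} (ht : t ∈ Ioo 0 T)
    (h : DifferentiableWithinAt ℝ w (Icc 0 T) t) : HasDerivAt w (derivWithin w (Icc 0 T) t) t :=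
  h.hasDerivWithinAt.hasDerivAt (Icc_mem_nhds ht.1 ht.2)

/-- The exponent `α₀ - 1` is positive, so the bound in (A1) forces zero initial velocity. This
removes the boundary term in the time integration and the load of the scheme. -/
theorem RegularityA1.dt_zero (hT : 0 < T) (hα : 1 < α 0) (h : RegularityA1 D T (α 0) C u) {x y : ℝ}
    (hp : (x, y) ∈ D.closed) : dt T u x y 0 = 0 :=
  eq_zero_of_abs_le_rpow hT (by linarith) (h.cont_t.time hp) fun s hs => h.bound_t x y s hp hs

theorem RegularityA1.continuousOn_forcing (hf : Continuous f) (h : RegularityA1 D T (α 0) C u)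
    {x y : ℝ} (hp : (x, y) ∈ D.closed) : ContinuousOn (forcing D f u x y) (Icc 0 T) :=
  ((ContinuousOn.add (fun t ht => (h.has_txx x y t hp ht).continuousWithinAt)
    fun t ht => (h.has_tyy x y t hp ht).continuousWithinAt)).add
    (hf.comp_continuousOn fun t ht => (h.has_t x y t hp ht).continuousWithinAt)

/-- The equation after convolution with the Abel kernel and integration in time. -/
theorem IsSolution.integrated_equation (hT : 0 < T) (hα : IsAdmissibleExponent T Qα α)
    (hf : Continuous f) (h : IsSolution D T α f u₀ v₀ u) (h1 : RegularityA1 D T (α 0) C u)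
    (h2 : RegularityA2 D T (α 0) C u) (hg : ContinuousOn (genIdentity α) (Icc 0 T)) {x y : ℝ}
    (hp : (x, y) ∈ D.closed) : ∀ t ∈ Icc 0 T,
    ∫ s in (0 : ℝ)..t, dt T u x y (t - s) * genIdentity α s
      = ∫ s in (0 : ℝ)..t, abelPrimitive (α 0 - 1) (t - s) * forcing D f u x y s := by
  obtain ⟨hα0, hα1⟩ := hα.range 0 ⟨le_rfl, hT.le⟩
  obtain ⟨K, hK, hkc, hk⟩ := hα.exists_varKernel_le hT
  refine conv_primitive_eq hT (by linarith) (k := varKernel α) (w := (dt T)^[2] u x y)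
    (integrableOn_of_abs_le_rpow (by linarith) hT.le hkc hk)
    (integrableOn_of_abs_le_rpow (by linarith) hT.le (h2.cont_tt.time hp)
      fun s hs => h2.bound_tt x y s hp hs) (h1.cont_t.time hp) (h1.dt_zero hT hα0 hp)
    (fun t ht => hasDerivAt_of_mem_Ioo ht (h2.has_tt x y t hp (Ioo_subset_Ioc_self ht)))
    (h1.continuousOn_forcing hf hp) hg (fun t ht => h.equation_closed hT hα hf h1 h2 hp ht)
    (fun t ht => ?_)
  rw [genIdentity, if_neg ht.1.ne']

end

end DiffusionWave

/-! ### The integrated equation on the time grid. -/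

namespace DiffusionWave
open MeasureTheory

section
variable {T Qα Qf Qg C Kf a τ : ℝ} {α f B φ v U : ℝ → ℝ} {u₀ v₀ : ℝ → ℝ → ℝ} {D : Rectangle}
  {u : ℝ → ℝ → ℝ → ℝ}

/-- Cauchy's mean value theorem against `r^q / q`. It allows a derivative that is singular at `0`
and needs no integrability of `h'`. -/
theorem abs_sub_le_of_deriv_le_rpow {h h' : ℝ → ℝ} {K q s t : ℝ} (hq : 0 < q) (hs : 0 ≤ s)
    (hst : s ≤ t) (hc : ContinuousOn h (Icc s t)) (hd : ∀ r ∈ Ioo s t, HasDerivAt h (h' r) r)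
    (hb : ∀ r ∈ Ioo s t, |h' r| ≤ K * r ^ (q - 1)) :
    |h t - h s| ≤ K / q * t ^ q - K / q * s ^ q := by
  rcases hst.eq_or_lt with rfl | hst
  · simp
  obtain ⟨c, hc, e⟩ := exists_ratio_hasDerivAt_eq_ratio_slope h h' hst hc hd
    (fun r => r ^ q / q) (fun r => r ^ (q - 1))
    (((Real.continuous_rpow_const hq.le).div_const q).continuousOn) fun r hr => by
      have := (Real.hasDerivAt_rpow_const (p := q) (Or.inl (hs.trans_lt hr.1).ne')).div_const q
      exact this.congr_deriv (by field_simp)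
  have hc0 : 0 < c := hs.trans_lt hc.1
  have hp := Real.rpow_pos_of_pos hc0 (q - 1)
  have hm : 0 ≤ t ^ q / q - s ^ q / q := by
    have := Real.rpow_le_rpow hs hst.le hq.le
    have : s ^ q / q ≤ t ^ q / q := by gcongr
    linarith
  have h1 : |h t - h s| * c ^ (q - 1) ≤ (t ^ q / q - s ^ q / q) * K * c ^ (q - 1) := by
    rw [← abs_of_pos hp, ← abs_mul, abs_of_pos hp, ← e, abs_mul, abs_of_nonneg hm, mul_assoc]
    exact mul_le_mul_of_nonneg_left (hb c hc) hm
  have := le_of_mul_le_mul_right h1 hp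
  calc _ ≤ _ := this
    _ = _ := by ring

theorem monotoneOn_const_mul_rpow {K q : ℝ} (hK : 0 ≤ K) (hq : 0 ≤ q) :
    MonotoneOn (fun t : ℝ => K * t ^ q) (Ici 0) := fun _ hs _ _ hst =>
  mul_le_mul_of_nonneg_left (Real.rpow_le_rpow hs hst hq) hK

/-- The convolution at a grid point is the product trapezoidal sum up to `trapSum`. -/
theorem conv_eq_trapSum {n N : ℕ} (hτ : 0 < τ) (hn : n ≤ N) (hN : N * τ ≤ T)
    (hB : ContinuousOn B (Icc 0 T)) (hφ : ContinuousOn φ (Icc 0 T)) :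
    ∫ s in (0 : ℝ)..(n * τ), B (n * τ - s) * φ s = trapSum τ B φ n
      + ∑ j ∈ Finset.range n, (∫ r in (0 : ℝ)..τ, B (((n - 1 - j : ℕ) : ℝ) * τ + r))
        * ((φ (((j : ℝ) + 1) * τ) + φ (j * τ)) / 2) := by
  have hnT : n * τ ≤ T := le_trans (by gcongr) hN
  have hF : ContinuousOn (fun s => B (n * τ - s) * φ s) (Icc 0 (n * τ)) :=
    (hB.comp (by fun_prop) fun s hs => ⟨by linarith [hs.2], by linarith [hs.1]⟩).mul
      (hφ.mono (Icc_subset_Icc_right hnT))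
  have hmem : ∀ j < n, ∀ r ∈ Icc (0 : ℝ) τ, ((n - 1 - j : ℕ) : ℝ) * τ + r ∈ Icc 0 T :=
    fun j hj r hr => mem_cell (j := n - 1 - j) (N := N) hτ (by omega) hN
      ⟨by linarith [hr.1], by linarith [hr.2]⟩
  have h1 : ∫ s in (0 : ℝ)..(n * τ), B (n * τ - s) * φ s
      = ∑ j ∈ Finset.range n, ∫ s in (j * τ)..(((j : ℝ) + 1) * τ), B (n * τ - s) * φ s := by
    have := intervalIntegral.sum_integral_adjacent_intervals (μ := volume)
      (f := fun s => B (n * τ - s) * φ s) (a := fun k : ℕ => (k : ℝ) * τ) (n := n) fun k hk => by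
        refine (hF.mono ?_).intervalIntegrable
        have hk' : ((k + 1 : ℕ) : ℝ) ≤ n := by exact_mod_cast hk
        have h0 : (0 : ℝ) ≤ k * τ := by positivity
        have h2 : (k : ℝ) * τ ≤ ((k + 1 : ℕ) : ℝ) * τ := by push_cast; nlinarith
        rw [uIcc_of_le h2]
        exact Icc_subset_Icc h0 (by gcongr)
    simp only [Nat.cast_add, Nat.cast_one, Nat.cast_zero, zero_mul] at this
    exact this.symm
  rw [h1, trapSum, ← Finset.sum_add_distrib]
  refine Finset.sum_congr rfl fun j hj => ?_
  rw [Finset.mem_range] at hj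
  have hcast : ((n - 1 - j : ℕ) : ℝ) = n - 1 - j := by
    rw [Nat.cast_sub (by omega), Nat.cast_sub (by omega), Nat.cast_one]
  have h2 := intervalIntegral.integral_comp_sub_left (fun s => B (n * τ - s) * φ s)
    (((j : ℝ) + 1) * τ) (a := 0) (b := τ)
  rw [sub_zero, show ((j : ℝ) + 1) * τ - τ = j * τ by ring] at h2
  rw [← h2, ← intervalIntegral.integral_mul_const, ← intervalIntegral.integral_add]
  · refine intervalIntegral.integral_congr fun r _ => ?_
    simp only [cellDev, hcast]
    rw [show n * τ - ((j + 1) * τ - r) = (n - 1 - j) * τ + r by ring]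
    ring
  · refine ContinuousOn.intervalIntegrable ?_
    rw [uIcc_of_le hτ.le]
    exact (hB.comp (by fun_prop) (hmem j hj)).mul
      (continuousOn_cellDev hτ (lt_of_lt_of_le hj hn) hN hφ)
  · refine ContinuousOn.intervalIntegrable ?_
    rw [uIcc_of_le hτ.le]
    exact (hB.comp (by fun_prop) (hmem j hj)).mul continuousOn_const

theorem genIdentity_zero : genIdentity α 0 = 1 := by simp [genIdentity]

/-- Origin of the coefficients of the scheme: the mean of `g` on the first cell is `(1 + g(τ)) / 2 =
1 + w_0 / 2 = c_0`, and consecutive cell means differ by `w̃`. -/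
theorem sum_mul_trapezoid_succ_sub (n : ℕ) (d : ℕ → ℝ) :
    ∑ j ∈ Finset.range (n + 1), d (n - j)
        * ((genIdentity α (((j : ℝ) + 1) * τ) + genIdentity α (j * τ)) / 2)
      - ∑ j ∈ Finset.range n, d (n - 1 - j)
        * ((genIdentity α (((j : ℝ) + 1) * τ) + genIdentity α (j * τ)) / 2)
      = leadCoeff α τ * d n
        + ∑ k ∈ Finset.Icc 1 n, gWeightTilde α τ (n + 1 - k) * d (k - 1) := by
  set G : ℕ → ℝ := fun j => (genIdentity α (((j : ℝ) + 1) * τ) + genIdentity α (j * τ)) / 2 with hG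
  have e1 : ∑ j ∈ Finset.range (n + 1), d (n - j) * G j
      = ∑ m ∈ Finset.range (n + 1), d m * G (n - m) := by
    rw [← Finset.sum_range_reflect]
    refine Finset.sum_congr rfl fun j hj => ?_
    rw [Finset.mem_range] at hj
    rw [show n - (n + 1 - 1 - j) = j by omega, show n + 1 - 1 - j = n - j by omega]
  have e2 : ∑ j ∈ Finset.range n, d (n - 1 - j) * G j
      = ∑ m ∈ Finset.range n, d m * G (n - 1 - m) := by
    rw [← Finset.sum_range_reflect]
    refine Finset.sum_congr rfl fun j hj => ?_
    rw [Finset.mem_range] at hj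
    rw [show n - 1 - (n - 1 - j) = j by omega]
  have e3 : ∑ k ∈ Finset.Icc 1 n, gWeightTilde α τ (n + 1 - k) * d (k - 1)
      = ∑ m ∈ Finset.range n, gWeightTilde α τ (n - m) * d m := by
    rw [← Finset.Ico_add_one_right_eq_Icc, Finset.sum_Ico_eq_sum_range]
    refine Finset.sum_congr (by simp) fun m _ => ?_
    rw [show n + 1 - (1 + m) = n - m by omega, show 1 + m - 1 = m by omega]
  rw [e1, e2, e3, Finset.sum_range_succ, add_sub_right_comm, ← Finset.sum_sub_distrib, add_comm]
  congr 1
  · rw [Nat.sub_self, hG, leadCoeff, gWeight]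
    simp only [Nat.cast_zero, zero_mul, genIdentity_zero]
    ring
  · refine Finset.sum_congr rfl fun m hm => ?_
    rw [Finset.mem_range] at hm
    obtain ⟨p, hp⟩ : ∃ p, n - m = p + 1 := ⟨n - m - 1, by omega⟩
    rw [show n - 1 - m = p by omega, hp, gWeightTilde, gWeight, gWeight, Nat.add_sub_cancel]
    simp only [hG, Nat.cast_add, Nat.cast_one]
    ring

/-- The integrated equation at two consecutive grid points. -/
theorem discrete_equation {n N : ℕ} (ha : 0 < a) (hτ : 0 < τ) (hn : n < N) (hN : N * τ ≤ T)
    (hv : ContinuousOn v (Icc 0 T)) (hφ : ContinuousOn φ (Icc 0 T))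
    (hg : ContinuousOn (genIdentity α) (Icc 0 T))
    (hU : ContinuousOn U (Icc 0 T)) (hUv : ∀ t ∈ Ioo 0 T, HasDerivAt U (v t) t)
    (he : ∀ t ∈ Icc 0 T, ∫ s in (0 : ℝ)..t, v (t - s) * genIdentity α s
      = ∫ s in (0 : ℝ)..t, abelPrimitive a (t - s) * φ s) :
    leadCoeff α τ * (U ((n + 1 : ℕ) * τ) - U (n * τ))
        + ∑ k ∈ Finset.Icc 1 n, gWeightTilde α τ (n + 1 - k) * (U (k * τ) - U ((k - 1 : ℕ) * τ))
      = τ * ∑ j ∈ Finset.Icc 1 (n + 1),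
          piWeight a τ (n + 1) j * ((φ (j * τ) + φ ((j - 1 : ℕ) * τ)) / 2)
        + (trapSum τ (abelPrimitive a) φ (n + 1) - trapSum τ (abelPrimitive a) φ n)
        - (trapSum τ v (genIdentity α) (n + 1) - trapSum τ v (genIdentity α) n) := by
  have hmemN : ∀ m : ℕ, m ≤ N → (m : ℝ) * τ ∈ Icc 0 T := fun m hm =>
    ⟨by positivity, le_trans (by gcongr) hN⟩
  have hB : ContinuousOn (abelPrimitive a) (Icc 0 T) := (continuous_abelPrimitive ha).continuousOn
  have hcell : ∀ m : ℕ, m < N → ∫ r in (0 : ℝ)..τ, v (m * τ + r)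
      = U (((m + 1 : ℕ) : ℝ) * τ) - U (m * τ) := fun m hm => by
    have h1 := (hmemN m hm.le).1
    have h2 := (hmemN (m + 1) hm).2
    have h3 : (m : ℝ) * τ ≤ ((m + 1 : ℕ) : ℝ) * τ := by push_cast; nlinarith
    rw [intervalIntegral.integral_comp_add_left v, add_zero,
      show (m : ℝ) * τ + τ = ((m + 1 : ℕ) : ℝ) * τ by push_cast; ring]
    refine intervalIntegral.integral_eq_sub_of_hasDerivAt_of_le h3
      (hU.mono (Icc_subset_Icc h1 h2)) (fun t ht => hUv t ⟨h1.trans_lt ht.1, ht.2.trans_le h2⟩) ?_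
    refine (hv.mono ?_).intervalIntegrable
    rw [uIcc_of_le h3]
    exact Icc_subset_Icc h1 h2
  -- The product rule on both sides: exact integration of `v` gives the increments of `U`, and that
  -- of the Abel primitive gives `cellWeight`. The claim is the difference of the levels `n + 1` and
  -- `n`.
  have key : ∀ m : ℕ, m ≤ N →
      trapSum τ v (genIdentity α) m + ∑ j ∈ Finset.range m,
        (fun i : ℕ => U (((i + 1 : ℕ) : ℝ) * τ) - U (i * τ)) (m - 1 - j)
          * ((genIdentity α (((j : ℝ) + 1) * τ) + genIdentity α (j * τ)) / 2)
      = trapSum τ (abelPrimitive a) φ m + ∑ j ∈ Finset.range m, cellWeight a τ (m - 1 - j)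
        * ((φ (((j : ℝ) + 1) * τ) + φ (j * τ)) / 2) := fun m hm => by
    have := he (m * τ) (hmemN m hm)
    rw [conv_eq_trapSum hτ hm hN hv hg, conv_eq_trapSum hτ hm hN hB hφ] at this
    refine Eq.trans ?_ this
    congr 1
    refine Finset.sum_congr rfl fun j hj => ?_
    rw [Finset.mem_range] at hj
    rw [hcell _ (by omega)]
  have k1 := key (n + 1) hn
  have k0 := key n hn.le
  have hS := sum_mul_trapezoid_succ_sub (α := α) (τ := τ) n
    (fun i : ℕ => U (((i + 1 : ℕ) : ℝ) * τ) - U (i * τ))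
  have hP := sum_piWeight_mul ha hτ n (fun j => (φ (j * τ) + φ ((j - 1 : ℕ) * τ)) / 2)
  simp only [Nat.add_sub_cancel, Nat.cast_add, Nat.cast_one] at k1 k0 hS hP ⊢
  have e : ∑ k ∈ Finset.Icc 1 n, gWeightTilde α τ (n + 1 - k) * (U (k * τ) - U ((k - 1 : ℕ) * τ))
      = ∑ k ∈ Finset.Icc 1 n, gWeightTilde α τ (n + 1 - k)
        * (U (((k - 1 : ℕ) + 1) * τ) - U ((k - 1 : ℕ) * τ)) := by
    refine Finset.sum_congr rfl fun k hk => ?_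
    rw [Finset.mem_Icc] at hk
    rw [Nat.cast_sub hk.1, Nat.cast_one, sub_add_cancel]
  rw [e]
  linarith

end

end DiffusionWave

/-! ### Constants and variation bounds for the truncation error in time. -/

namespace DiffusionWave
open MeasureTheory

section
variable {T Qα Qf Qg C Kf a τ : ℝ} {α f : ℝ → ℝ} {u₀ v₀ : ℝ → ℝ → ℝ} {D : Rectangle}
  {u : ℝ → ℝ → ℝ → ℝ}

/-- The primitive `K t^a / a` of `K t^(a-1)`. -/
noncomputable def powVar (K a t : ℝ) : ℝ := K / a * t ^ a

theorem powVar_zero (K : ℝ) (ha : 0 < a) : powVar K a 0 = 0 := by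
  rw [powVar, Real.zero_rpow ha.ne', mul_zero]

theorem powVar_mono {K : ℝ} (hK : 0 ≤ K) (ha : 0 < a) : MonotoneOn (powVar K a) (Ici 0) :=
  monotoneOn_const_mul_rpow (div_nonneg hK ha.le) ha.le

/-- A constant with `|g''(t)| ≤ K t^(-1/2)`. -/
noncomputable def kernelConst (T Qg : ℝ) : ℝ := Qg * (3 + (T + 1) * T ^ (1 / 2 : ℝ))

/-- A bound for the time derivative of the right-hand side. -/
noncomputable def forcingLip (T a Qf C : ℝ) : ℝ := (2 * C + Qf * C) * T ^ a

/-- A constant such that the second time derivative of the right-hand side is at most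
`K t^(a-1)`. -/
noncomputable def forcingConst (T a Qf C Kf : ℝ) : ℝ := 2 * C + Qf * C + Kf * C ^ 2 * T ^ (a + 1)

/-- A bound for the truncation error in time at the level `n`. -/
noncomputable def truncBound (T a Qg Qf C Kf τ : ℝ) (n : ℕ) : ℝ :=
  (trapBound τ (abelPrimitive a) (powVar (forcingConst T a Qf C Kf) a) (forcingLip T a Qf C) (n - 1)
    + trapBound τ (powVar C a) (powVar (kernelConst T Qg) (1 / 2)) Qg (n - 1)) / τ
  + piWeight a τ n 1 * (τ * forcingLip T a Qf C / 2)

/-- The constant in the bound for the accumulated truncation error. -/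
noncomputable def truncConst (T a Qg Qf C Kf : ℝ) : ℝ :=
  abelPrimitive a T * (3 * powVar (forcingConst T a Qf C Kf) a (2 * T) + forcingLip T a Qf C)
    + powVar C a T * (3 * powVar (kernelConst T Qg) (1 / 2) (2 * T) + Qg)
    + abelPrimitive a T * (forcingLip T a Qf C / 2)

theorem kernelConst_nonneg (hT : 0 ≤ T) (hQg : 0 ≤ Qg) : 0 ≤ kernelConst T Qg := by
  unfold kernelConst; positivity

theorem forcingLip_nonneg (hT : 0 ≤ T) (hQf : 0 ≤ Qf) (hC : 0 ≤ C) : 0 ≤ forcingLip T a Qf C := by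
  unfold forcingLip; positivity

theorem forcingConst_nonneg (hT : 0 ≤ T) (hQf : 0 ≤ Qf) (hC : 0 ≤ C) (hKf : 0 ≤ Kf) :
    0 ≤ forcingConst T a Qf C Kf := by
  unfold forcingConst; positivity

theorem truncBound_nonneg (hT : 0 ≤ T) (ha : 0 < a) (hQg : 0 ≤ Qg) (hQf : 0 ≤ Qf) (hC : 0 ≤ C)
    (hKf : 0 ≤ Kf) (hτ : 0 < τ) {n : ℕ} (hn : 1 ≤ n) : 0 ≤ truncBound T a Qg Qf C Kf τ n := by
  have h1 := trapBound_nonneg hτ (abelPrimitive_mono ha)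
    (powVar_mono (forcingConst_nonneg (a := a) hT hQf hC hKf) ha)
    (forcingLip_nonneg (a := a) hT hQf hC) (n - 1)
  have h2 := trapBound_nonneg hτ (powVar_mono hC ha)
    (powVar_mono (kernelConst_nonneg hT hQg) (one_half_pos (α := ℝ))) hQg (n - 1)
  have h3 := piWeight_nonneg ha hτ le_rfl hn
  have h4 := forcingLip_nonneg (a := a) hT hQf hC
  unfold truncBound
  positivity

/-- The weights of the first cell telescope in `n`. Their sum times `τ` is `O(τ)`, so an `O(τ)`
error on the first cell costs only `O(τ²)` in total. -/
theorem sum_piWeight_first (ha : 0 < a) (hτ : 0 < τ) (N : ℕ) :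
    τ * ∑ n ∈ Finset.Icc 1 (N + 1), piWeight a τ n 1 = cellWeight a τ N := by
  induction N with
  | zero =>
    rw [Finset.Icc_self, Finset.sum_singleton, piWeight_self ha hτ le_rfl]
    field_simp
  | succ N ih =>
    rw [Finset.sum_Icc_succ_top (by omega), mul_add, ih, piWeight_lt ha hτ le_rfl (by omega)]
    simp only [Nat.add_sub_cancel]
    field_simp
    ring

theorem sum_truncBound_le (ha : 0 < a) (hQg : 0 ≤ Qg) (hQf : 0 ≤ Qf) (hC : 0 ≤ C)
    (hKf : 0 ≤ Kf) (hτ : 0 < τ) {N : ℕ} (hN : 0 < N) (hNT : N * τ = T) :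
    ∑ n ∈ Finset.Icc 1 N, τ * truncBound T a Qg Qf C Kf τ n
      ≤ τ ^ 2 * truncConst T a Qg Qf C Kf := by
  obtain ⟨M, rfl⟩ : ∃ M, N = M + 1 := ⟨N - 1, by omega⟩
  have hT : 0 < T := by rw [← hNT]; positivity
  have hF := forcingConst_nonneg (a := a) hT.le hQf hC hKf
  have hL := forcingLip_nonneg (a := a) hT.le hQf hC
  have hG := kernelConst_nonneg hT.le hQg
  -- The extra cell beyond `T` in `sum_trapBound_le` is covered by `2 * T`, since `τ ≤ T`.
  have h2T : ((M + 1 : ℕ) + 1 : ℝ) * τ ≤ 2 * T := by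
    rw [← hNT]
    have : (1 : ℝ) ≤ (M + 1 : ℕ) := by exact_mod_cast hN
    nlinarith
  have h0 : (0 : ℝ) ≤ ((M + 1 : ℕ) + 1 : ℝ) * τ := by positivity
  have s1 := sum_trapBound_le (M := forcingLip T a Qf C) (N := M + 1) hτ (abelPrimitive_mono ha)
    (powVar_mono hF ha)
  have s2 := sum_trapBound_le (M := Qg) (N := M + 1) hτ (powVar_mono hC ha)
    (powVar_mono hG (one_half_pos (α := ℝ)))
  rw [hNT, abelPrimitive_zero ha, powVar_zero _ ha, sub_zero, sub_zero] at s1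
  rw [hNT, powVar_zero _ ha, powVar_zero _ one_half_pos, sub_zero, sub_zero] at s2
  have m1 := powVar_mono hF ha h0 (h0.trans h2T) h2T
  have m2 := powVar_mono hG (one_half_pos (α := ℝ)) h0 (h0.trans h2T) h2T
  have b0 := abelPrimitive_nonneg ha hT.le
  have c0 : 0 ≤ powVar C a T := by
    have := powVar_mono hC ha (mem_Ici.2 le_rfl) (mem_Ici.2 hT.le) hT.le
    rwa [powVar_zero _ ha] at this
  have hw : τ * ∑ n ∈ Finset.Icc 1 (M + 1), piWeight a τ n 1 ≤ τ * abelPrimitive a T := by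
    rw [sum_piWeight_first ha hτ]
    exact cellWeight_le ha hτ (by rw [← hNT]; push_cast; exact le_rfl)
  have e : ∑ n ∈ Finset.Icc 1 (M + 1), τ * truncBound T a Qg Qf C Kf τ n
      = ∑ n ∈ Finset.range (M + 1), trapBound τ (abelPrimitive a)
          (powVar (forcingConst T a Qf C Kf) a) (forcingLip T a Qf C) n
        + ∑ n ∈ Finset.range (M + 1), trapBound τ (powVar C a) (powVar (kernelConst T Qg) (1 / 2)) Qg n
        + (τ * ∑ n ∈ Finset.Icc 1 (M + 1), piWeight a τ n 1) * (τ * forcingLip T a Qf C / 2) := by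
    have r : ∀ F : ℕ → ℝ, ∑ n ∈ Finset.Icc 1 (M + 1), F (n - 1) = ∑ n ∈ Finset.range (M + 1), F n :=
      fun F => by
        rw [← Finset.Ico_add_one_right_eq_Icc, Finset.sum_Ico_eq_sum_range]
        exact Finset.sum_congr (by simp) fun m _ => by rw [Nat.add_sub_cancel_left]
    rw [← r, ← r, Finset.mul_sum, Finset.sum_mul, ← Finset.sum_add_distrib,
      ← Finset.sum_add_distrib]
    refine Finset.sum_congr rfl fun n _ => ?_
    unfold truncBound
    field_simp
  rw [e]
  have h3 : (τ * ∑ n ∈ Finset.Icc 1 (M + 1), piWeight a τ n 1) * (τ * forcingLip T a Qf C / 2)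
      ≤ τ * abelPrimitive a T * (τ * forcingLip T a Qf C / 2) := by gcongr
  have h1 : τ ^ 2 * (abelPrimitive a T * (3 * powVar (forcingConst T a Qf C Kf) a
        (((M + 1 : ℕ) + 1 : ℝ) * τ) + forcingLip T a Qf C))
      ≤ τ ^ 2 * (abelPrimitive a T * (3 * powVar (forcingConst T a Qf C Kf) a (2 * T)
        + forcingLip T a Qf C)) := by gcongr
  have h2 : τ ^ 2 * (powVar C a T * (3 * powVar (kernelConst T Qg) (1 / 2)
        (((M + 1 : ℕ) + 1 : ℝ) * τ) + Qg))
      ≤ τ ^ 2 * (powVar C a T * (3 * powVar (kernelConst T Qg) (1 / 2) (2 * T) + Qg)) := by gcongr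
  unfold truncConst
  calc _ ≤ _ := add_le_add (add_le_add (s1.trans h1) (s2.trans h2)) h3
    _ = _ := by ring

/-- The logarithm is traded for the integrable power `t^(-1/2)`, so that `g'` has a variation
function of the same power type as the other factors. -/
theorem abs_log_add_one_le {t : ℝ} (ht : t ∈ Ioc 0 T) :
    |Real.log t| + 1 ≤ (3 + (T + 1) * T ^ (1 / 2 : ℝ)) * t ^ (1 / 2 - 1 : ℝ) := by
  have ht0 : 0 < t := ht.1
  have hT : 0 < T := ht0.trans_le ht.2
  have hp := Real.rpow_pos_of_pos ht0 (1 / 2 : ℝ)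
  have hP := Real.rpow_pos_of_pos hT (1 / 2 : ℝ)
  have hpm := Real.rpow_pos_of_pos ht0 (1 / 2 - 1 : ℝ)
  have e : t ^ (1 / 2 - 1 : ℝ) = (t ^ (1 / 2 : ℝ))⁻¹ := by
    rw [← Real.rpow_neg ht0.le]; norm_num
  rw [e, ← div_eq_mul_inv, le_div_iff₀ hp, add_mul, one_mul]
  rcases le_or_gt t 1 with h1 | h1
  · have h2 := Real.abs_log_mul_self_rpow_lt t (1 / 2) ht0 h1 (by norm_num)
    rw [abs_mul, abs_of_pos hp] at h2
    have h3 : t ^ (1 / 2 : ℝ) ≤ 1 := Real.rpow_le_one ht0.le h1 (by norm_num)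
    have : 0 ≤ (T + 1) * T ^ (1 / 2 : ℝ) := by positivity
    norm_num at h2 ⊢
    norm_num at h3 this
    linarith
  · have h2 : |Real.log t| ≤ T := by
      rw [abs_of_nonneg (Real.log_nonneg h1.le)]
      linarith [Real.log_le_sub_one_of_pos ht0, ht.2]
    have h3 : t ^ (1 / 2 : ℝ) ≤ T ^ (1 / 2 : ℝ) := Real.rpow_le_rpow ht0.le ht.2 (by norm_num)
    have h4 : |Real.log t| * t ^ (1 / 2 : ℝ) ≤ T * T ^ (1 / 2 : ℝ) :=
      mul_le_mul h2 h3 hp.le hT.le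
    linarith

theorem IsKernelConstant.nonneg (hT : 0 ≤ T) (h : IsKernelConstant T α Qg) : 0 ≤ Qg :=
  (abs_nonneg _).trans (h.bound_zero 0 ⟨le_rfl, hT⟩)

theorem IsKernelConstant.abs_deriv_sub_le (hT : 0 ≤ T) (h : IsKernelConstant T α Qg) {s t : ℝ}
    (hs : 0 < s) (hst : s ≤ t) (ht : t < T) :
    |derivWithin (genIdentity α) (Icc 0 T) t - derivWithin (genIdentity α) (Icc 0 T) s|
      ≤ powVar (kernelConst T Qg) (1 / 2) t - powVar (kernelConst T Qg) (1 / 2) s := by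
  have hsub : ∀ r ∈ Icc s t, r ∈ Ioo 0 T := fun r hr => ⟨hs.trans_le hr.1, hr.2.trans_lt ht⟩
  have hd : ∀ r ∈ Icc s t, HasDerivAt (derivWithin (genIdentity α) (Icc 0 T))
      (derivWithin (derivWithin (genIdentity α) (Icc 0 T)) (Icc 0 T) r) r := fun r hr =>
    hasDerivAt_of_mem_Ioo (hsub r hr) (h.diff_two r (Ioo_subset_Ioc_self (hsub r hr)))
  refine abs_sub_le_of_deriv_le_rpow (by norm_num) hs.le hst
    (fun r hr => (hd r hr).continuousAt.continuousWithinAt)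
    (fun r hr => hd r (Ioo_subset_Icc_self hr)) fun r hr => ?_
  have hr' := Ioo_subset_Ioc_self (hsub r (Ioo_subset_Icc_self hr))
  refine (h.bound_two r hr').trans ?_
  rw [kernelConst, mul_assoc]
  exact mul_le_mul_of_nonneg_left (abs_log_add_one_le hr') (h.nonneg hT)

/-- The time derivative of the right-hand side. -/
noncomputable def forcingDeriv (D : Rectangle) (T : ℝ) (f : ℝ → ℝ) (u : ℝ → ℝ → ℝ → ℝ)
    (x y t : ℝ) : ℝ :=
  dt T (D.dx^[2] u) x y t + dt T (D.dy^[2] u) x y t + deriv f (u x y t) * dt T u x y t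

theorem IsAdmissibleSource.hasDerivAt (hf : IsAdmissibleSource Qf f) (v : ℝ) :
    HasDerivAt f (deriv f v) v :=
  ((hf.smooth.differentiable (by norm_num)) v).hasDerivAt

theorem IsAdmissibleSource.hasDerivAt_deriv (hf : IsAdmissibleSource Qf f) (v : ℝ) :
    HasDerivAt (deriv f) (iteratedDeriv 2 f v) v := by
  have h := (hf.smooth.differentiable_iteratedDeriv 1 (by norm_num)) v
  rw [iteratedDeriv_one] at h
  rw [iteratedDeriv_succ, iteratedDeriv_one]
  exact h.hasDerivAt

theorem IsAdmissibleSource.nonneg (hf : IsAdmissibleSource Qf f) : 0 ≤ Qf :=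
  (abs_nonneg _).trans (hf.bound 0)

theorem hasDerivAt_forcing (hf : IsAdmissibleSource Qf f) (h1 : RegularityA1 D T (α 0) C u)
    {x y t : ℝ} (hp : (x, y) ∈ D.closed) (ht : t ∈ Ioo 0 T) :
    HasDerivAt (forcing D f u x y) (forcingDeriv D T f u x y t) t := by
  have ht' := Ioo_subset_Icc_self ht
  have hu : HasDerivAt (u x y) (dt T u x y t) t := hasDerivAt_of_mem_Ioo ht (h1.has_t x y t hp ht')
  exact ((hasDerivAt_of_mem_Ioo ht (h1.has_txx x y t hp ht')).add
    (hasDerivAt_of_mem_Ioo ht (h1.has_tyy x y t hp ht'))).add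
    ((hf.hasDerivAt (u x y t)).comp t hu)

theorem abs_forcingDeriv_le (hf : IsAdmissibleSource Qf f) (ha : α 0 - 1 = a) (ha0 : 0 < a)
    (hT : 0 < T) (h1 : RegularityA1 D T (α 0) C u) {x y t : ℝ} (hp : (x, y) ∈ D.closed)
    (ht : t ∈ Ioo 0 T) : |forcingDeriv D T f u x y t| ≤ forcingLip T a Qf C := by
  have ht' := Ioo_subset_Ioc_self ht
  have hC := h1.bound_t.nonneg hT
  have hQ := hf.nonneg
  have b1 := h1.bound_txx x y t hp ht'
  have b2 := h1.bound_tyy x y t hp ht'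
  have b3 := h1.bound_t x y t hp ht'
  rw [ha] at b1 b2 b3
  have b4 : |deriv f (u x y t) * dt T u x y t| ≤ Qf * (C * t ^ a) := by
    rw [abs_mul]
    exact mul_le_mul (hf.bound _) b3 (abs_nonneg _) hQ
  have hpw : t ^ a ≤ T ^ a := Real.rpow_le_rpow ht.1.le ht.2.le ha0.le
  unfold forcingDeriv forcingLip
  calc _ ≤ |dt T (D.dx^[2] u) x y t| + |dt T (D.dy^[2] u) x y t|
        + |deriv f (u x y t) * dt T u x y t| := abs_add_three _ _ _
    _ ≤ C * t ^ a + C * t ^ a + Qf * (C * t ^ a) := add_le_add (add_le_add b1 b2) b4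
    _ = (2 * C + Qf * C) * t ^ a := by ring
    _ ≤ _ := by gcongr

/-- The second derivative of `φ` contains `f''(u) (∂_t u)²`, of size `r^(2a) = r^(a+1) r^(a-1)`; the
bounded factor goes into the constant, and all terms are `O(r^(a-1))`. -/
theorem abs_forcingDeriv_sub_le (hf : IsAdmissibleSource Qf f) (ha : α 0 - 1 = a) (ha0 : 0 < a)
    (hT : 0 < T) (h1 : RegularityA1 D T (α 0) C u) (h2 : RegularityA2 D T (α 0) C u) {x y : ℝ}
    (hp : (x, y) ∈ D.closed) (hK : ∀ t ∈ Icc 0 T, |iteratedDeriv 2 f (u x y t)| ≤ Kf) {s t : ℝ}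
    (hs : 0 < s) (hst : s ≤ t) (ht : t < T) :
    |forcingDeriv D T f u x y t - forcingDeriv D T f u x y s|
      ≤ powVar (forcingConst T a Qf C Kf) a t - powVar (forcingConst T a Qf C Kf) a s := by
  have hsub : ∀ r ∈ Icc s t, r ∈ Ioo 0 T := fun r hr => ⟨hs.trans_le hr.1, hr.2.trans_lt ht⟩
  have hd : ∀ r ∈ Icc s t, HasDerivAt (forcingDeriv D T f u x y)
      ((dt T)^[2] (D.dx^[2] u) x y r + (dt T)^[2] (D.dy^[2] u) x y r
        + (iteratedDeriv 2 f (u x y r) * dt T u x y r * dt T u x y r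
          + deriv f (u x y r) * (dt T)^[2] u x y r)) r := fun r hr => by
    have hr' := hsub r hr
    have hr2 := Ioo_subset_Ioc_self hr'
    have hu : HasDerivAt (u x y) (dt T u x y r) r :=
      hasDerivAt_of_mem_Ioo hr' (h1.has_t x y r hp (Ioo_subset_Icc_self hr'))
    have hut : HasDerivAt (dt T u x y) ((dt T)^[2] u x y r) r :=
      hasDerivAt_of_mem_Ioo hr' (h2.has_tt x y r hp hr2)
    exact ((hasDerivAt_of_mem_Ioo hr' (h2.has_ttxx x y r hp hr2)).add
      (hasDerivAt_of_mem_Ioo hr' (h2.has_ttyy x y r hp hr2))).add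
      (((hf.hasDerivAt_deriv (u x y r)).comp r hu).mul hut)
  refine abs_sub_le_of_deriv_le_rpow ha0 hs.le hst
    (fun r hr => (hd r hr).continuousAt.continuousWithinAt)
    (fun r hr => hd r (Ioo_subset_Icc_self hr)) fun r hr => ?_
  have hr' := hsub r (Ioo_subset_Icc_self hr)
  have hr2 := Ioo_subset_Ioc_self hr'
  have hr0 : 0 < r := hr'.1
  have hC := h1.bound_t.nonneg hT
  have hQ := hf.nonneg
  have b1 := h2.bound_ttxx x y r hp hr2
  have b2 := h2.bound_ttyy x y r hp hr2
  have b3 := h1.bound_t x y r hp hr2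
  have b4 := h2.bound_tt x y r hp hr2
  have b5 := hK r (Ioo_subset_Icc_self hr')
  have hKf : 0 ≤ Kf := (abs_nonneg _).trans b5
  rw [show α 0 - 2 = a - 1 by rw [← ha]; ring] at b1 b2 b4
  rw [ha] at b3
  have hpw := Real.rpow_pos_of_pos hr0 a
  have hpw1 := Real.rpow_pos_of_pos hr0 (a - 1)
  have b6 : |iteratedDeriv 2 f (u x y r) * dt T u x y r * dt T u x y r|
      ≤ Kf * (C * r ^ a) * (C * r ^ a) := by
    rw [abs_mul, abs_mul]
    exact mul_le_mul (mul_le_mul b5 b3 (abs_nonneg _) hKf) b3 (abs_nonneg _) (by positivity)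
  have b7 : |deriv f (u x y r) * (dt T)^[2] u x y r| ≤ Qf * (C * r ^ (a - 1)) := by
    rw [abs_mul]
    exact mul_le_mul (hf.bound _) b4 (abs_nonneg _) hQ
  have e : r ^ a * r ^ a = r ^ (a + 1) * r ^ (a - 1) := by
    rw [← Real.rpow_add hr0, ← Real.rpow_add hr0]; congr 1; ring
  have hTp : r ^ (a + 1) ≤ T ^ (a + 1) := Real.rpow_le_rpow hr0.le hr'.2.le (by linarith)
  have hTp' : Kf * C ^ 2 * (r ^ (a + 1) * r ^ (a - 1)) ≤ Kf * C ^ 2 * (T ^ (a + 1) * r ^ (a - 1)) := by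
    gcongr
  have t1 := abs_add_three ((dt T)^[2] (D.dx^[2] u) x y r) ((dt T)^[2] (D.dy^[2] u) x y r)
    (iteratedDeriv 2 f (u x y r) * dt T u x y r * dt T u x y r
      + deriv f (u x y r) * (dt T)^[2] u x y r)
  have t2 := abs_add_le (iteratedDeriv 2 f (u x y r) * dt T u x y r * dt T u x y r)
    (deriv f (u x y r) * (dt T)^[2] u x y r)
  have e2 : Kf * (C * r ^ a) * (C * r ^ a) = Kf * C ^ 2 * (r ^ (a + 1) * r ^ (a - 1)) := by
    rw [← e]; ring
  unfold forcingConst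
  nlinarith

end

end DiffusionWave

/-! ### Consistency in time and variation of the memory weights. -/

namespace DiffusionWave
open MeasureTheory

section
variable {T Qα Qf Qg C Kf a τ : ℝ} {α f : ℝ → ℝ} {u₀ v₀ : ℝ → ℝ → ℝ} {D : Rectangle}
  {u : ℝ → ℝ → ℝ → ℝ}

/-- The rule of the scheme differs from the rule with cell means only on the first cell, where it
takes the right end value. -/
theorem piRule_eq_sum_mean {n : ℕ} (hn : 1 ≤ n) (φ : ℕ → ℝ) :
    piRule a τ n φ = ∑ j ∈ Finset.Icc 1 n, piWeight a τ n j * ((φ j + φ (j - 1)) / 2)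
      + piWeight a τ n 1 * ((φ 1 - φ 0) / 2) := by
  unfold piRule
  have : Finset.Icc 1 n = insert 1 (Finset.Icc 2 n) := by
    ext x; simp only [Finset.mem_Icc, Finset.mem_insert]; omega
  rw [this, Finset.sum_insert (by simp)]
  ring

/-- The truncation error in time at a point of the closed rectangle. -/
theorem IsSolution.abs_consistency_le (hT : 0 < T) (hα : IsAdmissibleExponent T Qα α)
    (ha : α 0 - 1 = a) (hf : IsAdmissibleSource Qf f) (h : IsSolution D T α f u₀ v₀ u)
    (h1 : RegularityA1 D T (α 0) C u) (h2 : RegularityA2 D T (α 0) C u)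
    (hg : IsKernelConstant T α Qg) {x y : ℝ} (hp : (x, y) ∈ D.closed)
    (hK : ∀ t ∈ Icc 0 T, |iteratedDeriv 2 f (u x y t)| ≤ Kf) (hτ : 0 < τ) {n N : ℕ} (hn1 : 1 ≤ n)
    (hn : n ≤ N) (hN : N * τ ≤ T) :
    |leadCoeff α τ * ((u x y (n * τ) - u x y ((n - 1 : ℕ) * τ)) / τ)
        + ∑ k ∈ Finset.Icc 1 (n - 1),
          gWeightTilde α τ (n - k) * ((u x y (k * τ) - u x y ((k - 1 : ℕ) * τ)) / τ)
        - piRule a τ n (fun m => forcing D f u x y (m * τ))|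
      ≤ truncBound T a Qg Qf C Kf τ n := by
  obtain ⟨m, rfl⟩ : ∃ m, n = m + 1 := ⟨n - 1, by omega⟩
  have ha0 : 0 < a := by have := (hα.range 0 ⟨le_rfl, hT.le⟩).1; linarith
  have hC := h1.bound_t.nonneg hT
  have hQf := hf.nonneg
  have hKf : 0 ≤ Kf := (abs_nonneg _).trans (hK 0 ⟨le_rfl, hT.le⟩)
  have hgc := hg.diff_one.continuousOn
  have hφc := h1.continuousOn_forcing hf.smooth.continuous hp
  have hvc := h1.cont_t.time hp
  have hL := forcingLip_nonneg (a := a) hT.le hQf hC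
  have hφd : ∀ t ∈ Ioo 0 T, HasDerivAt (forcing D f u x y) (forcingDeriv D T f u x y t) t :=
    fun t ht => hasDerivAt_forcing hf h1 hp ht
  have hφb : ∀ t ∈ Ioo 0 T, |forcingDeriv D T f u x y t| ≤ forcingLip T a Qf C :=
    fun t ht => abs_forcingDeriv_le hf ha ha0 hT h1 hp ht
  have he := h.integrated_equation hT hα hf.smooth.continuous h1 h2 hgc hp
  rw [ha] at he
  have key := discrete_equation (U := u x y) ha0 hτ hn hN hvc hφc hgc
    (fun t ht => (h1.has_t x y t hp ht).continuousWithinAt)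
    (fun t ht => hasDerivAt_of_mem_Ioo ht (h1.has_t x y t hp (Ioo_subset_Icc_self ht))) he
  have b1 := abs_trapSum_succ_sub_le (n := m) (VB := abelPrimitive a) hτ hn hN
    (continuous_abelPrimitive ha0).continuousOn (abelPrimitive_zero ha0) (abelPrimitive_mono ha0)
    (fun s t hs hst _ => (abs_of_nonneg (sub_nonneg.2
      (abelPrimitive_mono ha0 hs (hs.trans hst) hst))).le)
    hφc hφd hφb (powVar_mono (forcingConst_nonneg (a := a) hT.le hQf hC hKf) ha0)
    (fun s t hs hst ht => abs_forcingDeriv_sub_le hf ha ha0 hT h1 h2 hp hK hs hst ht)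
  -- On the memory side the exactly integrated factor is `∂_t u`, which vanishes at `0` and has
  -- variation function `powVar C a`; the interpolated factor is `g`.
  have b2 := abs_trapSum_succ_sub_le (n := m) (B := dt T u x y) (VB := powVar C a)
    (φ := genIdentity α) (φ' := derivWithin (genIdentity α) (Icc 0 T)) (M := Qg)
    (V := powVar (kernelConst T Qg) (1 / 2)) hτ hn hN hvc
    (h1.dt_zero hT (by linarith) hp) (powVar_mono hC ha0)
    (fun s t hs hst ht => by
      refine abs_sub_le_of_deriv_le_rpow (h' := (dt T)^[2] u x y) ha0 hs hst
        (hvc.mono (Icc_subset_Icc hs ht)) (fun r hr => ?_) (fun r hr => ?_)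
      · exact hasDerivAt_of_mem_Ioo ⟨hs.trans_lt hr.1, hr.2.trans_le ht⟩
          (h2.has_tt x y r hp ⟨hs.trans_lt hr.1, hr.2.le.trans ht⟩)
      · have := h2.bound_tt x y r hp ⟨hs.trans_lt hr.1, hr.2.le.trans ht⟩
        rwa [show α 0 - 2 = a - 1 by rw [← ha]; ring] at this)
    hgc (fun t ht => hasDerivAt_of_mem_Ioo ht (hg.diff_one t (Ioo_subset_Icc_self ht)))
    (fun t ht => hg.bound_one t (Ioo_subset_Icc_self ht))
    (powVar_mono (kernelConst_nonneg hT.le (hg.nonneg hT.le)) one_half_pos)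
    (fun s t hs hst ht => hg.abs_deriv_sub_le hT.le hs hst ht)
  have b3 : |forcing D f u x y (1 * τ) - forcing D f u x y (0 * τ)| ≤ forcingLip T a Qf C * τ := by
    rw [one_mul, zero_mul]
    have hτT : τ ≤ T := by
      refine le_trans ?_ hN
      have : (1 : ℝ) ≤ N := by exact_mod_cast (show 1 ≤ N by omega)
      nlinarith
    have := abs_sub_le_of_deriv_bound hτ.le (hφc.mono (Icc_subset_Icc_right hτT))
      (fun t ht => hφd t ⟨ht.1, ht.2.trans_le hτT⟩) (fun t ht => hφb t ⟨ht.1, ht.2.trans_le hτT⟩)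
    rwa [sub_zero] at this
  have hw := piWeight_nonneg (a := a) ha0 hτ le_rfl hn1
  rw [piRule_eq_sum_mean hn1]
  have e1 : ∑ k ∈ Finset.Icc 1 (m + 1 - 1), gWeightTilde α τ (m + 1 - k)
        * ((u x y (k * τ) - u x y ((k - 1 : ℕ) * τ)) / τ)
      = (∑ k ∈ Finset.Icc 1 m, gWeightTilde α τ (m + 1 - k)
        * (u x y (k * τ) - u x y ((k - 1 : ℕ) * τ))) / τ := by
    rw [Finset.sum_div, Nat.add_sub_cancel]
    exact Finset.sum_congr rfl fun k _ => by ring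
  set S := ∑ k ∈ Finset.Icc 1 m, gWeightTilde α τ (m + 1 - k)
        * (u x y (k * τ) - u x y ((k - 1 : ℕ) * τ))
  set Sφ := ∑ j ∈ Finset.Icc 1 (m + 1), piWeight a τ (m + 1) j
    * ((forcing D f u x y (j * τ) + forcing D f u x y ((j - 1 : ℕ) * τ)) / 2)
  set ΔB := trapSum τ (abelPrimitive a) (forcing D f u x y) (m + 1)
    - trapSum τ (abelPrimitive a) (forcing D f u x y) m
  set Δg := trapSum τ (dt T u x y) (genIdentity α) (m + 1) - trapSum τ (dt T u x y) (genIdentity α) m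
  rw [e1]
  simp only [Nat.add_sub_cancel, Nat.cast_one, Nat.cast_zero]
  have e2 : leadCoeff α τ * ((u x y ((m + 1 : ℕ) * τ) - u x y (m * τ)) / τ) + S / τ
      - (Sφ + piWeight a τ (m + 1) 1
        * ((forcing D f u x y (1 * τ) - forcing D f u x y (0 * τ)) / 2))
      = (ΔB - Δg) / τ - piWeight a τ (m + 1) 1
        * ((forcing D f u x y (1 * τ) - forcing D f u x y (0 * τ)) / 2) := by
    have : Sφ = (τ * Sφ) / τ := by field_simp
    rw [this]
    have k2 : τ * Sφ = leadCoeff α τ * (u x y ((m + 1 : ℕ) * τ) - u x y (m * τ)) + S - ΔB + Δg := by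
      linarith
    rw [k2]
    ring
  rw [e2]
  refine (abs_sub _ _).trans ?_
  unfold truncBound
  rw [abs_div, abs_of_pos hτ, abs_mul, abs_of_nonneg hw, abs_div, abs_two, Nat.add_sub_cancel]
  have b4 := abs_sub ΔB Δg
  gcongr
  · linarith
  · linarith

theorem IsKernelConstant.abs_sub_le (hg : IsKernelConstant T α Qg) {s t : ℝ} (hs : 0 ≤ s)
    (hst : s ≤ t) (ht : t ≤ T) : |genIdentity α t - genIdentity α s| ≤ Qg * (t - s) :=
  abs_sub_le_of_deriv_bound hst (hg.diff_one.continuousOn.mono (Icc_subset_Icc hs ht))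
    (fun r hr => hasDerivAt_of_mem_Ioo ⟨hs.trans_lt hr.1, hr.2.trans_le ht⟩
      (hg.diff_one r ⟨hs.trans hr.1.le, hr.2.le.trans ht⟩))
    fun r hr => hg.bound_one r ⟨hs.trans hr.1.le, hr.2.le.trans ht⟩

theorem IsKernelConstant.half_le_leadCoeff (hg : IsKernelConstant T α Qg) (hτ : 0 < τ) (hτT : τ ≤ T)
    (h : Qg * τ ≤ 1) : 1 / 2 ≤ leadCoeff α τ := by
  have := hg.abs_sub_le le_rfl hτ.le hτT
  rw [sub_zero] at this
  rw [leadCoeff, gWeight]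
  simp only [Nat.cast_zero, zero_add, one_mul, zero_mul]
  linarith [(abs_le.1 this).1]

/-- The difference is the increment over `[0, τ]` of `r ↦ g((j+2)τ + r) - g(jτ + r)`, whose
derivative is bounded by the variation of `g'` over three cells. -/
theorem IsKernelConstant.abs_gWeight_sub_le (hg : IsKernelConstant T α Qg) (hτ : 0 < τ) {j : ℕ}
    (hj : ((j : ℝ) + 3) * τ ≤ T) : |gWeight α τ (j + 2) - gWeight α τ j|
      ≤ τ * (powVar (kernelConst T Qg) (1 / 2) (((j : ℝ) + 3) * τ)
        - powVar (kernelConst T Qg) (1 / 2) (j * τ)) := by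
  have hT : 0 ≤ T := le_trans (by positivity) hj
  have h0 : 0 ≤ (j : ℝ) * τ := by positivity
  have hc := hg.diff_one.continuousOn
  have hV := powVar_mono (kernelConst_nonneg hT (hg.nonneg hT)) (one_half_pos (α := ℝ))
  have hm1 : ∀ r ∈ Icc 0 τ, j * τ + r ∈ Icc 0 T := fun r hr => ⟨by linarith [hr.1], by nlinarith [hr.2]⟩
  have hm2 : ∀ r ∈ Icc 0 τ, ((j : ℝ) + 2) * τ + r ∈ Icc 0 T := fun r hr =>
    ⟨by nlinarith [hr.1], by nlinarith [hr.2]⟩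
  have hn1 : ∀ r ∈ Ioo 0 τ, j * τ + r ∈ Ioo 0 T := fun r hr => ⟨by linarith [hr.1], by nlinarith [hr.2]⟩
  have hn2 : ∀ r ∈ Ioo 0 τ, ((j : ℝ) + 2) * τ + r ∈ Ioo 0 T := fun r hr =>
    ⟨by nlinarith [hr.1], by nlinarith [hr.2]⟩
  have hd : ∀ t ∈ Ioo 0 T, HasDerivAt (genIdentity α) (derivWithin (genIdentity α) (Icc 0 T) t) t :=
    fun t ht => hasDerivAt_of_mem_Ioo ht (hg.diff_one t (Ioo_subset_Icc_self ht))
  have := abs_sub_le_of_deriv_bound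
    (f := fun r => genIdentity α (((j : ℝ) + 2) * τ + r) - genIdentity α (j * τ + r))
    (f' := fun r => derivWithin (genIdentity α) (Icc 0 T) (((j : ℝ) + 2) * τ + r)
      - derivWithin (genIdentity α) (Icc 0 T) (j * τ + r)) hτ.le
    ((hc.comp (by fun_prop) hm2).sub (hc.comp (by fun_prop) hm1))
    (fun r hr => ((hd _ (hn2 r hr)).comp_const_add (((j : ℝ) + 2) * τ) r).sub
      ((hd _ (hn1 r hr)).comp_const_add (j * τ) r))
    (C := powVar (kernelConst T Qg) (1 / 2) (((j : ℝ) + 3) * τ)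
        - powVar (kernelConst T Qg) (1 / 2) (j * τ)) (fun r hr => by
      refine (hg.abs_deriv_sub_le hT (hn1 r hr).1 (by nlinarith [hr.1]) (hn2 r hr).2).trans ?_
      have h2 := hV (mem_Ici.2 (hn2 r hr).1.le) (mem_Ici.2 (show (0 : ℝ) ≤ ((j : ℝ) + 3) * τ by positivity))
        (by nlinarith [hr.2])
      have h1 := hV (mem_Ici.2 h0) (mem_Ici.2 (hn1 r hr).1.le) (by linarith [hr.1])
      linarith)
  rw [sub_zero, add_zero, add_zero] at this
  have e : gWeight α τ (j + 2) - gWeight α τ j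
      = genIdentity α (((j : ℝ) + 2) * τ + τ) - genIdentity α (j * τ + τ)
        - (genIdentity α (((j : ℝ) + 2) * τ) - genIdentity α (j * τ)) := by
    unfold gWeight
    push_cast
    rw [show ((j : ℝ) + 2 + 1) * τ = (j + 2) * τ + τ by ring, show ((j : ℝ) + 1) * τ = j * τ + τ by ring]
    ring
  rw [e]
  linarith

/-- The total variation of the weights `w̃_k` is of the order `τ`. -/
theorem IsKernelConstant.variation_gWeightTilde_le (hg : IsKernelConstant T α Qg) (hτ : 0 < τ)
    {N : ℕ} (hN2 : 2 ≤ N) (hN : N * τ ≤ T) :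
    |gWeightTilde α τ 1|
        + ∑ j ∈ Finset.range (N - 2), |gWeightTilde α τ (j + 2) - gWeightTilde α τ (j + 1)|
      ≤ (Qg + 2 * powVar (kernelConst T Qg) (1 / 2) T) * τ := by
  have hT : 0 ≤ T := le_trans (by positivity) hN
  have hQ := hg.nonneg hT
  set V := powVar (kernelConst T Qg) (1 / 2) with hVdef
  have hV : MonotoneOn V (Ici 0) :=
    powVar_mono (kernelConst_nonneg hT hQ) (one_half_pos (α := ℝ))
  have hV0 : V 0 = 0 := powVar_zero _ one_half_pos
  have hVT : 0 ≤ V T := by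
    have := hV (mem_Ici.2 le_rfl) (mem_Ici.2 hT) hT
    rwa [hV0] at this
  have h1 : |gWeightTilde α τ 1| ≤ Qg * τ := by
    have h2T : 2 * τ ≤ T := le_trans (by gcongr; exact_mod_cast hN2) hN
    have := hg.abs_sub_le (t := 2 * τ) le_rfl (by positivity) h2T
    rw [sub_zero] at this
    have e : gWeightTilde α τ 1 = (genIdentity α (2 * τ) - genIdentity α 0) / 2 := by
      unfold gWeightTilde gWeight
      norm_num
    rw [e, abs_div, abs_two]
    linarith
  have h2 : ∀ j ∈ Finset.range (N - 2), |gWeightTilde α τ (j + 2) - gWeightTilde α τ (j + 1)|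
      ≤ τ / 2 * (cellInc τ V j + cellInc τ V (j + 1) + cellInc τ V (j + 2)) := by
    intro j hj
    rw [Finset.mem_range] at hj
    have hj3 : ((j : ℝ) + 3) * τ ≤ T := by
      refine le_trans ?_ hN
      have : (j : ℝ) + 3 ≤ N := by exact_mod_cast (show j + 3 ≤ N by omega)
      gcongr
    -- In the difference of two means the common weight `w_(j+1)` cancels.
    have e : gWeightTilde α τ (j + 2) - gWeightTilde α τ (j + 1)
        = (gWeight α τ (j + 2) - gWeight α τ j) / 2 := by
      unfold gWeightTilde
      rw [show j + 2 - 1 = j + 1 by omega, Nat.add_sub_cancel]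
      ring
    rw [e, abs_div, abs_two]
    have := hg.abs_gWeight_sub_le hτ hj3
    have e2 : cellInc τ V j + cellInc τ V (j + 1) + cellInc τ V (j + 2)
        = V (((j : ℝ) + 3) * τ) - V (j * τ) := by
      unfold cellInc
      push_cast
      rw [show (j : ℝ) + 1 + 1 = j + 2 by ring, show (j : ℝ) + 2 + 1 = j + 3 by ring]
      ring
    rw [e2]
    linarith
  have h3 : ∀ i ≤ 2, ∑ j ∈ Finset.range (N - 2), cellInc τ V (j + i) ≤ V T := by
    intro i hi
    have hnn := cellInc_nonneg hτ hV
    calc ∑ j ∈ Finset.range (N - 2), cellInc τ V (j + i)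
        ≤ ∑ j ∈ Finset.range N, cellInc τ V j := by
          rw [← Finset.sum_image (f := cellInc τ V) (g := fun j => j + i)
            (fun x _ y _ h => by simpa using h)]
          refine Finset.sum_le_sum_of_subset_of_nonneg (fun k hk => ?_) fun k _ _ => hnn k
          simp only [Finset.mem_image, Finset.mem_range] at hk ⊢
          omega
      _ = V (N * τ) := by rw [sum_cellInc, hV0, sub_zero]
      _ ≤ V T := hV (mem_Ici.2 (by positivity)) hT hN
  have h4 := Finset.sum_le_sum h2
  rw [← Finset.mul_sum, Finset.sum_add_distrib, Finset.sum_add_distrib] at h4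
  have h5 := h3 0 (by norm_num)
  have h6 := h3 1 (by norm_num)
  have h7 := h3 2 (by norm_num)
  simp only [add_zero] at h5
  have h8 : τ / 2 * (∑ j ∈ Finset.range (N - 2), cellInc τ V j
      + ∑ j ∈ Finset.range (N - 2), cellInc τ V (j + 1)
      + ∑ j ∈ Finset.range (N - 2), cellInc τ V (j + 2)) ≤ τ / 2 * (4 * V T) := by
    gcongr
    linarith
  linarith

end

end DiffusionWave

namespace DiffusionWave

section
variable {Mx My : ℕ} {D : Rectangle} {v w : ℕ → ℕ → ℝ} {a τ : ℝ}

/-! ### The discrete norm -/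

theorem Rectangle.step_mul_nonneg (D : Rectangle) (Mx My : ℕ) : 0 ≤ D.stepX Mx * D.stepY My :=
  mul_nonneg (div_nonneg (sub_pos.2 D.hx).le (Nat.cast_nonneg _))
    (div_nonneg (sub_pos.2 D.hy).le (Nat.cast_nonneg _))

theorem Rectangle.gridNorm_eq (D : Rectangle) (Mx My : ℕ) (v : ℕ → ℕ → ℝ) :
    D.gridNorm Mx My v = √(D.stepX Mx * D.stepY My * gridSum Mx My v v) := rfl

theorem Rectangle.gridNorm_nonneg : 0 ≤ D.gridNorm Mx My v := Real.sqrt_nonneg _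

theorem Rectangle.gridNorm_sq :
    D.gridNorm Mx My v ^ 2 = D.stepX Mx * D.stepY My * gridSum Mx My v v := by
  rw [D.gridNorm_eq, Real.sq_sqrt (mul_nonneg (D.step_mul_nonneg Mx My) gridSum_self_nonneg)]

theorem Rectangle.gridNorm_mul_gridNorm :
    D.gridNorm Mx My v * D.gridNorm Mx My w
      = D.stepX Mx * D.stepY My * (√(gridSum Mx My v v) * √(gridSum Mx My w w)) := by
  have h := D.step_mul_nonneg Mx My
  rw [D.gridNorm_eq, D.gridNorm_eq, Real.sqrt_mul h, Real.sqrt_mul h, mul_mul_mul_comm,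
    Real.mul_self_sqrt h]

theorem Rectangle.gridNorm_le_mul {Q : ℝ} (hQ : 0 ≤ Q)
    (h : ∀ i j, 0 < i → i < Mx → 0 < j → j < My → |v i j| ≤ Q * |w i j|) :
    D.gridNorm Mx My v ≤ Q * D.gridNorm Mx My w := by
  refine abs_le_of_sq_le_sq' ?_ (mul_nonneg hQ D.gridNorm_nonneg) |>.2
  rw [mul_pow, D.gridNorm_sq, D.gridNorm_sq, mul_left_comm]
  refine mul_le_mul_of_nonneg_left ?_ (D.step_mul_nonneg Mx My)
  unfold gridSum
  simp only [Finset.mul_sum]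
  refine Finset.sum_le_sum fun i hi => Finset.sum_le_sum fun j hj => ?_
  rw [Finset.mem_Ioo] at hi hj
  have := pow_le_pow_left₀ (abs_nonneg _) (h i j hi.1 hi.2 hj.1 hj.2) 2
  rw [mul_pow, sq_abs, sq_abs] at this
  nlinarith

theorem Rectangle.gridNorm_le_of_abs_le {Y : ℝ} (hY : 0 ≤ Y) (hMx : 0 < Mx) (hMy : 0 < My)
    (h : ∀ i j, 0 < i → i < Mx → 0 < j → j < My → |v i j| ≤ Y) :
    D.gridNorm Mx My v ≤ √((D.rx - D.lx) * (D.ry - D.ly)) * Y := by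
  have hx := sub_pos.2 D.hx
  have hy := sub_pos.2 D.hy
  refine abs_le_of_sq_le_sq' ?_ (mul_nonneg (Real.sqrt_nonneg _) hY) |>.2
  rw [mul_pow, D.gridNorm_sq, Real.sq_sqrt (mul_pos hx hy).le]
  have h1 : gridSum Mx My v v ≤ (Mx : ℝ) * (My * Y ^ 2) := by
    unfold gridSum
    refine (Finset.sum_le_card_nsmul _ _ (My * Y ^ 2) fun i hi => ?_).trans ?_
    · refine (Finset.sum_le_card_nsmul _ _ (Y ^ 2) fun j hj => ?_).trans ?_
      · rw [Finset.mem_Ioo] at hi hj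
        rw [← sq, ← sq_abs]
        exact pow_le_pow_left₀ (abs_nonneg _) (h i j hi.1 hi.2 hj.1 hj.2) 2
      · rw [nsmul_eq_mul, Nat.card_Ioo]
        gcongr
        omega
    · rw [nsmul_eq_mul, Nat.card_Ioo]
      gcongr
      omega
  have hMx' : (0 : ℝ) < Mx := by exact_mod_cast hMx
  have hMy' : (0 : ℝ) < My := by exact_mod_cast hMy
  calc D.stepX Mx * D.stepY My * gridSum Mx My v v
      ≤ D.stepX Mx * D.stepY My * ((Mx : ℝ) * (My * Y ^ 2)) :=
        mul_le_mul_of_nonneg_left h1 (D.step_mul_nonneg Mx My)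
    _ = _ := by
      unfold stepX stepY
      field_simp

theorem Rectangle.gridNorm_mean_le {X : ℝ} (hv : D.gridNorm Mx My v ≤ X)
    (hw : D.gridNorm Mx My w ≤ X) : D.gridNorm Mx My (fun i j => (v i j + w i j) / 2) ≤ X := by
  have hX : 0 ≤ X := D.gridNorm_nonneg.trans hv
  refine abs_le_of_sq_le_sq' ?_ hX |>.2
  have h1 := pow_le_pow_left₀ D.gridNorm_nonneg hv 2
  have h2 := pow_le_pow_left₀ D.gridNorm_nonneg hw 2
  rw [D.gridNorm_sq] at h1 h2 ⊢
  have h3 : gridSum Mx My (fun i j => (v i j + w i j) / 2) (fun i j => (v i j + w i j) / 2)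
      ≤ (gridSum Mx My v v + gridSum Mx My w w) / 2 := by
    unfold gridSum
    simp only [← Finset.sum_add_distrib, Finset.sum_div]
    refine Finset.sum_le_sum fun i _ => Finset.sum_le_sum fun j _ => ?_
    nlinarith [sq_nonneg (v i j - w i j)]
  have h4 := mul_le_mul_of_nonneg_left h3 (D.step_mul_nonneg Mx My)
  linarith

/-! ### The discrete operators as linear functionals -/

/-- The discrete inner product with a fixed grid function. -/
noncomputable def Rectangle.testAgainst (D : Rectangle) (Mx My : ℕ) (w : ℕ → ℕ → ℝ) : (ℕ → ℕ → ℝ) →ₗ[ℝ] ℝ where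
  toFun v := D.stepX Mx * D.stepY My * gridSum Mx My v w
  map_add' v₁ v₂ := by
    simp only [gridSum, Pi.add_apply, add_mul, Finset.sum_add_distrib, mul_add]
  map_smul' c v := by
    simp only [gridSum, Pi.smul_apply, smul_eq_mul, RingHom.id_apply, Finset.mul_sum]
    refine Finset.sum_congr rfl fun i _ => Finset.sum_congr rfl fun j _ => ?_
    ring

/-- The value of `𝒜 v` at a grid point. -/
noncomputable def avgAt (Mx My i j : ℕ) : (ℕ → ℕ → ℝ) →ₗ[ℝ] ℝ where
  toFun v := avg Mx My v i j
  map_add' v₁ v₂ := avg_add Mx My v₁ v₂ i j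
  map_smul' c v := by
    simp only [avg, avgX, avgY, Pi.smul_apply, smul_eq_mul, RingHom.id_apply]
    split_ifs <;> ring

/-- The value of `Λ v` at a grid point. -/
noncomputable def Rectangle.lapAt (D : Rectangle) (Mx My i j : ℕ) : (ℕ → ℕ → ℝ) →ₗ[ℝ] ℝ where
  toFun v := D.lap Mx My v i j
  map_add' v₁ v₂ := by
    simp only [lap, avgX, avgY, diffX, diffY, Pi.add_apply]
    split_ifs <;> ring
  map_smul' c v := by
    simp only [lap, avgX, avgY, diffX, diffY, Pi.smul_apply, smul_eq_mul, RingHom.id_apply]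
    split_ifs <;> ring

theorem Rectangle.testAgainst_apply :
    D.testAgainst Mx My w v = D.stepX Mx * D.stepY My * gridSum Mx My v w := rfl

theorem Rectangle.testAgainst_congr {v' : ℕ → ℕ → ℝ}
    (h : ∀ i j, 0 < i → i < Mx → 0 < j → j < My → v i j = v' i j) :
    D.testAgainst Mx My w v = D.testAgainst Mx My w v' := by
  rw [D.testAgainst_apply, D.testAgainst_apply, gridSum, gridSum]
  congr 1
  refine Finset.sum_congr rfl fun i hi => Finset.sum_congr rfl fun j hj => ?_
  rw [Finset.mem_Ioo] at hi hj
  rw [h i j hi.1 hi.2 hj.1 hj.2]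

theorem Rectangle.testAgainst_mean (D : Rectangle) (Mx My : ℕ) (v w w' : ℕ → ℕ → ℝ) :
    D.testAgainst Mx My (fun i j => (w i j + w' i j) / 2) v
      = (D.testAgainst Mx My w v + D.testAgainst Mx My w' v) / 2 := by
  simp only [D.testAgainst_apply, gridSum, ← mul_add, ← Finset.sum_add_distrib]
  rw [mul_div_assoc, Finset.sum_div]
  congr 1
  refine Finset.sum_congr rfl fun i _ => ?_
  rw [Finset.sum_div]
  exact Finset.sum_congr rfl fun j _ => by ring

theorem Rectangle.abs_testAgainst_le :
    |D.testAgainst Mx My w v| ≤ D.gridNorm Mx My v * D.gridNorm Mx My w := by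
  rw [D.testAgainst_apply, abs_mul, abs_of_nonneg (D.step_mul_nonneg Mx My),
    D.gridNorm_mul_gridNorm]
  exact mul_le_mul_of_nonneg_left (abs_gridSum_le v w) (D.step_mul_nonneg Mx My)

theorem Rectangle.abs_testAgainst_avg_le (hv : VanishesOnBdry Mx My v) :
    |D.testAgainst Mx My w (avg Mx My v)| ≤ D.gridNorm Mx My v * D.gridNorm Mx My w := by
  rw [D.testAgainst_apply, abs_mul, abs_of_nonneg (D.step_mul_nonneg Mx My),
    D.gridNorm_mul_gridNorm]
  exact mul_le_mul_of_nonneg_left (abs_gridSum_avg_le hv w) (D.step_mul_nonneg Mx My)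

/-- The left-hand memory operator `c δ_t v^n + ∑ w_{n-k} δ_t v^k`. -/
noncomputable def memoryOp (c τ : ℝ) (w : ℕ → ℝ) (n : ℕ) (v : ℕ → ℝ) : ℝ :=
  c * ((v n - v (n - 1)) / τ)
    + ∑ k ∈ Finset.Icc 1 (n - 1), w (n - k) * ((v k - v (k - 1)) / τ)

variable (ℓ : (ℕ → ℕ → ℝ) →ₗ[ℝ] ℝ)

theorem map_diffQuot (v w : ℕ → ℕ → ℝ) (c τ : ℝ) :
    ℓ (fun i j => c * ((v i j - w i j) / τ)) = c * ((ℓ v - ℓ w) / τ) := by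
  have : (fun i j => c * ((v i j - w i j) / τ)) = (c / τ) • (v - w) := by
    funext i j
    simp only [Pi.smul_apply, Pi.sub_apply, smul_eq_mul]
    ring
  rw [this, map_smul, map_sub, smul_eq_mul]
  ring

theorem map_finset_sum (s : Finset ℕ) (F : ℕ → ℕ → ℕ → ℝ) :
    ℓ (fun i j => ∑ k ∈ s, F k i j) = ∑ k ∈ s, ℓ (F k) := by
  rw [← map_sum]
  congr 1
  funext i j
  simp only [Finset.sum_apply]

/-- The time operators are linear combinations of levels, so they commute with every linear
functional in space. Both evaluation of `𝒜` at a point and testing against a grid function are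
handled this way. -/
theorem map_memoryOp (c τ : ℝ) (w : ℕ → ℝ) (n : ℕ) (v : ℕ → ℕ → ℕ → ℝ) :
    ℓ (fun i j => memoryOp c τ w n (fun m => v m i j)) = memoryOp c τ w n (fun m => ℓ (v m)) := by
  unfold memoryOp
  have := map_add ℓ (fun i j => c * ((v n i j - v (n - 1) i j) / τ))
    (fun i j => ∑ k ∈ Finset.Icc 1 (n - 1), w (n - k) * ((v k i j - v (k - 1) i j) / τ))
  rw [map_diffQuot, map_finset_sum] at this
  simp only [map_diffQuot] at this
  exact this

theorem map_piRule (n : ℕ) (φ : ℕ → ℕ → ℕ → ℝ) :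
    ℓ (fun i j => piRule a τ n (fun m => φ m i j)) = piRule a τ n (fun m => ℓ (φ m)) := by
  unfold piRule
  have h1 : ∀ (c : ℝ) (v : ℕ → ℕ → ℝ), ℓ (fun i j => c * v i j) = c * ℓ v := fun c v =>
    map_smul ℓ c v
  have h2 : ∀ (c : ℝ) (v w : ℕ → ℕ → ℝ), ℓ (fun i j => c * ((v i j + w i j) / 2))
      = c * ((ℓ v + ℓ w) / 2) := fun c v w => by
    have : (fun i j => c * ((v i j + w i j) / 2)) = (c / 2) • (v + w) := by
      funext i j
      simp only [Pi.smul_apply, Pi.add_apply, smul_eq_mul]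
      ring
    rw [this, map_smul, map_add, smul_eq_mul]
    ring
  have := map_add ℓ (fun i j => piWeight a τ n 1 * φ 1 i j)
    (fun i j => ∑ k ∈ Finset.Icc 2 n, piWeight a τ n k * ((φ k i j + φ (k - 1) i j) / 2))
  rw [h1, map_finset_sum] at this
  simp only [h2] at this
  exact this

theorem piRule_add (n : ℕ) (φ ψ : ℕ → ℝ) :
    piRule a τ n (fun m => φ m + ψ m) = piRule a τ n φ + piRule a τ n ψ := by
  unfold piRule
  rw [mul_add, add_add_add_comm, ← Finset.sum_add_distrib]
  congr 1
  exact Finset.sum_congr rfl fun j _ => by ring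

theorem piRule_sub (n : ℕ) (φ ψ : ℕ → ℝ) :
    piRule a τ n (fun m => φ m - ψ m) = piRule a τ n φ - piRule a τ n ψ := by
  unfold piRule
  rw [mul_sub, add_sub_add_comm, ← Finset.sum_sub_distrib]
  congr 1
  exact Finset.sum_congr rfl fun j _ => by ring

theorem memoryOp_sub (c τ : ℝ) (w : ℕ → ℝ) (n : ℕ) (φ ψ : ℕ → ℝ) :
    memoryOp c τ w n (fun m => φ m - ψ m) = memoryOp c τ w n φ - memoryOp c τ w n ψ := by
  unfold memoryOp
  rw [add_sub_add_comm, ← Finset.sum_sub_distrib]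
  congr 1
  · ring
  · exact Finset.sum_congr rfl fun j _ => by ring

/-- Regrouping by time level: the nonlinear term of the scheme is the same averaged rule as the one
for `Λ`. -/
theorem piRule_eq_tilde {n : ℕ} (hn : 2 ≤ n) (φ : ℕ → ℝ) :
    piRule a τ n φ = piWeight a τ n n * φ n / 2
      + ∑ k ∈ Finset.Icc 1 (n - 1), piWeightTilde a τ n k * φ k := by
  have key : ∀ (w : ℕ → ℝ) (m : ℕ), w 1 * φ 1
      + ∑ j ∈ Finset.Icc 2 (m + 2), w j * ((φ j + φ (j - 1)) / 2)
      = w (m + 2) * φ (m + 2) / 2 + ∑ k ∈ Finset.Icc 1 (m + 1),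
        (if k = 1 then w 1 + w 2 / 2 else (w (k + 1) + w k) / 2) * φ k := by
    intro w m
    induction m with
    | zero =>
      simp only [zero_add, Finset.Icc_self, Finset.sum_singleton, if_true]
      norm_num
      ring
    | succ m ih =>
      rw [show m + 1 + 2 = m + 2 + 1 by omega, Finset.sum_Icc_succ_top (by omega), ← add_assoc, ih,
        Finset.sum_Icc_succ_top (show 1 ≤ m + 1 + 1 by omega),
        if_neg (show ¬m + 1 + 1 = 1 by omega)]
      simp only [Nat.add_sub_cancel]
      ring
  obtain ⟨m, rfl⟩ : ∃ m, n = m + 2 := ⟨n - 2, by omega⟩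
  rw [piRule, key (piWeight a τ (m + 2)) m]
  simp only [piWeightTilde, show m + 2 - 1 = m + 1 by omega]

end

end DiffusionWave

/-! ### The error equation and the error bound. -/

namespace DiffusionWave

section
variable {T Qα Qf Qg C Kf a : ℝ} {α f : ℝ → ℝ} {u₀ v₀ : ℝ → ℝ → ℝ} {D : Rectangle}
  {u : ℝ → ℝ → ℝ → ℝ} {N Mx My : ℕ} {U : ℕ → ℕ → ℕ → ℝ}

/-- The values of `u` at the grid points of the time level `n`. -/
noncomputable def Rectangle.sample (D : Rectangle) (Mx My : ℕ) (τ : ℝ) (u : ℝ → ℝ → ℝ → ℝ) (n : ℕ) :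
    ℕ → ℕ → ℝ := fun i j => u (D.ptX Mx i) (D.ptY My j) (n * τ)

theorem Rectangle.pt_mem_closed (D : Rectangle) (hMx : 0 < Mx) (hMy : 0 < My) {i j : ℕ}
    (hi : i ≤ Mx) (hj : j ≤ My) : (D.ptX Mx i, D.ptY My j) ∈ D.closed :=
  ⟨D.ptX_mem hMx hi, D.ptY_mem hMy hj⟩

theorem Rectangle.pt_mem_bdry (D : Rectangle) (hMx : 0 < Mx) (hMy : 0 < My) {i j : ℕ}
    (hi : i ≤ Mx) (hj : j ≤ My) (h : i = 0 ∨ i = Mx ∨ j = 0 ∨ j = My) :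
    (D.ptX Mx i, D.ptY My j) ∈ D.bdry := by
  refine ⟨D.pt_mem_closed hMx hMy hi hj, fun hin => ?_⟩
  obtain ⟨h1, h2⟩ := hin
  have x0 : D.ptX Mx 0 = D.lx := by simp [ptX]
  have y0 : D.ptY My 0 = D.ly := by simp [ptY]
  rcases h with rfl | rfl | rfl | rfl
  · exact absurd h1.1 (by simp only [x0]; exact lt_irrefl _)
  · exact absurd h1.2 (by simp only [D.ptX_last hMx]; exact lt_irrefl _)
  · exact absurd h2.1 (by simp only [y0]; exact lt_irrefl _)
  · exact absurd h2.2 (by simp only [D.ptY_last hMy]; exact lt_irrefl _)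

/-- With zero initial velocity the load drops out, and the first and the later steps of the scheme
take one common form. -/
theorem IsSchemeSolution.memoryOp_eq (h : IsSchemeSolution D T α f u₀ v₀ N Mx My U)
    (hv₀ : ∀ i ≤ Mx, ∀ j ≤ My, v₀ (D.ptX Mx i) (D.ptY My j) = 0) {n i j : ℕ} (hn1 : 1 ≤ n)
    (hn : n ≤ N) (hi0 : 0 < i) (hi : i < Mx) (hj0 : 0 < j) (hj : j < My) :
    memoryOp (leadCoeff α (T / N)) (T / N) (gWeightTilde α (T / N)) n (fun m => avg Mx My (U m) i j)
        - piRule (α 0 - 1) (T / N) n (fun m => D.lap Mx My (U m) i j)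
      = piRule (α 0 - 1) (T / N) n (fun m => avg Mx My (fun i j => f (U m i j)) i j) := by
  have hload : avg Mx My (D.load Mx My α (T / N) v₀ n) i j = 0 := by
    refine abs_nonpos_iff.1 (abs_avg_le hi0 hi hj0 hj fun k hk l hl => ?_)
    simp only [Rectangle.load, hv₀ k hk l hl, mul_zero, intervalIntegral.integral_zero, abs_zero,
      le_refl]
  have hdiff : ∀ m, avg Mx My (diffT (T / N) U m) i j
      = (avg Mx My (U m) i j - avg Mx My (U (m - 1)) i j) / (T / N) := fun m => by
    have := map_diffQuot (avgAt Mx My i j) (U m) (U (m - 1)) 1 (T / N)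
    simp only [one_mul] at this
    exact this
  rcases hn1.eq_or_lt with rfl | hn2
  · have := h.first i j hi0 hi hj0 hj
    rw [hload, hdiff] at this
    simp only [memoryOp, piRule, Nat.sub_self, Finset.Icc_eq_empty_of_lt zero_lt_one,
      Finset.Icc_eq_empty_of_lt one_lt_two, Finset.sum_empty, add_zero] at this ⊢
    exact this
  · have := h.later n hn2 hn i j hi0 hi hj0 hj
    simp only [hload, hdiff, add_zero] at this
    rw [piRule_eq_tilde (φ := fun m => avg Mx My (fun i j => f (U m i j)) i j) hn2, memoryOp]
    exact this

/-- The equation satisfied by the error of the scheme. -/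
theorem exists_error_equation (hT : 0 < T) (hα : IsAdmissibleExponent T Qα α) (ha : α 0 - 1 = a)
    (hg : IsKernelConstant T α Qg) (hf : IsAdmissibleSource Qf f)
    (h : IsSolution D T α f u₀ v₀ u) (h1 : RegularityA1 D T (α 0) C u)
    (h2 : RegularityA2 D T (α 0) C u)
    (hK : ∀ x y t, (x, y) ∈ D.closed → t ∈ Icc 0 T → |iteratedDeriv 2 f (u x y t)| ≤ Kf)
    (hN : 0 < N) (hMx : 0 < Mx) (hMy : 0 < My)
    (hU : IsSchemeSolution D T α f u₀ v₀ N Mx My U) :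
    ∃ r : ℕ → ℕ → ℕ → ℝ,
      (∀ n, 1 ≤ n → n ≤ N → ∀ i j, 0 < i → i < Mx → 0 < j → j < My →
        |r n i j| ≤ truncBound T a Qg Qf C Kf (T / N) n
          + abelPrimitive a T * (3 * C * (D.stepX Mx ^ 4 + D.stepY My ^ 4))) ∧
      ∀ n, 1 ≤ n → n ≤ N → ∀ i j, 0 < i → i < Mx → 0 < j → j < My →
        memoryOp (leadCoeff α (T / N)) (T / N) (gWeightTilde α (T / N)) n
            (fun m => avg Mx My (D.sample Mx My (T / N) u m - U m) i j)
          - piRule a (T / N) n (fun m => D.lap Mx My (D.sample Mx My (T / N) u m - U m) i j)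
        = piRule a (T / N) n (fun m => avg Mx My
            (fun i j => f (D.sample Mx My (T / N) u m i j) - f (U m i j)) i j) + r n i j := by
  set τ := T / N with hτdef
  have hN' : (0 : ℝ) < N := by exact_mod_cast hN
  have hτ : 0 < τ := div_pos hT hN'
  have hNT : N * τ = T := by rw [hτdef]; field_simp
  have ha0 : 0 < a := by have := (hα.range 0 ⟨le_rfl, hT.le⟩).1; linarith
  set w := D.sample Mx My τ u with hwdef
  set φ := D.sample Mx My τ (forcing D f u) with hφdef
  set L := D.sample Mx My τ (fun x y t => D.dx^[2] u x y t + D.dy^[2] u x y t) with hLdef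
  -- `E` is the truncation error in time at a grid point, boundary points included, and `S` the one
  -- in space. The residual is `𝒜 E` plus the rule applied to `S`.
  set E : ℕ → ℕ → ℕ → ℝ := fun n i j =>
    memoryOp (leadCoeff α τ) τ (gWeightTilde α τ) n (fun m => w m i j)
      - piRule a τ n (fun m => φ m i j) with hE
  set S : ℕ → ℕ → ℕ → ℝ := fun m i j => avg Mx My (L m) i j - D.lap Mx My (w m) i j with hS
  refine ⟨fun n i j => avg Mx My (E n) i j + piRule a τ n (fun m => S m i j), ?_, ?_⟩
  · intro n hn1 hn i j hi0 hi hj0 hj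
    have hnT : (n : ℝ) * τ ≤ T := by rw [← hNT]; gcongr
    refine (abs_add_le _ _).trans (add_le_add ?_ ?_)
    · refine abs_avg_le hi0 hi hj0 hj fun k hk l hl => ?_
      exact h.abs_consistency_le hT hα ha hf h1 h2 hg (D.pt_mem_closed hMx hMy hk hl)
        (fun t ht => hK _ _ t (D.pt_mem_closed hMx hMy hk hl) ht) hτ hn1 hn hNT.le
    · refine abs_piRule_le ha0 hτ hn1 hnT fun m hm1 hm => ?_
      have hm0 : (0 : ℝ) < m := by exact_mod_cast hm1
      exact h1.abs_avg_laplacian_sub_lap_le hi0 hi hj0 hj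
        ⟨by positivity, le_trans (by gcongr) hnT⟩
  · intro n hn1 hn i j hi0 hi hj0 hj
    have hv₀ : ∀ i ≤ Mx, ∀ j ≤ My, v₀ (D.ptX Mx i) (D.ptY My j) = 0 := fun i hi j hj => by
      have hp := D.pt_mem_closed hMx hMy hi hj
      rw [← h.initial_deriv _ _ hp, h1.dt_zero hT (by linarith) hp]
    have e1 := hU.memoryOp_eq hv₀ hn1 hn hi0 hi hj0 hj
    rw [ha, ← hτdef] at e1
    have e2 : avg Mx My (E n) i j
        = memoryOp (leadCoeff α τ) τ (gWeightTilde α τ) n (fun m => avg Mx My (w m) i j)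
          - piRule a τ n (fun m => avg Mx My (φ m) i j) := by
      have := map_sub (avgAt Mx My i j)
        (fun i j => memoryOp (leadCoeff α τ) τ (gWeightTilde α τ) n (fun m => w m i j))
        (fun i j => piRule a τ n (fun m => φ m i j))
      rw [map_memoryOp, map_piRule] at this
      exact this
    have e3 : ∀ m, avg Mx My (φ m) i j
        = avg Mx My (L m) i j + avg Mx My (fun i j => f (w m i j)) i j := fun m =>
      avg_add Mx My (L m) (fun i j => f (w m i j)) i j
    have e4 : ∀ m, avg Mx My (w m - U m) i j = avg Mx My (w m) i j - avg Mx My (U m) i j := fun m =>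
      map_sub (avgAt Mx My i j) (w m) (U m)
    have e5 : ∀ m, D.lap Mx My (w m - U m) i j = D.lap Mx My (w m) i j - D.lap Mx My (U m) i j :=
      fun m => map_sub (D.lapAt Mx My i j) (w m) (U m)
    have e6 : ∀ m, avg Mx My (fun i j => f (w m i j) - f (U m i j)) i j
        = avg Mx My (fun i j => f (w m i j)) i j - avg Mx My (fun i j => f (U m i j)) i j := fun m =>
      map_sub (avgAt Mx My i j) (fun i j => f (w m i j)) (fun i j => f (U m i j))
    simp only [e4, e5, e6, hS, memoryOp_sub, piRule_sub, e2, e3, piRule_add]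
    linarith

theorem IsAdmissibleSource.abs_sub_le (hf : IsAdmissibleSource Qf f) (x y : ℝ) :
    |f x - f y| ≤ Qf * |x - y| := by
  have := convex_univ.norm_image_sub_le_of_norm_deriv_le (f := f) (x := y) (y := x) (C := Qf)
    (fun z _ => (hf.hasDerivAt z).differentiableAt) (fun z _ => hf.bound z) (mem_univ _) (mem_univ _)
  simpa only [Real.norm_eq_abs] using this

theorem Rectangle.testAgainst_lap_mean (D : Rectangle) (Mx My : ℕ) (W v w : ℕ → ℕ → ℝ) :
    D.testAgainst Mx My W (D.lap Mx My (fun i j => (v i j + w i j) / 2))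
      = (D.testAgainst Mx My W (D.lap Mx My v) + D.testAgainst Mx My W (D.lap Mx My w)) / 2 := by
  have : D.lap Mx My (fun i j => (v i j + w i j) / 2)
      = (1 / 2 : ℝ) • (D.lap Mx My v + D.lap Mx My w) := by
    funext i j
    simp only [Rectangle.lap, avgX, avgY, diffX, diffY, Pi.smul_apply, Pi.add_apply, smul_eq_mul]
    split_ifs <;> ring
  rw [this, map_smul, map_add, smul_eq_mul]
  ring

/-- The constant that bounds the variation of the weights `w̃_k`. -/
noncomputable def weightConst (T Qg : ℝ) : ℝ := Qg + 2 * powVar (kernelConst T Qg) (1 / 2) T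

/-- `energy_estimate` for the error, with `c = 4/9` from the lower bound of `𝒜`, `K = Qf B(T)` from
the Lipschitz bound of `f`, and `q` from the variation of `w̃`. The factor `18` is `8 / (4/9)`. -/
theorem gridNorm_error_le (hT : 0 < T) (hα : IsAdmissibleExponent T Qα α) (ha : α 0 - 1 = a)
    (hg : IsKernelConstant T α Qg) (hf : IsAdmissibleSource Qf f)
    (h : IsSolution D T α f u₀ v₀ u) (h1 : RegularityA1 D T (α 0) C u)
    (h2 : RegularityA2 D T (α 0) C u)
    (hK : ∀ x y t, (x, y) ∈ D.closed → t ∈ Icc 0 T → |iteratedDeriv 2 f (u x y t)| ≤ Kf)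
    (hN : 0 < N) (hMx : 0 < Mx) (hMy : 0 < My) (hsmall : Qg * (T / N) ≤ 1)
    (hsmall' : 18 * (Qf * abelPrimitive a T + weightConst T Qg) * (T / N) ≤ 1)
    (hU : IsSchemeSolution D T α f u₀ v₀ N Mx My U) {n : ℕ} (hn : n ≤ N) :
    D.gridNorm Mx My (D.sample Mx My (T / N) u n - U n)
      ≤ 18 * (√((D.rx - D.lx) * (D.ry - D.ly)) * ((T / N) ^ 2 * truncConst T a Qg Qf C Kf
          + T * (abelPrimitive a T * (3 * C * (D.stepX Mx ^ 4 + D.stepY My ^ 4)))))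
        * Real.exp (18 * (Qf * abelPrimitive a T + weightConst T Qg) * T) := by
  obtain ⟨r, hr, heq⟩ := exists_error_equation hT hα ha hg hf h h1 h2 hK hN hMx hMy hU
  set τ := T / N with hτdef
  have hN' : (0 : ℝ) < N := by exact_mod_cast hN
  have hτ : 0 < τ := div_pos hT hN'
  have hNT : N * τ = T := by rw [hτdef]; field_simp
  obtain ⟨hα1, hα2⟩ := hα.range 0 ⟨le_rfl, hT.le⟩
  have ha0 : 0 < a := by linarith
  have ha1 : a < 1 := by linarith
  have hQg := hg.nonneg hT.le
  have hQf := hf.nonneg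
  have hC := h1.bound_t.nonneg hT
  have hKf : 0 ≤ Kf :=
    (abs_nonneg _).trans (hK D.lx D.ly 0 ⟨⟨le_rfl, D.hx.le⟩, le_rfl, D.hy.le⟩ ⟨le_rfl, hT.le⟩)
  have hB := abelPrimitive_nonneg ha0 hT.le
  set w := D.sample Mx My τ u with hwdef
  set e : ℕ → ℕ → ℕ → ℝ := fun m => w m - U m with he
  set G : ℕ → ℕ → ℕ → ℝ := fun m i j => f (w m i j) - f (U m i j) with hG
  -- The test functions are exactly the combinations to which `Λ` is applied by the rule, so the `Λ`
  -- term is a quadratic form in `V`.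
  set V : ℕ → ℕ → ℕ → ℝ := fun m =>
    if m = 1 then e 1 else fun i j => (e m i j + e (m - 1) i j) / 2 with hV
  have hmem : ∀ m ≤ N, (m : ℝ) * τ ∈ Icc 0 T := fun m hm =>
    ⟨by positivity, by rw [← hNT]; gcongr⟩
  have hwb : ∀ m ≤ N, VanishesOnBdry Mx My (w m) := fun m hm i hi j hj hb =>
    h.boundary _ _ _ (D.pt_mem_bdry hMx hMy hi hj hb) (hmem m hm)
  have heb : ∀ m ≤ N, VanishesOnBdry Mx My (e m) := fun m hm i hi j hj hb => by
    simp only [he, Pi.sub_apply]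
    rw [hwb m hm i hi j hj hb, hU.boundary m hm i hi j hj hb, sub_zero]
  -- Both arguments of `f` are `0` at boundary points, so the difference vanishes whatever `f 0` is.
  have hGb : ∀ m ≤ N, VanishesOnBdry Mx My (G m) := fun m hm i hi j hj hb => by
    simp only [hG]
    rw [hwb m hm i hi j hj hb, hU.boundary m hm i hi j hj hb, sub_self]
  have hVb : ∀ m ≤ N, VanishesOnBdry Mx My (V m) := fun m hm i hi j hj hb => by
    simp only [hV]
    split_ifs with hm1
    · exact heb 1 (hm1 ▸ hm) i hi j hj hb
    · change (e m i j + e (m - 1) i j) / 2 = 0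
      rw [heb m hm i hi j hj hb, heb (m - 1) (by omega) i hi j hj hb]; norm_num
  set x : ℕ → ℝ := fun m => D.gridNorm Mx My (e m) with hx
  set p : ℕ → ℕ → ℝ := fun k m => D.testAgainst Mx My (e m) (avg Mx My (e k)) with hp
  set P : ℕ → ℕ → ℝ := fun k m => D.testAgainst Mx My (V m) (avg Mx My (e k)) with hP
  set R : ℝ := abelPrimitive a T * (3 * C * (D.stepX Mx ^ 4 + D.stepY My ^ 4)) with hR
  have hR0 : 0 ≤ R := by positivity
  set QL := √((D.rx - D.lx) * (D.ry - D.ly)) with hQL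
  have hQL0 : 0 ≤ QL := Real.sqrt_nonneg _
  -- The absolute value secures `ρ m ≥ 0` also at `m = 0`; on the levels `m ≥ 1` that are summed it
  -- has no effect.
  set ρ : ℕ → ℝ := fun m => QL * |truncBound T a Qg Qf C Kf τ m + R| with hρ
  have hVx : ∀ m, 1 ≤ m → ∀ X, (∀ k ≤ m, x k ≤ X) → D.gridNorm Mx My (V m) ≤ X := by
    intro m hm X hX
    simp only [hV]
    split_ifs with hm1
    · exact hX 1 hm
    · exact D.gridNorm_mean_le (hX m le_rfl) (hX (m - 1) (by omega))
  have hsum : ∑ m ∈ Finset.Icc 1 N, τ * ρ m ≤ QL * (τ ^ 2 * truncConst T a Qg Qf C Kf + T * R) := by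
    have : ∑ m ∈ Finset.Icc 1 N, τ * ρ m
        = QL * (∑ m ∈ Finset.Icc 1 N, τ * truncBound T a Qg Qf C Kf τ m + T * R) := by
      have hTR : T * R = ∑ m ∈ Finset.Icc 1 N, τ * R := by
        rw [Finset.sum_const, Nat.card_Icc, Nat.add_sub_cancel, nsmul_eq_mul,
          ← mul_assoc (N : ℝ), hNT]
      rw [hTR, ← Finset.sum_add_distrib, Finset.mul_sum]
      refine Finset.sum_congr rfl fun m hm => ?_
      rw [Finset.mem_Icc] at hm
      simp only [hρ]
      rw [abs_of_nonneg (add_nonneg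
        (truncBound_nonneg hT.le ha0 hQg hQf hC hKf hτ hm.1) hR0)]
      ring
    rw [this]
    have := sum_truncBound_le ha0 hQg hQf hC hKf hτ hN hNT
    gcongr
  have hq : 0 ≤ weightConst T Qg := by
    have := powVar_mono (kernelConst_nonneg hT.le hQg) (one_half_pos (α := ℝ)) (mem_Ici.2 le_rfl)
      (mem_Ici.2 hT.le) hT.le
    rw [powVar_zero _ one_half_pos] at this
    unfold weightConst
    linarith
  have hτT : τ ≤ T := by
    have : (1 : ℝ) ≤ N := by exact_mod_cast hN
    rw [← hNT]
    nlinarith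
  have key := energy_estimate (N := N) (τ := τ) (T := T) (c := 4 / 9) (c₀ := leadCoeff α τ)
    (K := Qf * abelPrimitive a T) (q := weightConst T Qg) (x := x) (ρ := ρ)
    -- Only the weights with index below `N` occur. The cut matters for `N = 1`, where `w̃_1` would
    -- involve `g` beyond `T`.
    (w := fun m => if m < N then gWeightTilde α τ m else 0)
    (l := fun m => -D.testAgainst Mx My (V m)
      (fun i j => piRule a τ m (fun k => D.lap Mx My (e k) i j)))
    (F := fun m => D.testAgainst Mx My (V m)
      (fun i j => piRule a τ m (fun k => avg Mx My (G k) i j) + r m i j)) (p := p) (P := P)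
    hτ hNT.le (by norm_num) (hg.half_le_leadCoeff hτ hτT hsmall) (by positivity) hq
    (fun m => D.gridNorm_nonneg) ?_ (fun m => by positivity) ?_ ?_ ?_ ?_ ?_ ?_ ?_ ?_ ?_ ?_ n hn
  · refine key.trans ?_
    have e1 : (8 : ℝ) / (4 / 9) = 18 := by norm_num
    have e2 : ∀ z : ℝ, 8 * z / (4 / 9) = 18 * z := fun z => by ring
    rw [e1, e2]
    gcongr
  · -- the initial error vanishes
    have : x 0 ≤ 0 * D.gridNorm Mx My (e 0) := D.gridNorm_le_mul le_rfl fun i j hi0 hi hj0 hj => by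
      simp only [he, Pi.sub_apply, hwdef, Rectangle.sample, Nat.cast_zero, zero_mul]
      rw [h.initial _ _ (D.pt_mem_closed hMx hMy hi.le hj.le), hU.initial i j hi0 hi hj0 hj, sub_self,
        abs_zero]
    rw [zero_mul] at this
    exact le_antisymm this D.gridNorm_nonneg
  · intro k m hk hm
    simp only [hp, D.testAgainst_apply]
    rw [gridSum_avg_comm (heb k hk) (heb m hm)]
  · exact fun k m hk _ => D.abs_testAgainst_avg_le (heb k hk)
  · intro m hm
    simp only [hp, hx, D.testAgainst_apply]
    rw [D.gridNorm_sq, mul_left_comm]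
    exact mul_le_mul_of_nonneg_left (le_gridSum_avg_self (heb m hm)) (D.step_mul_nonneg Mx My)
  · intro k
    simp only [hP, hp, hV, if_true]
  · intro k m hm
    simp only [hP, hp, hV]
    rw [if_neg (by omega)]
    exact D.testAgainst_mean Mx My _ _ _
  · rcases lt_or_ge N 2 with hN2 | hN2
    · rw [show N - 2 = 0 by omega, if_neg (by omega)]
      simp only [Finset.range_zero, Finset.sum_empty, abs_zero, add_zero]
      positivity
    · rw [if_pos (by omega)]
      refine le_trans (le_of_eq ?_) (hg.variation_gWeightTilde_le hτ hN2 hNT.le)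
      congr 1
      refine Finset.sum_congr rfl fun j hj => ?_
      rw [Finset.mem_range] at hj
      rw [if_pos (by omega), if_pos (by omega)]
  · intro m hm1 hm
    have h3 := D.testAgainst_congr (w := V m) (heq m hm1 hm)
    have h4 := map_sub (D.testAgainst Mx My (V m))
      (fun i j => memoryOp (leadCoeff α τ) τ (gWeightTilde α τ) m (fun k => avg Mx My (e k) i j))
      (fun i j => piRule a τ m (fun k => D.lap Mx My (e k) i j))
    have h5 := map_memoryOp (D.testAgainst Mx My (V m)) (leadCoeff α τ) τ (gWeightTilde α τ) m
      (fun k => avg Mx My (e k))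
    have h6 : ∑ k ∈ Finset.Icc 1 (m - 1), (if m - k < N then gWeightTilde α τ (m - k) else 0)
          * ((P k m - P (k - 1) m) / τ)
        = ∑ k ∈ Finset.Icc 1 (m - 1), gWeightTilde α τ (m - k) * ((P k m - P (k - 1) m) / τ) := by
      refine Finset.sum_congr rfl fun k hk => ?_
      rw [Finset.mem_Icc] at hk
      rw [if_pos (by omega)]
    rw [h6, ← sub_eq_add_neg]
    rw [h5] at h4
    exact h4.symm.trans h3
  -- Positive type of the weights in time combined with the sum-of-squares form of `-Λ` in space.
  · intro m hm
    have hpos := posWeighted_neg_gridSum_lap (Mx := Mx) (My := My) D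
      (piWeight_posWeighted ha0 ha1 hτ m) (V := V)
      (fun k hk => hVb k (by rw [Finset.mem_Icc] at hk; omega))
    have hpos' := hpos.const_mul (D.step_mul_nonneg Mx My)
    unfold PosWeighted at hpos'
    refine hpos'.trans_eq (Finset.sum_congr rfl fun k hk => ?_)
    rw [Finset.mem_Icc] at hk
    rw [map_piRule, piRule_eq_sum hk.1, ← Finset.sum_neg_distrib]
    refine Finset.sum_congr rfl fun j hj => ?_
    rw [← mul_neg]
    congr 1
    change D.stepX Mx * D.stepY My * -gridSum Mx My (D.lap Mx My (V j)) (V k) = _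
    rcases eq_or_ne j 1 with rfl | hj1
    · rw [if_pos rfl, show V 1 = e 1 from if_pos rfl, D.testAgainst_apply, mul_neg]
    · rw [if_neg hj1, show V j = fun i l => (e j i l + e (j - 1) i l) / 2 from if_neg hj1, mul_neg]
      exact congrArg Neg.neg (D.testAgainst_lap_mean Mx My (V k) (e j) (e (j - 1)))
  · intro m hm1 hm X hX
    have hX0 : 0 ≤ X := D.gridNorm_nonneg.trans (hX 0 (by omega))
    have hVm := hVx m hm1 X hX
    have h3 := map_add (D.testAgainst Mx My (V m))
      (fun i j => piRule a τ m (fun k => avg Mx My (G k) i j)) (r m)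
    rw [map_piRule] at h3
    have h4 : |piRule a τ m (fun k => D.testAgainst Mx My (V m) (avg Mx My (G k)))|
        ≤ abelPrimitive a T * (Qf * X * X) := by
      refine abs_piRule_le ha0 hτ hm1 (hmem m hm).2 fun k hk1 hk => ?_
      refine (D.abs_testAgainst_avg_le (hGb k (hk.trans hm))).trans ?_
      refine mul_le_mul ?_ hVm D.gridNorm_nonneg (by positivity)
      refine (D.gridNorm_le_mul (w := e k) hQf fun i j _ _ _ _ => hf.abs_sub_le _ _).trans ?_
      exact mul_le_mul_of_nonneg_left (hX k hk) hQf
    have h5 : |D.testAgainst Mx My (V m) (r m)| ≤ ρ m * X := by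
      refine D.abs_testAgainst_le.trans ?_
      refine mul_le_mul ?_ hVm D.gridNorm_nonneg (by positivity)
      exact D.gridNorm_le_of_abs_le (abs_nonneg _) hMx hMy fun i j hi0 hi hj0 hj =>
        (hr m hm1 hm i j hi0 hi hj0 hj).trans (le_abs_self _)
    have h6 : D.testAgainst Mx My (V m)
        (fun i j => piRule a τ m (fun k => avg Mx My (G k) i j) + r m i j)
        = piRule a τ m (fun k => D.testAgainst Mx My (V m) (avg Mx My (G k)))
          + D.testAgainst Mx My (V m) (r m) := h3
    simp only [h6]
    refine (abs_add_le _ _).trans ((add_le_add h4 h5).trans_eq ?_)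
    ring
  · linarith

end

end DiffusionWave

/-! ### Nonnegativity of the constants and the final choice of `Q` and `δ`. -/

namespace DiffusionWave

theorem weightConst_nonneg {T Qg : ℝ} (hT : 0 ≤ T) (hQg : 0 ≤ Qg) : 0 ≤ weightConst T Qg := by
  have := kernelConst_nonneg hT hQg
  unfold weightConst powVar
  positivity

theorem truncConst_nonneg {T a Qg Qf C Kf : ℝ} (hT : 0 ≤ T) (ha : 0 < a) (hQg : 0 ≤ Qg)
    (hQf : 0 ≤ Qf) (hC : 0 ≤ C) (hKf : 0 ≤ Kf) : 0 ≤ truncConst T a Qg Qf C Kf := by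
  have h1 := forcingConst_nonneg (a := a) hT hQf hC hKf
  have h2 := forcingLip_nonneg (a := a) hT hQf hC
  have h3 := kernelConst_nonneg hT hQg
  have h4 := abelPrimitive_nonneg ha hT
  unfold truncConst powVar
  positivity

end DiffusionWave

theorem theorem4p3 :
    -- every admissible exponent has a constant `Qg`
    (∀ (T Qα : ℝ) (α : ℝ → ℝ), 0 < T → DiffusionWave.IsAdmissibleExponent T Qα α →
      ∃ Qg > 0, DiffusionWave.IsKernelConstant T α Qg) ∧
    -- the error bound; `Q` and `δ` depend only on the seven constants listed first
    (∀ T a Qg Qf QL C Kf : ℝ, 0 < T →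
      ∃ Q > 0, ∃ δ > 0,
        ∀ (D : DiffusionWave.Rectangle) (Qα : ℝ) (α f : ℝ → ℝ) (u₀ v₀ : ℝ → ℝ → ℝ)
          (u : ℝ → ℝ → ℝ → ℝ),
          Real.sqrt ((D.rx - D.lx) * (D.ry - D.ly)) = QL →
          DiffusionWave.IsAdmissibleExponent T Qα α →
          α 0 - 1 = a →
          DiffusionWave.IsKernelConstant T α Qg →
          DiffusionWave.IsAdmissibleSource Qf f →
          DiffusionWave.IsSolution D T α f u₀ v₀ u →
          DiffusionWave.RegularityA1 D T (α 0) C u →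
          DiffusionWave.RegularityA2 D T (α 0) C u →
          (∀ x y t, (x, y) ∈ D.closed → t ∈ Set.Icc 0 T → |iteratedDeriv 2 f (u x y t)| ≤ Kf) →
          ∀ (N Mx My : ℕ) (U : ℕ → ℕ → ℕ → ℝ), 0 < N → 0 < Mx → 0 < My →
            T / N ≤ δ → D.stepX Mx ≤ δ → D.stepY My ≤ δ →
            DiffusionWave.IsSchemeSolution D T α f u₀ v₀ N Mx My U →
            ∀ n, 1 ≤ n → n ≤ N →
              D.gridNorm Mx My (fun i j => u (D.ptX Mx i) (D.ptY My j) (n * (T / N)) - U n i j)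
                ≤ Q * ((T / N) ^ 2 + D.stepX Mx ^ 4 + D.stepY My ^ 4)) := by
  refine ⟨fun T Qα α hT hα => hα.exists_kernelConstant hT, fun T a Qg Qf QL C Kf hT => ?_⟩
  -- The constants are quantified before the data. If one of these sign conditions fails, no data
  -- satisfy the hypotheses and any `Q`, `δ` will do.
  by_cases hpos : 0 < a ∧ 0 ≤ Qg ∧ 0 ≤ Qf ∧ 0 ≤ QL ∧ 0 ≤ C ∧ 0 ≤ Kf
  · obtain ⟨ha, hQg, hQf, hQL, hC, hKf⟩ := hpos
    have hB := DiffusionWave.abelPrimitive_nonneg ha hT.le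
    have hW := DiffusionWave.weightConst_nonneg hT.le hQg
    have hR := DiffusionWave.truncConst_nonneg (Qg := Qg) hT.le ha hQg hQf hC hKf
    set B := DiffusionWave.abelPrimitive a T
    set W := DiffusionWave.weightConst T Qg
    set R := DiffusionWave.truncConst T a Qg Qf C Kf
    have hden : 0 < 1 + Qg + 18 * (Qf * B + W) := by positivity
    -- `Q` adds the coefficients of the time and space errors, and the final `+ 1` makes it
    -- positive. The choice of `δ` implies both smallness conditions on `τ` in `gridNorm_error_le`.
    refine ⟨18 * (QL * (R + T * (B * (3 * C)))) * Real.exp (18 * (Qf * B + W) * T) + 1, by positivity,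
      1 / (1 + Qg + 18 * (Qf * B + W)), by positivity, ?_⟩
    intro D Qα α f u₀ v₀ u hL hα hαa hg hf h h1 h2 hK N Mx My U hN hMx hMy hδ _ _ hU n _ hn
    have hτ : 0 ≤ T / N := by positivity
    rw [le_div_iff₀ hden] at hδ
    have hp1 : 0 ≤ T / N * Qg := by positivity
    have hp2 : 0 ≤ T / N * (18 * (Qf * B + W)) := by positivity
    have hx := D.stepX_pos hMx
    have hy := D.stepY_pos hMy
    refine (DiffusionWave.gridNorm_error_le hT hα hαa hg hf h h1 h2 hK hN hMx hMy
      (by linarith) (by linarith) hU hn).trans ?_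
    rw [hL]
    set E := Real.exp (18 * (Qf * B + W) * T)
    have hE : 0 < E := Real.exp_pos _
    set S := D.stepX Mx ^ 4 + D.stepY My ^ 4 with hS
    have hS0 : 0 ≤ S := by positivity
    have hq1 : 0 ≤ 18 * (QL * (R * S)) * E := by positivity
    have hq2 : 0 ≤ 18 * (QL * (T * (B * (3 * C)) * (T / N) ^ 2)) * E := by positivity
    have hq3 : 0 ≤ (T / N) ^ 2 + S := by positivity
    -- The two mixed products and the term from `+ 1` are nonnegative; adding them completes the
    -- factorization.
    rw [add_assoc, ← hS]
    calc 18 * (QL * ((T / N) ^ 2 * R + T * (B * (3 * C * S)))) * E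
        ≤ 18 * (QL * ((T / N) ^ 2 * R + T * (B * (3 * C * S)))) * E
          + 18 * (QL * (R * S)) * E + 18 * (QL * (T * (B * (3 * C)) * (T / N) ^ 2)) * E
          + ((T / N) ^ 2 + S) := by linarith
      _ = _ := by ring
  · refine ⟨1, one_pos, 1, one_pos, ?_⟩
    intro D Qα α f u₀ v₀ u hL hα hαa hg hf h h1 h2 hK
    have h00 : (0 : ℝ) ∈ Set.Icc 0 T := ⟨le_rfl, hT.le⟩
    exact absurd ⟨by linarith [(hα.range 0 h00).1], hg.nonneg hT.le, hf.nonneg,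
      hL ▸ Real.sqrt_nonneg _, h1.bound_t.nonneg hT,
      (abs_nonneg _).trans (hK D.lx D.ly 0 ⟨⟨le_rfl, D.hx.le⟩, le_rfl, D.hy.le⟩ h00)⟩ hpos
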